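/- **Theorem 3.2 (Differential systems).** Let $V$ be a vertex operator algebra over $\mathbb C$. All modules are $V$-modules $W=\bigoplus_{m\in\mathbb N}W_{(m)}$ with an $\mathbb N$-grading such that $\alpha_kW_{(m)}\subseteq W_{(m+\mathrm{wt}(\alpha)-k-1)}$ for homogeneous $\alpha \in V$ and $k\in\mathbb Z$; we write $\mathrm{gr}(w)=m$ for $0\ne w\in W_{(m)}$. Put $C_1(W)=\mathrm{span}\{\alpha_{-1}w: w\in W,\ \alpha\in V,\ \mathrm{wt}(\alpha)\ge 1\}$; $W$ is $C_1$-cofinite if $\dim W/C_1(W)<\infty$. Put $W^\vee_{(\le N)}=\bigoplus_{m\le N}\mathrm{Hom}(W_{(m)},\mathbb C)$. Let $A,B,C$ be $C_1$-cofinite. A fusion product is a pair of an $\mathbb N$-gradable module and a logarithmic intertwining operator $\mathcal Y(v,z)=\sum_{h=0}^{K}\mathcal Y_h(v,z)\log^h z$ that is universal for $\mathbb N$-gradable modules. Let $(B\boxtimes C,\mathcal Y^{BC})$, $(A\boxtimes(B\boxtimes C),\mathcal Y^{A(BC)})$, $(A\boxtimes B,\mathcal Y^{AB})$, $((A\boxtimes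 B)\boxtimes C,\mathcal Y^{(AB)C})$ be fusion products, let $T$ denote $A\boxtimes(B\boxtimes C)$ or $(A\boxtimes B)\boxtimes C$ with an $\mathbb N$-grading, and for $\theta\in T^\vee_{(\le N)}$, $v\in A$, $u\in B$, $w\in C$ put, respectively, $$F_{h,k}(\theta,v,u,w;x,y)=\langle\theta,\mathcal Y^{A(BC)}_h(v,x)\mathcal Y^{BC}_k(u,y)w\rangle,\qquad F_{h,k}(\theta,v,u,w;x,y)=\langle\theta,\mathcal Y^{(AB)C}_h(\mathcal Y^{AB}_k(v,x-y)u,y)w\rangle ,$$ formal series with complex exponents in $x,y$, respectively in $x-y,y$. Then $T^\vee_{(\le N)}$ is finite dimensional for every $N$, and in $F_{h,k}$ every power of one of the two variables occurs with only finitely many powers of the other. Let $J_{P_A}\subseteq J_{\tilde P_A}$ be finite linearly independent sets of homogeneous elements of $A$, where $J_{P_A}$ is a basis of a complement $P_A$ of $C_1(A)$; likewise for $B$ and $C$. Let $N\in\mathbb N$, let $J_N$ be a basis of $T^\vee_{(\le N)}$ of homogeneous functionals, and let $\mathcal J_N=J_N\times J_{\tilde P_A}\times J_{\tilde P_B}\times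 J_{\tilde P_C}\supseteq\mathcal J_N^0=J_N\times J_{P_A}\times J_{P_B}\times J_{P_C}$. Let $K^2$ be the finite set of pairs $(h,k)$ of powers of the two logarithms, bounded by the respective $K$'s. For $\xi=(\theta,v,u,w)$ let $g(\xi)=\mathrm{gr}(v)+\mathrm{gr}(u)+\mathrm{gr}(w)$. 1. Fix $x_0\neq0$ and a value of $\log x_0$. There is a matrix $\Lambda^{34}(x_0,y)$, indexed by $\mathcal J_N\times K^2$, with entries in $\mathbb C[y,(x_0-y)^{-1}]$ (so holomorphic on the disc $\mathbb D_{|x_0|}(0)$) and vanishing in all columns outside $\mathcal J_N^0\times K^2$, such that $G^y=\big(F_{h,k}(\xi;x_0,y)\,y^{g(\xi)}\big)_{\xi\in\mathcal J_N,(h,k)\in K^2}$ satisfies the Fuchsian system $$\frac{d}{dy}G^y=\frac{\Lambda^{34}(x_0,y)}{y}\,G^y .$$ 2. Fix $y_0\ne0$ and a value of $\log y_0$. There is a matrix $\Lambda^{23}(x,y_0)$, indexed by $\mathcal J_N\times K^2$, with entries in $\mathbb C[x,x^{-1}]$ (so holomorphic on $\mathbb D_{|y_0|}(y_0)$) and vanishing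 in all columns outside $\mathcal J_N^0\times K^2$, such that $G^{x-y}=\big(F_{h,k}(\xi;x,y_0)\,(x-y_0)^{g(\xi)}\big)_{\xi\in\mathcal J_N,(h,k)\in K^2}$ satisfies the Fuchsian system $$\frac{d}{dx}G^{x-y}=\frac{\Lambda^{23}(x,y_0)}{x-y_0}\,G^{x-y}.$$ The equations are identities of formal series: for $T=A\boxtimes(B\boxtimes C)$, (1) in powers of $y$ and (2) in powers of $x$; for $T=(A\boxtimes B)\boxtimes C$, (1) in powers of $x_0-y$ and (2) in powers of $x-y_0$. In (1) for $A\boxtimes(B\boxtimes C)$ and (2) for $(A\boxtimes B)\boxtimes C$ the coefficients are expanded at the pole; in the two other cases the equation is multiplied by $y$, respectively $x-y_0$. 3. The matrices can be chosen so that their residues have the following nonzero eigenvalues (without multiplicities) whenever $\mathcal J_N^0\ne\emptyset$. There are a finite set $E_{B,C}\subset\mathbb C$, depending only on the graded modules $B,C$, and a finite set $E_{A,B}\subset\mathbb C$, depending only on the graded modules $A,B$, such that the set of nonzero eigenvalues of $\Lambda^{34}(x_0,0)$ is $\{e+\mathrm{gr}(v): e\in E_{B,C},\ v\in J_{P_A}\}\setminus\{0\}$,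 and that of $\Lambda^{23}(y_0,y_0)$ is $\{e+\mathrm{gr}(w): e\in E_{A,B},\ w\in J_{P_C}\}\setminus\{0\}$, with the same sets $E$ for both choices of $T$. In particular, for given $A,B,C$ these sets do not depend on $N$, $x_0$, $y_0$, the basis $J_N$ or the bases $J_{\tilde P}$, and so are determined by $J_{P_A}$ and $J_{P_B}$. -/

import Mathlib

open scoped LaurentPolynomial

universe v u

noncomputable section

/-! ## Vertex operator algebras and their modules -/

/-- A vertex operator algebra over `ℂ`, given by its modes `mode α n = αₙ`, where
`Y(α, z) = ∑ αₙ z^(-n-1)`.  The weight spaces are the eigenspaces of `L(0) = ω₁` with integral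
eigenvalue; they span, are finite dimensional and vanish for very negative weights. -/
class VertexOperatorAlgebra (V : Type v) [AddCommGroup V] [Module ℂ V] where
  /-- the modes `αₙ` -/
  mode : V →ₗ[ℂ] (ℤ → Module.End ℂ V)
  /-- the vacuum -/
  vac : V
  /-- the conformal vector `ω`, with `L(n) = ω₍ₙ₊₁₎` -/
  conf : V
  /-- the central charge -/
  charge : ℂ
  truncation : ∀ α β : V, ∃ N : ℤ, ∀ n, N ≤ n → mode α n β = 0
  vac_mode : ∀ (n : ℤ) (β : V), mode vac n β = if n = -1 then β else 0
  creation : ∀ α : V, mode α (-1) vac = α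
  creation_nonneg : ∀ (α : V) (n : ℤ), 0 ≤ n → mode α n vac = 0
  borcherds : ∀ (α β δ : V) (l m n : ℤ),
    ∑ᶠ i : ℕ, ((Ring.choose m i : ℤ) : ℂ) • mode (mode α (l + i) β) (m + n - i) δ =
    ∑ᶠ i : ℕ, ((-1 : ℂ) ^ i * ((Ring.choose l i : ℤ) : ℂ)) •
      (mode α (m + l - i) (mode β (n + i) δ)
        - (-1 : ℂ) ^ l • mode β (n + l - i) (mode α (m + i) δ))
  virasoro : ∀ (m n : ℤ) (β : V),
    mode conf (m + 1) (mode conf (n + 1) β) - mode conf (n + 1) (mode conf (m + 1) β) =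
      ((m : ℂ) - n) • mode conf (m + n + 1) β
        + (if m + n = 0 then ((m : ℂ) ^ 3 - m) / 12 * charge else 0) • β
  derivative : ∀ (α : V) (n : ℤ) (β : V),
    mode (mode conf 0 α) n β = -(n : ℂ) • mode α (n - 1) β
  weights_span : ⨆ n : ℤ, Module.End.eigenspace (mode conf 1) (n : ℂ) = ⊤
  weights_finite : ∀ n : ℤ, FiniteDimensional ℂ (Module.End.eigenspace (mode conf 1) (n : ℂ))
  weights_bounded : ∃ N : ℤ, ∀ n < N, Module.End.eigenspace (mode conf 1) (n : ℂ) = ⊥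

namespace VertexOperatorAlgebra

variable (V : Type v) [AddCommGroup V] [Module ℂ V] [VertexOperatorAlgebra V]

/-- The space `Vₙ` of vectors of weight `n`. -/
def wtSpace (n : ℤ) : Submodule ℂ V :=
  Module.End.eigenspace (mode (conf : V) 1) (n : ℂ)

end VertexOperatorAlgebra

open VertexOperatorAlgebra

/-- A (weak) module over a vertex operator algebra; `vmode α n` is the action of `αₙ`. -/
class VertexModule (V : Type v) [AddCommGroup V] [Module ℂ V] [VertexOperatorAlgebra V]
    (W : Type u) [AddCommGroup W] [Module ℂ W] where
  vmode : V →ₗ[ℂ] (ℤ → Module.End ℂ W)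
  truncation : ∀ (α : V) (w : W), ∃ N : ℤ, ∀ n, N ≤ n → vmode α n w = 0
  vac_mode : ∀ (n : ℤ) (w : W), vmode vac n w = if n = -1 then w else 0
  borcherds : ∀ (α β : V) (w : W) (l m n : ℤ),
    ∑ᶠ i : ℕ, ((Ring.choose m i : ℤ) : ℂ) • vmode (mode α (l + i) β) (m + n - i) w =
    ∑ᶠ i : ℕ, ((-1 : ℂ) ^ i * ((Ring.choose l i : ℤ) : ℂ)) •
      (vmode α (m + l - i) (vmode β (n + i) w)
        - (-1 : ℂ) ^ l • vmode β (n + l - i) (vmode α (m + i) w))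

/-- A `V`-module `W` with an `ℕ`-grading `W = ⨁ₘ W₍ₘ₎` such that
`αₖ W₍ₘ₎ ⊆ W₍ₘ₊wt(α)₋ₖ₋₁₎` (which is `0` for a negative index). -/
structure NGradedModule (V : Type v) [AddCommGroup V] [Module ℂ V]
    [VertexOperatorAlgebra V] where
  carrier : Type u
  [addCommGroup : AddCommGroup carrier]
  [module : Module ℂ carrier]
  [vertexModule : VertexModule V carrier]
  /-- the homogeneous subspace `W₍ₘ₎` -/
  gr : ℕ → Submodule ℂ carrier
  isInternal : DirectSum.IsInternal gr
  vmode_mem : ∀ (n : ℤ), ∀ α ∈ wtSpace V n, ∀ (k : ℤ) (m : ℕ), ∀ w ∈ gr m, ∀ m' : ℕ,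
    (m' : ℤ) = m + n - k - 1 → VertexModule.vmode α k w ∈ gr m'
  vmode_eq_zero : ∀ (n : ℤ), ∀ α ∈ wtSpace V n, ∀ (k : ℤ) (m : ℕ), ∀ w ∈ gr m,
    (m : ℤ) + n - k - 1 < 0 → VertexModule.vmode α k w = 0

attribute [instance] NGradedModule.addCommGroup NGradedModule.module NGradedModule.vertexModule

instance (V : Type v) [AddCommGroup V] [Module ℂ V] [VertexOperatorAlgebra V] :
    CoeSort (NGradedModule.{v, u} V) (Type u) := ⟨NGradedModule.carrier⟩

open VertexModule

section Modules

variable {V : Type v} [AddCommGroup V] [Module ℂ V] [VertexOperatorAlgebra V]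

namespace NGradedModule

/-- `C₁(W)`, the span of all `α₋₁ w` with `w ∈ W` and `α ∈ V` of weight at least `1`. -/
def C1 (W : NGradedModule.{v, u} V) : Submodule ℂ W :=
  Submodule.span ℂ {x | ∃ n : ℤ, 1 ≤ n ∧ ∃ α ∈ wtSpace V n, ∃ w : W, x = vmode α (-1) w}

/-- `W` is `C₁`-cofinite: `dim W / C₁(W) < ∞`. -/
def C1Cofinite (W : NGradedModule.{v, u} V) : Prop :=
  FiniteDimensional ℂ (W ⧸ W.C1)

/-- The grade of a nonzero homogeneous element. -/
def grade (W : NGradedModule.{v, u} V) (w : W) : ℕ := sInf {m | w ∈ W.gr m}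

/-- `W^∨₍≤N₎ = ⨁_{m ≤ N} Hom(W₍ₘ₎, ℂ)`: the functionals vanishing on `W₍ₘ₎` for `m > N`. -/
def dualLE (W : NGradedModule.{v, u} V) (N : ℕ) : Submodule ℂ (Module.Dual ℂ W) where
  carrier := {θ | ∀ m, N < m → ∀ w ∈ W.gr m, θ w = 0}
  add_mem' := fun ha hb m hm w hw => by simp [ha m hm w hw, hb m hm w hw]
  zero_mem' := fun m hm w hw => by simp
  smul_mem' := fun c θ h m hm w hw => by simp [h m hm w hw]

end NGradedModule

/-- A pair of finite families of linearly independent homogeneous elements of `W`: `small` is a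
basis `J_P` of a complement `P` of `C₁(W)`, and `big ⊇ small` is a basis of a finite dimensional
space containing `P`. -/
structure HomogeneousBases (W : NGradedModule.{v, u} V) where
  small : Finset W
  big : Finset W
  small_subset : small ⊆ big
  homogeneous : ∀ w ∈ big, ∃ m, w ∈ W.gr m
  linearIndependent : LinearIndepOn ℂ id (big : Set W)
  isCompl : IsCompl (Submodule.span ℂ (small : Set W)) W.C1

/-- A (finite) basis `J_N` of `W^∨₍≤N₎` consisting of homogeneous functionals. -/
structure DualBasis (W : NGradedModule.{v, u} V) (N : ℕ) where
  elems : Finset (Module.Dual ℂ W)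
  homogeneous : ∀ θ ∈ elems, ∃ n, ∀ m, m ≠ n → ∀ w ∈ W.gr m, θ w = 0
  linearIndependent : LinearIndepOn ℂ id (elems : Set (Module.Dual ℂ W))
  span_eq : Submodule.span ℂ (elems : Set (Module.Dual ℂ W)) = W.dualLE N

/-! ## Logarithmic intertwining operators and fusion products -/

/-- A logarithmic intertwining operator of type `(W; A B)`,
`𝒴(v, z) u = ∑_{h ≤ K} ∑_{s ∈ ℂ} (mode h s v u) z^(-s-1) log^h z`.  The fields `commutator`,
`associator` and `derivative` are the coefficients of `z^(-s-1) log^h z` in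
* `[αₘ, 𝒴(v,z)] = ∑ⱼ (m choose j) 𝒴(αⱼ v, z) z^(m-j)`,
* `𝒴(αₘ v, z) = ∑ⱼ (-1)^j (m choose j) (αₘ₋ⱼ z^j 𝒴(v,z) - (-1)^m 𝒴(v,z) αⱼ z^(m-j))`,
* `𝒴(L(-1) v, z) = d/dz 𝒴(v, z)`. -/
structure LogIntertwiningOperator (A B W : NGradedModule.{v, u} V) where
  /-- a bound for the powers of `log z` -/
  K : ℕ
  mode : ℕ → ℂ → A →ₗ[ℂ] B →ₗ[ℂ] W
  mode_eq_zero : ∀ h, K < h → ∀ s, mode h s = 0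
  truncation : ∀ (h : ℕ) (s : ℂ) (v : A) (u : B), ∃ n₀ : ℕ, ∀ n : ℕ, n₀ ≤ n →
    mode h (s + n) v u = 0
  commutator : ∀ (α : V) (m : ℤ) (h : ℕ) (s : ℂ) (v : A) (u : B),
    vmode α m (mode h s v u) - mode h s v (vmode α m u) =
      ∑ᶠ j : ℕ, ((Ring.choose m j : ℤ) : ℂ) • mode h (s + m - j) (vmode α j v) u
  associator : ∀ (α : V) (m : ℤ) (h : ℕ) (s : ℂ) (v : A) (u : B),
    mode h s (vmode α m v) u =
      ∑ᶠ j : ℕ, ((-1 : ℂ) ^ j * ((Ring.choose m j : ℤ) : ℂ)) •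
        (vmode α (m - j) (mode h (s + j) v u)
          - (-1 : ℂ) ^ m • mode h (s + m - j) v (vmode α j u))
  derivative : ∀ (h : ℕ) (s : ℂ) (v : A) (u : B),
    mode h s (vmode (conf : V) 0 v) u =
      (-s) • mode h (s - 1) v u + ((h : ℂ) + 1) • mode (h + 1) (s - 1) v u

/-- `(W, 𝒴)` is a fusion product of `A` and `B`: every logarithmic intertwining operator from
`A`, `B` to an `ℕ`-gradable module `D` factors through `𝒴` by a unique `V`-homomorphism
`W → D`. -/
def IsFusionProduct {A B W : NGradedModule.{v, u} V}
    (Y : LogIntertwiningOperator A B W) : Prop :=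
  ∀ (D : NGradedModule.{v, u} V) (Y' : LogIntertwiningOperator A B D),
    ∃! φ : W →ₗ[ℂ] D,
      (∀ (α : V) (n : ℤ) (w : W), φ (vmode α n w) = vmode α n (φ w)) ∧
      ∀ (h : ℕ) (s : ℂ) (v : A) (u : B), φ (Y.mode h s v u) = Y'.mode h s v u

/-- The iterated fusion product `A ⊠ (B ⊠ C)` with its intertwining operators. -/
structure RightFusion (A B C : NGradedModule.{v, u} V) where
  /-- `B ⊠ C` -/
  BC : NGradedModule.{v, u} V
  /-- `A ⊠ (B ⊠ C)` -/
  ABC : NGradedModule.{v, u} V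
  YBC : LogIntertwiningOperator B C BC
  YABC : LogIntertwiningOperator A BC ABC
  fusionBC : IsFusionProduct YBC
  fusionABC : IsFusionProduct YABC

/-- The iterated fusion product `(A ⊠ B) ⊠ C` with its intertwining operators. -/
structure LeftFusion (A B C : NGradedModule.{v, u} V) where
  /-- `A ⊠ B` -/
  AB : NGradedModule.{v, u} V
  /-- `(A ⊠ B) ⊠ C` -/
  ABC : NGradedModule.{v, u} V
  YAB : LogIntertwiningOperator A B AB
  YABC : LogIntertwiningOperator AB C ABC
  fusionAB : IsFusionProduct YAB
  fusionABC : IsFusionProduct YABC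

end Modules

/-! ## Formal series with complex exponents -/

/-- A formal series `∑_{e ∈ ℂ} f(e) z^e`, as the function `e ↦ f(e)` of its coefficients. -/
abbrev FormalSeries := ℂ → ℂ

/-- A formal series `∑_{a, b ∈ ℂ} F(a, b) p^a q^b` in two variables. -/
abbrev FormalSeries₂ := ℂ → ℂ → ℂ

namespace FormalSeries

/-- `d/dz`. -/
def deriv (f : FormalSeries) : FormalSeries := fun e => (e + 1) * f (e + 1)

/-- The product with a Laurent polynomial in `z`. -/
def laurentMul (p : ℂ[T;T⁻¹]) (f : FormalSeries) : FormalSeries :=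
  fun e => p.coeff.sum fun n a => a * f (e - n)

/-- The product with the power series `∑ⱼ cⱼ z^j` (used for `f` whose exponents are bounded below
in every class modulo `ℤ`, so that all sums are finite). -/
def powerMul (c : ℕ → ℂ) (f : FormalSeries) : FormalSeries :=
  fun e => ∑ᶠ j : ℕ, c j * f (e - j)

end FormalSeries

namespace FormalSeries₂

/-- Put `p = exp ℓ` in `∑ F(a, b) p^a q^b`, with the branch `p^a = exp (a ℓ)`. -/
def evalFst (ℓ : ℂ) (F : FormalSeries₂) : FormalSeries :=
  fun b => ∑ᶠ a : ℂ, F a b * Complex.exp (a * ℓ)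

/-- Put `q = exp ℓ` in `∑ F(a, b) p^a q^b`, with the branch `q^b = exp (b ℓ)`. -/
def evalSnd (ℓ : ℂ) (F : FormalSeries₂) : FormalSeries :=
  fun a => ∑ᶠ b : ℂ, F a b * Complex.exp (b * ℓ)

/-- Put `p + q = exp ℓ` in `∑ F(a, b) p^a q^b`, that is, `q = exp ℓ - p` with
`q^b = ∑ⱼ (b choose j) exp ((b - j) ℓ) (-p)^j`; the result is a series in `p`. -/
def evalSum (ℓ : ℂ) (F : FormalSeries₂) : FormalSeries :=
  fun e => ∑ᶠ j : ℕ, ∑ᶠ b : ℂ,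
    F (e - j) b * (Ring.choose b j * Complex.exp ((b - j) * ℓ) * (-1) ^ j)

/-- Each power of either variable occurs with only finitely many powers of the other one. -/
def RowColumnFinite (F : FormalSeries₂) : Prop :=
  (∀ a, {b | F a b ≠ 0}.Finite) ∧ ∀ b, {a | F a b ≠ 0}.Finite

end FormalSeries₂

/-- The value of a Laurent polynomial at a nonzero complex number. -/
def laurentValue (p : ℂ[T;T⁻¹]) (c : ℂ) : ℂ := p.coeff.sum fun n a => a * c ^ n

/-- The coefficient of `t^j` in the expansion of `p(c + ε t)` in nonnegative powers of `t`, where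
`(c + ε t)^n = ∑ⱼ (n choose j) c^(n-j) (ε t)^j`. -/
def expansionCoeff (p : ℂ[T;T⁻¹]) (c ε : ℂ) (j : ℕ) : ℂ :=
  p.coeff.sum fun n a => a * (((Ring.choose n j : ℤ) : ℂ) * c ^ (n - (j : ℤ)) * ε ^ j)

/-! ## Fuchsian systems -/

section Fuchsian

variable {ι : Type u} [Fintype ι]

/-- The nonzero eigenvalues (without multiplicities) of a matrix. -/
def nonzeroEigenvalues (M : Matrix ι ι ℂ) : Set ℂ :=
  {μ | μ ≠ 0 ∧ Module.End.HasEigenvalue M.mulVecLin μ}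

/-- `Λ(c + ε t)` (with `ε = ±1`) is the coefficient matrix of a Fuchsian system
`dG/dt = (Λ(c + ε t) / t) G` on the disc `|t| < |c|`: its entries are holomorphic there.  Moreover
only the columns in `I₀` are nonzero, and (unless `I₀` is empty) the nonzero eigenvalues of the
residue matrix, its value at `t = 0`, are the nonzero elements of `S`. -/
structure IsFuchsianMatrix (Λ : Matrix ι ι ℂ[T;T⁻¹]) (c ε : ℂ) (I₀ : Set ι) (S : Set ℂ) :
    Prop where
  holomorphic : ∀ i j,
    DifferentiableOn ℂ (fun t => laurentValue (Λ i j) (c + ε * t)) (Metric.ball 0 ‖c‖)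
  column_eq_zero : ∀ i, ∀ j ∉ I₀, Λ i j = 0
  eigenvalues : I₀.Nonempty →
    nonzeroEigenvalues (Λ.map fun p => laurentValue p c) = {μ | μ ∈ S ∧ μ ≠ 0}

/-- The series `Gᵢ` in the variable `t` satisfy `dG/dt = (Λ(c + ε t) / t) G`, where the
coefficients are expanded in nonnegative powers of `t`. -/
def SolvesAtPole (Λ : Matrix ι ι ℂ[T;T⁻¹]) (c ε : ℂ) (G : ι → FormalSeries) : Prop :=
  ∀ i, (G i).deriv = FormalSeries.laurentMul (LaurentPolynomial.T (-1))
    (∑ j, FormalSeries.powerMul (expansionCoeff (Λ i j) c ε) (G j))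

/-- The series `Gᵢ` in the variable `z` satisfy `(z - c) dG/dz = Λ(z) G`.  In the variable `t`
with `z = c + ε t`, `ε = ±1`, this is `t dG/dt = Λ(c + ε t) G`. -/
def SolvesInVariable (Λ : Matrix ι ι ℂ[T;T⁻¹]) (c : ℂ) (G : ι → FormalSeries) : Prop :=
  ∀ i, FormalSeries.laurentMul (LaurentPolynomial.T 1 - LaurentPolynomial.C c) (G i).deriv =
    ∑ j, FormalSeries.laurentMul (Λ i j) (G j)

end Fuchsian

/-! ## The modified four-point functions -/

section FourPoint

variable {V : Type v} [AddCommGroup V] [Module ℂ V] [VertexOperatorAlgebra V]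
  {A B C : NGradedModule.{v, u} V}

/-- `gr(v) + gr(u) + gr(w)`. -/
def grade₃ (v : A) (u : B) (w : C) : ℕ := A.grade v + B.grade u + C.grade w

/-- The index set `J_N × J_A × J_B × J_C × {0, …, K₁} × {0, …, K₂}`. -/
abbrev FourPointIndex {W : NGradedModule.{v, u} V} {N : ℕ} (J : DualBasis W N)
    (bA : HomogeneousBases A) (bB : HomogeneousBases B) (bC : HomogeneousBases C)
    (K₁ K₂ : ℕ) : Type u :=
  J.elems × bA.big × bB.big × bC.big × Fin (K₁ + 1) × Fin (K₂ + 1)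

/-- The indices whose components in `A`, `B`, `C` lie in the bases of the complements of
`C₁(A)`, `C₁(B)`, `C₁(C)`. -/
def smallIndex {W : NGradedModule.{v, u} V} {N : ℕ} (J : DualBasis W N)
    (bA : HomogeneousBases A) (bB : HomogeneousBases B) (bC : HomogeneousBases C)
    (K₁ K₂ : ℕ) : Set (FourPointIndex J bA bB bC K₁ K₂) :=
  {i | (i.2.1 : A) ∈ bA.small ∧ (i.2.2.1 : B) ∈ bB.small ∧ (i.2.2.2.1 : C) ∈ bC.small}

namespace RightFusion

variable (P : RightFusion A B C)

/-- `⟨θ, 𝒴_h^{A(BC)}(v, x) 𝒴_k^{BC}(u, y) w⟩` as a series in `x` and `y`. -/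
def F (h k : ℕ) (θ : Module.Dual ℂ P.ABC) (v : A) (u : B) (w : C) : FormalSeries₂ :=
  fun a b => θ (P.YABC.mode h (-a - 1) v (P.YBC.mode k (-b - 1) u w))

variable {N : ℕ} (J : DualBasis P.ABC N)
  (bA : HomogeneousBases A) (bB : HomogeneousBases B) (bC : HomogeneousBases C)

abbrev Index : Type u := FourPointIndex J bA bB bC P.YABC.K P.YBC.K

/-- `J⁰_N × K²`. -/
abbrev small : Set (P.Index J bA bB bC) := smallIndex J bA bB bC P.YABC.K P.YBC.K

/-- The vector `F_{h,k}(ξ; x₀, y) y^{gr(v)+gr(u)+gr(w)}`, `x₀ = exp ℓ`, of series in `y`. -/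
def Gy (ℓ : ℂ) : P.Index J bA bB bC → FormalSeries := fun ⟨θ, v, u, w, h, k⟩ =>
  FormalSeries.laurentMul (LaurentPolynomial.T 1 ^ grade₃ v.1 u.1 w.1)
    ((P.F h k θ.1 v.1 u.1 w.1).evalFst ℓ)

/-- The vector `F_{h,k}(ξ; x, y₀) (x - y₀)^{gr(v)+gr(u)+gr(w)}`, `y₀ = exp ℓ`, of series
in `x`. -/
def Gxy (ℓ : ℂ) : P.Index J bA bB bC → FormalSeries := fun ⟨θ, v, u, w, h, k⟩ =>
  FormalSeries.laurentMul
    ((LaurentPolynomial.T 1 - LaurentPolynomial.C (Complex.exp ℓ)) ^ grade₃ v.1 u.1 w.1)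
    ((P.F h k θ.1 v.1 u.1 w.1).evalSnd ℓ)

end RightFusion

namespace LeftFusion

variable (Q : LeftFusion A B C)

/-- `⟨θ, 𝒴_h^{(AB)C}(𝒴_k^{AB}(v, x - y) u, y) w⟩` as a series in `x - y` and `y`. -/
def F (h k : ℕ) (θ : Module.Dual ℂ Q.ABC) (v : A) (u : B) (w : C) : FormalSeries₂ :=
  fun a b => θ (Q.YABC.mode h (-b - 1) (Q.YAB.mode k (-a - 1) v u) w)

variable {N : ℕ} (J : DualBasis Q.ABC N)
  (bA : HomogeneousBases A) (bB : HomogeneousBases B) (bC : HomogeneousBases C)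

abbrev Index : Type u := FourPointIndex J bA bB bC Q.YABC.K Q.YAB.K

/-- `J'⁰_N × K'²`. -/
abbrev small : Set (Q.Index J bA bB bC) := smallIndex J bA bB bC Q.YABC.K Q.YAB.K

/-- The vector `F_{h,k}(ξ; x₀, y) y^{gr(v)+gr(u)+gr(w)}`, `x₀ = exp ℓ`, of series in
`z = x₀ - y`, where `y = x₀ - z`. -/
def Gy (ℓ : ℂ) : Q.Index J bA bB bC → FormalSeries := fun ⟨θ, v, u, w, h, k⟩ =>
  FormalSeries.laurentMul
    ((LaurentPolynomial.C (Complex.exp ℓ) - LaurentPolynomial.T 1) ^ grade₃ v.1 u.1 w.1)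
    ((Q.F h k θ.1 v.1 u.1 w.1).evalSum ℓ)

/-- The vector `F_{h,k}(ξ; x, y₀) (x - y₀)^{gr(v)+gr(u)+gr(w)}`, `y₀ = exp ℓ`, of series
in `x - y₀`. -/
def Gxy (ℓ : ℂ) : Q.Index J bA bB bC → FormalSeries := fun ⟨θ, v, u, w, h, k⟩ =>
  FormalSeries.laurentMul (LaurentPolynomial.T 1 ^ grade₃ v.1 u.1 w.1)
    ((Q.F h k θ.1 v.1 u.1 w.1).evalSnd ℓ)

end LeftFusion

/-- The numbers `e + gr(v)` with `e ∈ E` and `v ∈ J`. -/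
def shiftByGrades (E : Finset ℂ) (W : NGradedModule.{v, u} V) (J : Finset W) : Set ℂ :=
  {μ | ∃ e ∈ E, ∃ w ∈ J, μ = e + (W.grade w : ℂ)}

end FourPoint

end

open scoped TensorProduct

noncomputable section

open VertexOperatorAlgebra VertexModule

/-! ### Finite sums and binomial coefficients at negative integers. -/

section Preliminaries

/-! Let `α` have weight `n ≥ 1` and let `p`, `q`, `s` be inserted at the three points `x`, `y`, `0`
in some order. The commutator and associator formulas trade `α₋₁` on one insertion for modes `αᵢ`,
`i ≥ 0`, on the other two, with coefficients (difference of points)^(-1-i), and for terms in which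
`α₋₁₋ⱼ` is absorbed by the functional `θ`. The new functionals stay in `T^∨₍≤N₎` because `α₋₁₋ⱼ`
raises degrees, and all new insertions have smaller total degree. Let `t = zp - zq` be the local
parameter at the pole. Multiplying by `t` to the total degree absorbs the negative powers of `t`,
and induction on the degree writes every twisted four-point function as a Laurent polynomial
combination of those whose insertions lie in the complements of `C₁` (`WardSystem.act_mem`). Since
`L(-1)` acts as a derivative, `t d/dt` of a twisted function is again such a combination; this is
the Fuchsian system.

For the residue, the Ward identities modulo `t` become relations in `P ⊗ Q` that involve neither `s`
nor `θ` nor `T` (`outerRelation`, `innerRelation`, `WardSystem.twist_relations_mem`). The operator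
`gr ⊗ 1 + 1 ⊗ gr + L(-1) ⊗ 1` preserves their span and so acts on a finite dimensional quotient
(`residueOp`). At `t = 0` the block of small indices is `gr(s)`, plus a lift of this operator, plus
a commuting nilpotent matrix coming from `log t`. Hence the nonzero eigenvalues are the nonzero `e +
gr(s)`, with `e` in a set attached to `P` and `Q` alone. Lifting from the quotient can only add `e =
0`, and dimensions decide whether it does (`exists_residueMatrix`, `residueEigenvalues`).

The same quotient gives all finiteness. After multiplication by `z^(gr u + gr w)`, the coefficient
of `z^e` in `𝒴(u, z) w` satisfies the relations up to terms `α₋₁₋ⱼ` applied to coefficients of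
smaller exponents, and the residue operator acts on it as `e`, up to the logarithm. So exponents lie
in (eigenvalue) + `ℕ`, and modulo `C₁` only the eigenvalues themselves contribute. The first fact
makes the span of the modes `ℕ`-gradable, so that universality forces it to be the whole fusion
product (`LogIntertwiningOperator.modeSpan_eq_top`). The second then shows that fusion products are
`C₁`-cofinite (`LogIntertwiningOperator.c1Cofinite_of_isFusionProduct`), and this can be iterated.
Consequently graded pieces are finite dimensional, `θ` sees only finitely many `L(0)`-weights, and
the four-point series have finitely many total degrees, so that fixing one variable involves finite
sums only.

The two fusion products and the two poles give four instances of one structure, `WardSystem`, over a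
module on which the Laurent polynomials act. -/

theorem finsum_eq_sum_range {M : Type*} [AddCommMonoid M] {f : ℕ → M} {n : ℕ}
    (h : ∀ j, n ≤ j → f j = 0) : ∑ᶠ j, f j = ∑ j ∈ Finset.range n, f j := by
  apply finsum_eq_sum_of_support_subset
  intro j hj
  by_contra hn
  exact hj (h j (by simpa using hn))

theorem Int.choose_neg_one_sub (j i : ℕ) :
    Ring.choose (-1 - (j : ℤ)) i = (-1) ^ i * ((i + j).choose i : ℤ) := by
  have h : (-1 - (j : ℤ)) = -((1 : ℤ) + j) := by ring
  rw [h, Ring.choose_neg]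
  have h2 : ((1 : ℤ) + j + i - 1) = ((i + j : ℕ) : ℤ) := by push_cast; ring
  rw [h2, Ring.choose_natCast, Units.smul_def]
  simp [Int.negOnePow_def]

theorem Int.choose_neg_one (i : ℕ) : Ring.choose (-1 : ℤ) i = (-1) ^ i := by
  simpa using Int.choose_neg_one_sub 0 i

theorem neg_one_pow_mul_choose_neg_one (j : ℕ) :
    ((-1 : ℂ) ^ j * ((Ring.choose (-1 : ℤ) j : ℤ) : ℂ)) = 1 := by
  rw [Int.choose_neg_one]
  push_cast
  rw [← mul_pow]
  simp

end Preliminaries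

/-! ### Consequences of the Borcherds identity for modules. -/

section ModuleBasics

variable {V : Type v} [AddCommGroup V] [Module ℂ V] [VertexOperatorAlgebra V]
variable {W : Type u} [AddCommGroup W] [Module ℂ W] [VertexModule V W]

/-- The Borcherds identity with `l = 0`: the binomial coefficient `choose 0 i` leaves only `i = 0`
on the right. -/
theorem vmode_commutator (α β : V) (m n : ℤ) (w : W) :
    vmode α m (vmode β n w) - vmode β n (vmode α m w) =
      ∑ᶠ i : ℕ, ((Ring.choose m i : ℤ) : ℂ) • vmode (mode α i β) (m + n - i) w := by
  have h := VertexModule.borcherds α β w 0 m n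
  rw [finsum_eq_single (fun i : ℕ => ((-1 : ℂ) ^ i * ((Ring.choose (0 : ℤ) i : ℤ) : ℂ)) • _) 0] at h
  · simpa using h.symm
  · intro i hi
    obtain ⟨k, rfl⟩ := Nat.exists_eq_succ_of_ne_zero hi
    simp

/-- This is `[L(0), L(-2)] = 2 L(-2)` applied to the vacuum, which `L(0)` kills. -/
theorem mode_one_conf : mode (conf : V) 1 conf = (2 : ℂ) • (conf : V) := by
  have h := VertexOperatorAlgebra.virasoro (V := V) 0 (-2) vac
  norm_num at h
  rw [VertexOperatorAlgebra.creation, VertexOperatorAlgebra.creation_nonneg _ 1 (by norm_num)] at h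
  simpa using h

theorem conf_mem_wtSpace : (conf : V) ∈ wtSpace V 2 := by
  rw [wtSpace, Module.End.mem_eigenspace_iff]
  simpa using mode_one_conf (V := V)

theorem mode_conf_zero_mem_wtSpace {n : ℤ} {α : V} (h : α ∈ wtSpace V n) :
    mode conf 0 α ∈ wtSpace V (n + 1) := by
  rw [wtSpace, Module.End.mem_eigenspace_iff] at *
  have := VertexOperatorAlgebra.virasoro (V := V) 0 (-1) α
  norm_num at this
  rw [h, map_smul, sub_eq_iff_eq_add] at this
  rw [this]
  push_cast
  module

theorem mode_neg_two_vac (α : V) : mode α (-2) vac = mode conf 0 α := by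
  have h := VertexOperatorAlgebra.derivative α (-1) (vac : V)
  rw [VertexOperatorAlgebra.creation] at h
  rw [h]
  norm_num

/-- The `L(-1)`-derivative property on modules. -/
theorem vmode_derivative (α : V) (n : ℤ) (w : W) :
    vmode (mode conf 0 α) n w = -(n : ℂ) • vmode α (n - 1) w := by
  -- Since `ω₀ α = α₋₂ vac`, the claim is the Borcherds identity for `α` and the vacuum with `l =
  -- -2`, `m = 0`.
  have h := VertexModule.borcherds α (vac : V) w (-2) 0 n
  rw [finsum_eq_single _ 0] at h
  swap
  · intro i hi
    obtain ⟨k, rfl⟩ := Nat.exists_eq_succ_of_ne_zero hi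
    simp
  simp only [Nat.cast_zero, add_zero, zero_add, Ring.choose_zero_right, sub_zero, Int.cast_one,
    one_smul, mode_neg_two_vac] at h
  rw [h]
  have hc : ∀ i : ℕ, ((-1 : ℂ) ^ i * ((Ring.choose (-2 : ℤ) i : ℤ) : ℂ)) = (i : ℂ) + 1 := by
    intro i
    have := Int.choose_neg_one_sub 1 i
    norm_num at this
    rw [this]
    push_cast
    rw [← mul_assoc, ← mul_pow]
    simp
  simp_rw [hc, VertexModule.vac_mode]
  have h2 : ((-1 : ℂ) ^ (-2 : ℤ)) = 1 := by norm_num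
  rw [h2]
  -- Only the mode `-1` of the vacuum is nonzero: for `n < 0` the first product contributes at `i =
  -- -1 - n`, for `n > 0` the second one at `i = n - 1`, and for `n = 0` neither does.
  rcases lt_trichotomy n 0 with hn | hn | hn
  · obtain ⟨k, rfl⟩ : ∃ k : ℕ, n = -1 - k := ⟨(-1 - n).toNat, by omega⟩
    rw [finsum_eq_single _ k]
    · have e1 : (-1 - (k : ℤ) + k = -1) := by ring
      have e2 : (-1 - (k : ℤ) + -2 - k ≠ -1) := by omega
      have e3 : -2 - (k : ℤ) = -1 - (k : ℤ) - 1 := by ring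
      simp only [e1, e2, if_true, if_false, one_smul, sub_zero, e3]
      push_cast
      congr 1
      ring
    · intro i hi
      have e1 : (-1 - (k : ℤ) + i ≠ -1) := by omega
      have e2 : (-1 - (k : ℤ) + -2 - i ≠ -1) := by omega
      simp [e1, e2]
  · subst hn
    rw [finsum_eq_zero_of_forall_eq_zero]
    · simp
    · intro i
      have e1 : ((0 : ℤ) + i ≠ -1) := by omega
      have e2 : ((0 : ℤ) + -2 - i ≠ -1) := by omega
      simp only [e1, e2, if_false]
      simp
  · obtain ⟨k, rfl⟩ : ∃ k : ℕ, n = 1 + k := ⟨(n - 1).toNat, by omega⟩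
    rw [finsum_eq_single _ k]
    · have e1 : ((1 + (k : ℤ)) + k ≠ -1) := by omega
      have e2 : ((1 + (k : ℤ)) + -2 - k = -1) := by omega
      have e3 : (1 + (k : ℤ)) - 1 = k := by ring
      simp only [e1, e2, if_true, if_false, one_smul, e3, map_zero, zero_sub]
      push_cast
      rw [smul_neg, ← neg_smul]
      congr 1
      ring
    · intro i hi
      have e1 : ((1 + (k : ℤ)) + i ≠ -1) := by omega
      have e2 : ((1 + (k : ℤ)) + -2 - i ≠ -1) := by omega
      simp only [e1, e2, if_false]
      simp

/-- In the commutator with `ω₁` only `ω₀ α` and `ω₁ α = n α` occur, as `choose 1 i` vanishes for `i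
≥ 2`; the derivative property turns the first one into `-(k + 1) αₖ`. -/
theorem vmode_conf_one_comm {n : ℤ} {α : V} (h : α ∈ wtSpace V n) (k : ℤ) (w : W) :
    vmode (conf : V) 1 (vmode α k w) =
      vmode α k (vmode (conf : V) 1 w) + ((n : ℂ) - k - 1) • vmode α k w := by
  rw [← sub_eq_iff_eq_add', vmode_commutator, finsum_eq_sum_range (n := 2)]
  · rw [wtSpace, Module.End.mem_eigenspace_iff] at h
    simp only [Finset.sum_range_succ, Finset.sum_range_zero, Nat.cast_zero, Nat.cast_one, h,
      vmode_derivative, Ring.choose_zero_right, Ring.choose_one_right]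
    have e1 : (1 + k - 0 - 1 : ℤ) = k := by ring
    have e2 : (1 + k - 1 : ℤ) = k := by ring
    rw [e1, e2, map_smul]
    simp only [Pi.smul_apply, LinearMap.smul_apply]
    push_cast
    module
  · intro j hj
    have : Ring.choose (1 : ℤ) j = 0 := by
      have := Ring.choose_natCast (R := ℤ) 1 j
      rw [Nat.cast_one, Nat.choose_eq_zero_of_lt (by omega)] at this
      simpa using this
    simp [this]

theorem vmode_conf_zero_comm (α : V) (k : ℤ) (w : W) :
    vmode (conf : V) 0 (vmode α k w) =
      vmode α k (vmode (conf : V) 0 w) - (k : ℂ) • vmode α (k - 1) w := by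
  have := vmode_commutator (conf : V) α 0 k w
  rw [finsum_eq_single _ 0] at this
  · simp only [Nat.cast_zero, Ring.choose_zero_right, vmode_derivative] at this
    rw [sub_eq_iff_eq_add'] at this
    rw [this]
    simp [sub_eq_add_neg]
  · intro i hi
    obtain ⟨k, rfl⟩ := Nat.exists_eq_succ_of_ne_zero hi
    simp

/-- `α₋₁₋ⱼ` is the `-1` mode of a vector of weight `wt α + j`. -/
theorem exists_vmode_neg_one (W : Type u) [AddCommGroup W] [Module ℂ W] [VertexModule V W] (j : ℕ) :
    ∀ {n : ℤ} {α : V}, α ∈ wtSpace V n → ∃ β ∈ wtSpace V (n + j), ∀ w : W,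
      vmode α (-1 - j) w = vmode β (-1) w := by
  induction j with
  | zero => intro n α h; exact ⟨α, by simpa using h, fun w => by simp⟩
  | succ j ih =>
    intro n α h
    obtain ⟨β, hβ, hw⟩ := ih (mode_conf_zero_mem_wtSpace h)
    -- `β` represents `(ω₀ α)₋₁₋ⱼ = (j + 1) α₋₂₋ⱼ`, hence the factor.
    refine ⟨((j : ℂ) + 1)⁻¹ • β, ?_, fun w => ?_⟩
    · apply Submodule.smul_mem
      have e : n + ((j + 1 : ℕ) : ℤ) = n + 1 + j := by push_cast; ring
      rwa [e]
    · have := vmode_derivative α (-1 - (j : ℤ)) w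
      rw [hw] at this
      rw [map_smul]
      simp only [Pi.smul_apply, LinearMap.smul_apply]
      rw [this, smul_smul]
      have e : (-1 - ((j + 1 : ℕ) : ℤ)) = -1 - (j : ℤ) - 1 := by push_cast; ring
      have e2 : ((j : ℂ) + 1)⁻¹ * -((-1 - (j : ℤ) : ℤ) : ℂ) = 1 := by
        have : ((j : ℂ) + 1) ≠ 0 := by exact_mod_cast Nat.succ_ne_zero j
        push_cast
        field_simp
        ring
      rw [e, e2, one_smul]

theorem exists_vmode_eq_zero (α : V) (w : W) : ∃ n : ℕ, ∀ j : ℕ, n ≤ j → vmode α j w = 0 := by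
  obtain ⟨N, hN⟩ := VertexModule.truncation α w
  exact ⟨N.toNat, fun j hj => hN j (by omega)⟩

end ModuleBasics

/-! ### Graded modules: homogeneous components and generators modulo `C₁`. -/

namespace NGradedModule

variable {V : Type v} [AddCommGroup V] [Module ℂ V] [VertexOperatorAlgebra V]
  (W : NGradedModule.{v, u} V)

theorem vmode_neg_one_mem_gr {n : ℕ} {α : V} (hα : α ∈ wtSpace V n) {m : ℕ} {w : W}
    (hw : w ∈ W.gr m) : vmode α (-1) w ∈ W.gr (m + n) :=
  W.vmode_mem n α hα _ m w hw _ (by push_cast; omega)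

theorem vmode_neg_mem_gr {n : ℕ} {α : V} (hα : α ∈ wtSpace V n) (j : ℕ) {m : ℕ} {w : W}
    (hw : w ∈ W.gr m) : vmode α (-1 - (j : ℤ)) w ∈ W.gr (m + n + j) :=
  W.vmode_mem n α hα _ m w hw _ (by push_cast; omega)

theorem vmode_conf_one_mem_gr {m : ℕ} {w : W} (hw : w ∈ W.gr m) :
    vmode (conf : V) 1 w ∈ W.gr m :=
  W.vmode_mem 2 _ conf_mem_wtSpace _ m w hw _ (by omega)

theorem vmode_conf_zero_mem_gr {m : ℕ} {w : W} (hw : w ∈ W.gr m) :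
    vmode (conf : V) 0 w ∈ W.gr (m + 1) :=
  W.vmode_mem 2 _ conf_mem_wtSpace _ m w hw _ (by push_cast; omega)

/-- For `α` of weight `n`, either `αⱼ w = 0` or it is homogeneous of degree `gr w + n - j - 1`. -/
theorem vmode_nat_mem_gr {n : ℕ} {α : V} (hα : α ∈ wtSpace V n) (j : ℕ) {m : ℕ} {w : W}
    (hw : w ∈ W.gr m) :
    (vmode α (j : ℤ) w = 0) ∨ ∃ k, k + (j + 1) = m + n ∧ vmode α (j : ℤ) w ∈ W.gr k := by
  rcases le_or_gt (j + 1) (m + n) with h | h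
  · exact Or.inr ⟨m + n - (j + 1), by omega, W.vmode_mem n α hα _ m w hw _ (by omega)⟩
  · exact Or.inl (W.vmode_eq_zero n α hα _ m w hw (by omega))

theorem iSup_gr : ⨆ m, W.gr m = ⊤ := W.isInternal.submodule_iSup_eq_top

theorem hom_induction {p : W → Prop} (w : W) (add : ∀ x y, p x → p y → p (x + y))
    (hom : ∀ m, ∀ x ∈ W.gr m, p x) : p w := by
  have h : w ∈ ⨆ m, W.gr m := by rw [W.iSup_gr]; trivial
  exact Submodule.iSup_induction _ (motive := p) h hom (hom 0 0 (Submodule.zero_mem _)) add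

/-- The decomposition of `W` into its homogeneous subspaces. -/
def decomp : W ≃ₗ[ℂ] DirectSum ℕ (fun m => W.gr m) :=
  (LinearEquiv.ofBijective (DirectSum.coeLinearMap W.gr)
    (show Function.Bijective (DirectSum.coeLinearMap W.gr) from W.isInternal)).symm

theorem decomp_of_mem {m : ℕ} {w : W} (hw : w ∈ W.gr m) :
    W.decomp w = DirectSum.lof ℂ ℕ (fun m => W.gr m) m ⟨w, hw⟩ := by
  rw [decomp, LinearEquiv.symm_apply_eq, LinearEquiv.ofBijective_apply,
    DirectSum.coeLinearMap_lof]

variable {M : Type*} [AddCommGroup M] [Module ℂ M]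

/-- The linear map which is given by `f m` on `W₍ₘ₎`, as a linear function of `f`. -/
def glue : (ℕ → (W →ₗ[ℂ] M)) →ₗ[ℂ] (W →ₗ[ℂ] M) where
  toFun f := (DirectSum.toModule ℂ ℕ M fun m => f m ∘ₗ (W.gr m).subtype) ∘ₗ W.decomp.toLinearMap
  map_add' f g := by
    ext w
    induction w using W.hom_induction with
    | add x y hx hy => simp only [map_add, hx, hy]
    | hom m x hx => simp [W.decomp_of_mem hx]
  map_smul' c f := by
    ext w
    induction w using W.hom_induction with
    | add x y hx hy => simp only [map_add, hx, hy]
    | hom m x hx => simp [W.decomp_of_mem hx]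

theorem glue_of_mem (f : ℕ → (W →ₗ[ℂ] M)) {m : ℕ} {w : W} (hw : w ∈ W.gr m) :
    W.glue f w = f m w := by
  simp [glue, W.decomp_of_mem hw]

/-- The projection to `W₍ₘ₎`. -/
def proj (m : ℕ) : W →ₗ[ℂ] W := W.glue fun k => if k = m then LinearMap.id else 0

theorem proj_of_mem {m k : ℕ} {w : W} (hw : w ∈ W.gr k) :
    W.proj m w = if k = m then w else 0 := by
  rw [proj, W.glue_of_mem _ hw]
  split_ifs <;> simp

theorem proj_mem (m : ℕ) (w : W) : W.proj m w ∈ W.gr m := by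
  induction w using W.hom_induction with
  | add x y hx hy => rw [map_add]; exact Submodule.add_mem _ hx hy
  | hom k x hx =>
    rw [W.proj_of_mem hx]
    split_ifs with h
    · exact h ▸ hx
    · exact Submodule.zero_mem _

/-- The grading operator. -/
def degree : W →ₗ[ℂ] W := W.glue fun m => (m : ℂ) • LinearMap.id

theorem degree_of_mem {m : ℕ} {w : W} (hw : w ∈ W.gr m) : W.degree w = (m : ℂ) • w := by
  rw [degree, W.glue_of_mem _ hw]
  simp

theorem eq_of_mem_gr {m k : ℕ} {w : W} (h0 : w ≠ 0) (hm : w ∈ W.gr m) (hk : w ∈ W.gr k) :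
    m = k := by
  by_contra h
  have h1 := W.proj_of_mem (m := k) hm
  have h2 := W.proj_of_mem (m := k) hk
  rw [if_pos rfl] at h2
  rw [if_neg h, h2] at h1
  exact h0 h1

theorem grade_eq {m : ℕ} {w : W} (h0 : w ≠ 0) (hm : w ∈ W.gr m) : W.grade w = m := by
  have : W.grade w ∈ {m | w ∈ W.gr m} := Nat.sInf_mem ⟨m, hm⟩
  exact W.eq_of_mem_gr h0 this hm

/-- The finite set `s` of homogeneous vectors spans `W` modulo `C₁(W)`. -/
def SpansModC1 (s : Finset W) : Prop :=
  (∀ x ∈ s, ∃ m, x ∈ W.gr m) ∧ Submodule.span ℂ (s : Set W) ⊔ W.C1 = ⊤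

/-- A mode `α₋₁₋ⱼ` is the `-1` mode of a vector of the still larger weight `n + j`. -/
theorem vmode_neg_mem_C1 {n : ℕ} (hn : 1 ≤ n) {α : V} (hα : α ∈ wtSpace V n) (j : ℕ) (w : W) :
    vmode α (-1 - (j : ℤ)) w ∈ W.C1 := by
  obtain ⟨β, hβ, h⟩ := exists_vmode_neg_one W j hα
  rw [h]
  exact Submodule.subset_span ⟨_, by omega, β, hβ, w, rfl⟩

variable {W} in
-- Both the chosen generators and `C₁(W)` are graded, so projecting to degree `m` respects the
-- decomposition. As `n ≥ 1`, the vectors `w` in the second summand have degree below `m`; this is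
-- what drives the inductions on the degree.
theorem SpansModC1.gr_le {s : Finset W} (hs : W.SpansModC1 s) (m : ℕ) :
    W.gr m ≤ Submodule.span ℂ {x | x ∈ s ∧ x ∈ W.gr m} ⊔
      Submodule.span ℂ {x | ∃ n : ℕ, 1 ≤ n ∧ ∃ α ∈ wtSpace V n, ∃ k, k + n = m ∧
        ∃ w ∈ W.gr k, x = vmode α (-1) w} := by
  set R := Submodule.span ℂ {x | x ∈ s ∧ x ∈ W.gr m} ⊔
      Submodule.span ℂ {x | ∃ n : ℕ, 1 ≤ n ∧ ∃ α ∈ wtSpace V n, ∃ k, k + n = m ∧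
        ∃ w ∈ W.gr k, x = vmode α (-1) w} with hR
  have key : Submodule.span ℂ (s : Set W) ⊔ W.C1 ≤ R.comap (W.proj m) := by
    apply sup_le
    · rw [Submodule.span_le]
      intro x hx
      obtain ⟨k, hk⟩ := hs.1 x hx
      simp only [SetLike.mem_coe, Submodule.mem_comap, W.proj_of_mem hk]
      split_ifs with h
      · exact Submodule.mem_sup_left (Submodule.subset_span ⟨hx, h ▸ hk⟩)
      · exact Submodule.zero_mem _
    · rw [C1, Submodule.span_le]
      rintro x ⟨n, hn, α, hα, w, rfl⟩
      lift n to ℕ using by omega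
      simp only [SetLike.mem_coe, Submodule.mem_comap]
      induction w using W.hom_induction with
      | add x y hx hy => rw [map_add, map_add]; exact Submodule.add_mem _ hx hy
      | hom k x hx =>
        rw [W.proj_of_mem (W.vmode_neg_one_mem_gr hα hx)]
        split_ifs with h
        · exact Submodule.mem_sup_right
            (Submodule.subset_span ⟨n, by omega, α, hα, k, h, x, hx, rfl⟩)
        · exact Submodule.zero_mem _
  intro w hw
  have := key (show w ∈ _ by rw [hs.2]; trivial)
  rwa [Submodule.mem_comap, W.proj_of_mem hw, if_pos rfl] at this

variable {W} in
/-- A submodule contains the image of `W₍ₘ₎` under a linear map as soon as it contains the images of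
the generators modulo `C₁(W)` and those of the elements `α₋₁ w`. -/
theorem SpansModC1.map_mem {s : Finset W} (hs : W.SpansModC1 s) (f : W →ₗ[ℂ] M)
    (Z : Submodule ℂ M) {m : ℕ} (h1 : ∀ x ∈ s, x ∈ W.gr m → f x ∈ Z)
    (h2 : ∀ n : ℕ, 1 ≤ n → ∀ α ∈ wtSpace V n, ∀ k, k + n = m → ∀ w ∈ W.gr k,
      f (vmode α (-1) w) ∈ Z) {w : W} (hw : w ∈ W.gr m) : f w ∈ Z := by
  have : W.gr m ≤ Z.comap f := (hs.gr_le m).trans <| by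
    apply sup_le <;> rw [Submodule.span_le]
    · rintro x ⟨hx, hx'⟩
      exact h1 x hx hx'
    · rintro x ⟨n, hn, α, hα, k, hk, w, hw, rfl⟩
      exact h2 n hn α hα k hk w hw
  exact this hw

open Classical in
-- The images of the homogeneous vectors span `W / C₁(W)`; a basis extracted from them is finite and
-- lifts to homogeneous vectors.
theorem exists_spansModC1 (h : W.C1Cofinite) : ∃ s : Finset W, W.SpansModC1 s := by
  have : FiniteDimensional ℂ (W ⧸ W.C1) := h
  let H : Set W := {x | ∃ m, x ∈ W.gr m}
  have hH : Submodule.span ℂ (W.C1.mkQ '' H) = ⊤ := by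
    rw [Submodule.span_image, Submodule.map_mkQ_eq_top]
    refine eq_top_iff.2 (le_trans ?_ le_sup_right)
    rw [← W.iSup_gr]
    exact iSup_le fun m x hx => Submodule.subset_span ⟨m, hx⟩
  obtain ⟨t, ht, hspan⟩ : ∃ t : Finset (W ⧸ W.C1), (t : Set _) ⊆ W.C1.mkQ '' H ∧
      Submodule.span ℂ (t : Set (W ⧸ W.C1)) = ⊤ := by
    obtain ⟨b, hb1, hb2, hb3⟩ := exists_linearIndependent ℂ (W.C1.mkQ '' H)
    refine ⟨hb3.setFinite.toFinset, by simpa using hb1, by simpa [hb2] using hH⟩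
  obtain ⟨s, hs, rfl⟩ := (Finset.subset_set_image_iff (f := W.C1.mkQ)).1 ht
  refine ⟨s, fun x hx => hs hx, ?_⟩
  rw [Finset.coe_image, Submodule.span_image] at hspan
  rw [sup_comm]
  exact (Submodule.map_mkQ_eq_top _ _).1 hspan

end NGradedModule

/-! ### Bases of complements of `C₁`. -/

namespace HomogeneousBases

variable {V : Type v} [AddCommGroup V] [Module ℂ V] [VertexOperatorAlgebra V]
  {W : NGradedModule.{v, u} V} (b : HomogeneousBases W)

theorem spansModC1 : W.SpansModC1 b.small :=
  ⟨fun x hx => b.homogeneous x (b.small_subset hx), b.isCompl.sup_eq_top⟩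

theorem ne_zero {x : W} (hx : x ∈ b.big) : x ≠ 0 :=
  b.linearIndependent.ne_zero hx

theorem mem_gr_grade {x : W} (hx : x ∈ b.big) : x ∈ W.gr (W.grade x) := by
  obtain ⟨m, hm⟩ := b.homogeneous x hx
  rwa [W.grade_eq (b.ne_zero hx) hm]

/-- Shows that the size of the residue matrix, and with it the question whether `0` is one of its
eigenvalues, does not depend on the chosen complements. -/
theorem card_small : b.small.card = Module.finrank ℂ (W ⧸ W.C1) := by
  have e := Submodule.quotientEquivOfIsCompl _ _ b.isCompl.symm
  rw [e.finrank_eq]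
  have := (b.linearIndependent.mono (show (b.small : Set W) ⊆ b.big from b.small_subset))
  have := finrank_span_set_eq_card this
  rw [this]
  simp

end HomogeneousBases

/-! ### Leading-order relations in `A ⊗ B` and the residue operator. -/

section Reduction

variable {V : Type v} [AddCommGroup V] [Module ℂ V] [VertexOperatorAlgebra V]
  (A B : NGradedModule.{v, u} V)

/-- The relation obtained by letting `α₋₁` act on `𝒴(u, 1) w` from the outside, to leading order. -/
def outerRelation (α : V) (u : A) (w : B) : A ⊗[ℂ] B :=
  u ⊗ₜ[ℂ] vmode α (-1) w + ∑ᶠ j : ℕ, (-1 : ℂ) ^ j • (vmode α (j : ℤ) u ⊗ₜ[ℂ] w)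

/-- The relation obtained by expanding `𝒴(α₋₁ u, 1) w`, to leading order. -/
def innerRelation (α : V) (u : A) (w : B) : A ⊗[ℂ] B :=
  vmode α (-1) u ⊗ₜ[ℂ] w - ∑ᶠ j : ℕ, u ⊗ₜ[ℂ] vmode α (j : ℤ) w

variable {A B} in
theorem outerRelation_eq {α : V} {u : A} {L : ℕ} (h : ∀ j : ℕ, L ≤ j → vmode α (j : ℤ) u = 0)
    (w : B) : outerRelation A B α u w = u ⊗ₜ[ℂ] vmode α (-1) w +
      ∑ j ∈ Finset.range L, (-1 : ℂ) ^ j • (vmode α (j : ℤ) u ⊗ₜ[ℂ] w) := by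
  rw [outerRelation, finsum_eq_sum_range]
  intro j hj
  simp [h j hj]

variable {A B} in
theorem innerRelation_eq {α : V} {w : B} {L : ℕ} (h : ∀ j : ℕ, L ≤ j → vmode α (j : ℤ) w = 0)
    (u : A) : innerRelation A B α u w = vmode α (-1) u ⊗ₜ[ℂ] w -
      ∑ j ∈ Finset.range L, u ⊗ₜ[ℂ] vmode α (j : ℤ) w := by
  rw [innerRelation, finsum_eq_sum_range]
  intro j hj
  simp [h j hj]

/-- The leading terms of the relations among the matrix elements of an intertwining operator. -/
def relations : Submodule ℂ (A ⊗[ℂ] B) :=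
  Submodule.span ℂ {x | ∃ n : ℕ, 1 ≤ n ∧ ∃ α ∈ wtSpace V n, ∃ a, ∃ u ∈ A.gr a, ∃ b, ∃ w ∈ B.gr b,
    x = outerRelation A B α u w ∨ x = innerRelation A B α u w}

variable {A B} in
theorem outerRelation_mem {n : ℕ} (hn : 1 ≤ n) {α : V} (hα : α ∈ wtSpace V n) {a : ℕ} {u : A}
    (hu : u ∈ A.gr a) {b : ℕ} {w : B} (hw : w ∈ B.gr b) :
    outerRelation A B α u w ∈ relations A B :=
  Submodule.subset_span ⟨n, hn, α, hα, a, u, hu, b, w, hw, Or.inl rfl⟩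

variable {A B} in
theorem innerRelation_mem {n : ℕ} (hn : 1 ≤ n) {α : V} (hα : α ∈ wtSpace V n) {a : ℕ} {u : A}
    (hu : u ∈ A.gr a) {b : ℕ} {w : B} (hw : w ∈ B.gr b) :
    innerRelation A B α u w ∈ relations A B :=
  Submodule.subset_span ⟨n, hn, α, hα, a, u, hu, b, w, hw, Or.inr rfl⟩

/-- The operator `gr ⊗ 1 + 1 ⊗ gr + L(-1) ⊗ 1`. -/
def fusionOp : Module.End ℂ (A ⊗[ℂ] B) :=
  TensorProduct.map A.degree LinearMap.id + TensorProduct.map LinearMap.id B.degree +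
    TensorProduct.map (vmode (conf : V) 0) LinearMap.id

variable {A B} in
theorem fusionOp_tmul {a b : ℕ} {u : A} {w : B} (hu : u ∈ A.gr a) (hw : w ∈ B.gr b) :
    fusionOp A B (u ⊗ₜ w) = ((a : ℂ) + b) • (u ⊗ₜ[ℂ] w) + vmode (conf : V) 0 u ⊗ₜ[ℂ] w := by
  simp only [fusionOp, LinearMap.add_apply, TensorProduct.map_tmul, A.degree_of_mem hu,
    B.degree_of_mem hw, LinearMap.id_apply, TensorProduct.smul_tmul', TensorProduct.tmul_smul,
    add_smul]

variable {A B} in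
-- The term `αⱼ u ⊗ w` has degree `j + 1` less than the leading term. Moving `L(-1)` past `αⱼ`
-- produces `-j αⱼ₋₁`, and after reindexing these terms make up for exactly this deficit.
theorem fusionOp_outerRelation {n : ℕ} {α : V} (hα : α ∈ wtSpace V n) {a b : ℕ} {u : A} {w : B}
    (hu : u ∈ A.gr a) (hw : w ∈ B.gr b) :
    fusionOp A B (outerRelation A B α u w) =
      ((a : ℂ) + b + n) • outerRelation A B α u w +
        outerRelation A B α (vmode (conf : V) 0 u) w := by
  obtain ⟨L₁, hL₁⟩ := exists_vmode_eq_zero α u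
  obtain ⟨L₂, hL₂⟩ := exists_vmode_eq_zero α (vmode (conf : V) 0 u)
  have h1 : ∀ j : ℕ, max L₁ L₂ ≤ j → vmode α (j : ℤ) u = 0 := fun j hj => hL₁ j (by omega)
  have h2 : ∀ j : ℕ, max L₁ L₂ + 1 ≤ j → vmode α (j : ℤ) (vmode (conf : V) 0 u) = 0 :=
    fun j hj => hL₂ j (by omega)
  set L := max L₁ L₂
  have h3 : ∀ j : ℕ, L + 1 ≤ j → vmode α (j : ℤ) u = 0 := fun j hj => h1 j (by omega)
  rw [outerRelation_eq h3, outerRelation_eq h2, map_add, map_sum,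
    fusionOp_tmul hu (B.vmode_neg_one_mem_gr hα hw)]
  have key : ∀ j : ℕ, fusionOp A B (vmode α (j : ℤ) u ⊗ₜ w) =
      ((a : ℂ) + b + n - j - 1) • (vmode α (j : ℤ) u ⊗ₜ[ℂ] w) +
        vmode α (j : ℤ) (vmode (conf : V) 0 u) ⊗ₜ[ℂ] w -
          (j : ℂ) • (vmode α ((j : ℤ) - 1) u ⊗ₜ[ℂ] w) := by
    intro j
    have hD : fusionOp A B (vmode α (j : ℤ) u ⊗ₜ w) =
      ((a : ℂ) + b + n - j - 1) • (vmode α (j : ℤ) u ⊗ₜ[ℂ] w) +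
        vmode (conf : V) 0 (vmode α (j : ℤ) u) ⊗ₜ[ℂ] w := by
      rcases A.vmode_nat_mem_gr hα j hu with h0 | ⟨k, hk, hm⟩
      · simp [h0]
      · rw [fusionOp_tmul hm hw]
        have : (a : ℂ) + n = k + (j + 1) := by exact_mod_cast hk.symm
        congr 2
        linear_combination -this
    rw [hD, vmode_conf_zero_comm, TensorProduct.sub_tmul, TensorProduct.smul_tmul']
    simp only [Int.cast_natCast]
    abel
  -- The shift lowers the index by one, and the term at `L` vanishes by the choice of `L`, so that
  -- both sums may run over the same range.
  have tele : ∑ j ∈ Finset.range (L + 1),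
      (-1 : ℂ) ^ j • ((j : ℂ) • (vmode α ((j : ℤ) - 1) u ⊗ₜ[ℂ] w)) =
      - ∑ j ∈ Finset.range (L + 1), (-1 : ℂ) ^ j •
        (((j : ℂ) + 1) • (vmode α (j : ℤ) u ⊗ₜ[ℂ] w)) := by
    rw [Finset.sum_range_succ', Finset.sum_range_succ _ L, h1 L le_rfl]
    simp only [Nat.cast_zero, zero_smul, smul_zero, add_zero, TensorProduct.zero_tmul]
    rw [← Finset.sum_neg_distrib]
    refine Finset.sum_congr rfl fun j _ => ?_
    push_cast
    rw [add_sub_cancel_right, pow_succ]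
    module
  simp_rw [map_smul, key, smul_sub, smul_add, Finset.sum_sub_distrib, Finset.sum_add_distrib, tele]
  have e : ∑ j ∈ Finset.range (L + 1),
      (-1 : ℂ) ^ j • (((a : ℂ) + b + n - j - 1) • (vmode α (j : ℤ) u ⊗ₜ[ℂ] w)) +
      ∑ j ∈ Finset.range (L + 1), (-1 : ℂ) ^ j • (((j : ℂ) + 1) • (vmode α (j : ℤ) u ⊗ₜ[ℂ] w)) =
      ((a : ℂ) + b + n) • ∑ j ∈ Finset.range (L + 1), (-1 : ℂ) ^ j •
        (vmode α (j : ℤ) u ⊗ₜ[ℂ] w) := by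
    rw [Finset.smul_sum, ← Finset.sum_add_distrib]
    refine Finset.sum_congr rfl fun j _ => ?_
    module
  rw [← e]
  push_cast
  module

variable {A B} in
-- The relation for `ω₀ α` enters because `L(-1) α₋₁ u = α₋₁ L(-1) u + (ω₀ α)₋₁ u`. Its remaining
-- terms contain `(ω₀ α)ⱼ w = -j αⱼ₋₁ w`, which after reindexing compensate the degree deficit `j +
-- 1` of `αⱼ w`. The weight of `ω₀ α` is `n + 1`, so the span of the relations of all weights is
-- needed for invariance.
theorem fusionOp_innerRelation {n : ℕ} {α : V} (hα : α ∈ wtSpace V n) {a b : ℕ} {u : A} {w : B}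
    (hu : u ∈ A.gr a) (hw : w ∈ B.gr b) :
    fusionOp A B (innerRelation A B α u w) =
      ((a : ℂ) + b + n) • innerRelation A B α u w +
        innerRelation A B α (vmode (conf : V) 0 u) w +
          innerRelation A B (mode conf 0 α) u w := by
  obtain ⟨L, h1⟩ := exists_vmode_eq_zero α w
  have h3 : ∀ j : ℕ, L + 1 ≤ j → vmode α (j : ℤ) w = 0 := fun j hj => h1 j (by omega)
  have h4 : ∀ j : ℕ, L + 1 ≤ j → vmode (mode conf 0 α) (j : ℤ) w = 0 := fun j hj => by
    rw [vmode_derivative]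
    have := h1 (j - 1) (by omega)
    rw [Nat.cast_sub (by omega), Nat.cast_one] at this
    rw [this, smul_zero]
  rw [innerRelation_eq h3, innerRelation_eq h3, innerRelation_eq h4, map_sub, map_sum,
    fusionOp_tmul (A.vmode_neg_one_mem_gr hα hu) hw]
  have key : ∀ j : ℕ, fusionOp A B (u ⊗ₜ vmode α (j : ℤ) w) =
      ((a : ℂ) + b + n - j - 1) • (u ⊗ₜ[ℂ] vmode α (j : ℤ) w) +
        vmode (conf : V) 0 u ⊗ₜ[ℂ] vmode α (j : ℤ) w := by
    intro j
    rcases B.vmode_nat_mem_gr hα j hw with h0 | ⟨k, hk, hm⟩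
    · simp [h0]
    · rw [fusionOp_tmul hu hm]
      have : (b : ℂ) + n = k + (j + 1) := by exact_mod_cast hk.symm
      congr 2
      linear_combination -this
  have tele : ∑ j ∈ Finset.range (L + 1), u ⊗ₜ[ℂ] vmode (mode conf 0 α) (j : ℤ) w =
      - ∑ j ∈ Finset.range (L + 1), (((j : ℂ) + 1) • (u ⊗ₜ[ℂ] vmode α (j : ℤ) w)) := by
    simp_rw [vmode_derivative, TensorProduct.tmul_smul]
    rw [Finset.sum_range_succ', Finset.sum_range_succ _ L, h1 L le_rfl]
    simp only [Nat.cast_zero, Int.cast_zero, neg_zero, zero_smul, smul_zero, add_zero,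
      TensorProduct.tmul_zero]
    rw [← Finset.sum_neg_distrib]
    refine Finset.sum_congr rfl fun j _ => ?_
    push_cast
    rw [add_sub_cancel_right]
    module
  have e : ∑ j ∈ Finset.range (L + 1),
      (((a : ℂ) + b + n - j - 1) • (u ⊗ₜ[ℂ] vmode α (j : ℤ) w)) +
      ∑ j ∈ Finset.range (L + 1), (((j : ℂ) + 1) • (u ⊗ₜ[ℂ] vmode α (j : ℤ) w)) =
      ((a : ℂ) + b + n) • ∑ j ∈ Finset.range (L + 1), (u ⊗ₜ[ℂ] vmode α (j : ℤ) w) := by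
    rw [Finset.smul_sum, ← Finset.sum_add_distrib]
    refine Finset.sum_congr rfl fun j _ => ?_
    module
  rw [vmode_conf_zero_comm, TensorProduct.sub_tmul, vmode_derivative, tele,
    smul_sub, ← e]
  simp_rw [key, Finset.sum_add_distrib]
  push_cast
  simp only [← TensorProduct.smul_tmul']
  module

theorem fusionOp_mem_relations :
    relations A B ≤ (relations A B).comap (fusionOp A B) := by
  rw [relations, Submodule.span_le]
  rintro x ⟨n, hn, α, hα, a, u, hu, b, w, hw, rfl | rfl⟩
  · simp only [SetLike.mem_coe, Submodule.mem_comap]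
    rw [fusionOp_outerRelation hα hu hw]
    exact Submodule.add_mem _ (Submodule.smul_mem _ _ (outerRelation_mem hn hα hu hw))
      (outerRelation_mem hn hα (A.vmode_conf_zero_mem_gr hu) hw)
  · simp only [SetLike.mem_coe, Submodule.mem_comap]
    rw [fusionOp_innerRelation hα hu hw]
    refine Submodule.add_mem _ (Submodule.add_mem _
      (Submodule.smul_mem _ _ (innerRelation_mem hn hα hu hw))
      (innerRelation_mem hn hα (A.vmode_conf_zero_mem_gr hu) hw))
      (innerRelation_mem (n := n + 1) (by omega) ?_ hu hw)
    exact_mod_cast mode_conf_zero_mem_wtSpace hα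

/-- The space of leading coefficients, `A ⊗ B` modulo the relations. -/
abbrev FusionQuotient : Type _ := (A ⊗[ℂ] B) ⧸ relations A B

/-- The residue operator. -/
def residueOp : Module.End ℂ (FusionQuotient A B) :=
  (relations A B).mapQ (relations A B) (fusionOp A B) (fusionOp_mem_relations A B)

variable {A B}

theorem tensor_hom_induction {p : A ⊗[ℂ] B → Prop} (x : A ⊗[ℂ] B)
    (add : ∀ x y, p x → p y → p (x + y))
    (hom : ∀ a, ∀ u ∈ A.gr a, ∀ b, ∀ w ∈ B.gr b, p (u ⊗ₜ w)) : p x := by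
  induction x using TensorProduct.induction_on with
  | zero => simpa using hom 0 0 (Submodule.zero_mem _) 0 0 (Submodule.zero_mem _)
  | add x y hx hy => exact add x y hx hy
  | tmul u w =>
    induction u using A.hom_induction with
    | add x y hx hy => rw [TensorProduct.add_tmul]; exact add _ _ hx hy
    | hom a u hu =>
      induction w using B.hom_induction with
      | add x y hx hy => rw [TensorProduct.tmul_add]; exact add _ _ hx hy
      | hom b w hw => exact hom a u hu b w hw

/-- Induction on the total degree: modulo the relations, `α₋₁ u ⊗ w` becomes a sum of `u ⊗ αⱼ w`,
and `u ⊗ α₋₁ w` a sum of `αⱼ u ⊗ w`. All of these have smaller total degree, so only the products of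
generators survive. -/
theorem span_sup_relations {s : Finset A} {t : Finset B} (hs : A.SpansModC1 s)
    (ht : B.SpansModC1 t) :
    Submodule.span ℂ {x : A ⊗[ℂ] B | ∃ p ∈ s, ∃ q ∈ t, x = p ⊗ₜ q} ⊔ relations A B = ⊤ := by
  set Z := Submodule.span ℂ {x : A ⊗[ℂ] B | ∃ p ∈ s, ∃ q ∈ t, x = p ⊗ₜ q} ⊔ relations A B with hZ
  have key : ∀ N : ℕ, ∀ a b, a + b = N → ∀ u ∈ A.gr a, ∀ w ∈ B.gr b, u ⊗ₜ[ℂ] w ∈ Z := by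
    intro N
    induction N using Nat.strong_induction_on with
    | _ N ih =>
      intro a b hab u hu w hw
      refine hs.map_mem ((TensorProduct.mk ℂ A B).flip w) Z ?_ ?_ hu
      · intro p hp hpa
        refine ht.map_mem (TensorProduct.mk ℂ A B p) Z ?_ ?_ hw
        · intro q hq hqb
          exact Submodule.mem_sup_left (Submodule.subset_span ⟨p, hp, q, hq, rfl⟩)
        · intro n hn α hα k hk w' hw'
          have h1 : outerRelation A B α p w' ∈ Z :=
            Submodule.mem_sup_right (outerRelation_mem hn hα hpa hw')
          obtain ⟨L, hL⟩ := exists_vmode_eq_zero α p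
          rw [outerRelation_eq hL] at h1
          refine (Submodule.add_mem_iff_left _ ?_).1 h1
          refine Submodule.sum_mem _ fun j _ => Submodule.smul_mem _ _ ?_
          rcases A.vmode_nat_mem_gr hα j hpa with h0 | ⟨k', hk', hm⟩
          · simp [h0]
          · exact ih (k' + k) (by omega) _ _ rfl _ hm _ hw'
      · intro n hn α hα k hk u' hu'
        have h1 : innerRelation A B α u' w ∈ Z :=
          Submodule.mem_sup_right (innerRelation_mem hn hα hu' hw)
        obtain ⟨L, hL⟩ := exists_vmode_eq_zero α w
        rw [innerRelation_eq hL] at h1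
        refine (Submodule.sub_mem_iff_left _ ?_).1 h1
        refine Submodule.sum_mem _ fun j _ => ?_
        rcases B.vmode_nat_mem_gr hα j hw with h0 | ⟨k', hk', hm⟩
        · simp [h0]
        · exact ih (k + k') (by omega) _ _ rfl _ hu' _ hm
  rw [eq_top_iff]
  rintro x -
  induction x using tensor_hom_induction with
  | add x y hx hy => exact Submodule.add_mem _ hx hy
  | hom a u hu b w hw => exact key _ a b rfl u hu w hw

/-- The map from the coefficient space of `s × t` to the space of leading coefficients. -/
def leadingMap (s : Finset A) (t : Finset B) : (s × t → ℂ) →ₗ[ℂ] FusionQuotient A B :=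
  Fintype.linearCombination ℂ fun x : s × t => (relations A B).mkQ (x.1.1 ⊗ₜ x.2.1)

theorem leadingMap_surjective {s : Finset A} {t : Finset B} (hs : A.SpansModC1 s)
    (ht : B.SpansModC1 t) : Function.Surjective (leadingMap s t) := by
  rw [← LinearMap.range_eq_top, leadingMap, Fintype.range_linearCombination]
  have h := span_sup_relations hs ht
  rw [sup_comm, ← Submodule.map_mkQ_eq_top, Submodule.map_span] at h
  rw [← h]
  congr 1
  ext y
  constructor
  · rintro ⟨x, rfl⟩
    exact ⟨_, ⟨x.1.1, x.1.2, x.2.1, x.2.2, rfl⟩, rfl⟩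
  · rintro ⟨_, ⟨p, hp, q, hq, rfl⟩, rfl⟩
    exact ⟨(⟨p, hp⟩, ⟨q, hq⟩), rfl⟩

theorem finiteDimensional_fusionQuotient (hA : A.C1Cofinite) (hB : B.C1Cofinite) :
    FiniteDimensional ℂ (FusionQuotient A B) := by
  obtain ⟨s, hs⟩ := A.exists_spansModC1 hA
  obtain ⟨t, ht⟩ := B.exists_spansModC1 hB
  exact Module.Finite.of_surjective (leadingMap s t) (leadingMap_surjective hs ht)

variable (A B) in
/-- The eigenvalues of the residue, which only depend on the graded modules. -/
def residueEigenvalues : Set ℂ :=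
  {μ | (residueOp A B).HasEigenvalue μ ∨ (μ = 0 ∧
    Module.finrank ℂ (A ⧸ A.C1) * Module.finrank ℂ (B ⧸ B.C1) ≠
      Module.finrank ℂ (FusionQuotient A B))}

theorem finite_residueEigenvalues (hA : A.C1Cofinite) (hB : B.C1Cofinite) :
    (residueEigenvalues A B).Finite := by
  have := finiteDimensional_fusionQuotient hA hB
  apply Set.Finite.union
  · exact Module.End.finite_hasEigenvalue _
  · exact (Set.finite_singleton 0).subset fun μ h => h.1

/-- `π` maps eigenvectors outside its kernel to eigenvectors of `D`, and `σ` carries eigenvectors of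
`D` back. The kernel of `π` adds the eigenvalue `0`, and it is nonzero exactly when the dimensions
differ, because `π` is surjective. -/
theorem hasEigenvalue_lift_iff {X Q : Type*} [AddCommGroup X] [Module ℂ X] [FiniteDimensional ℂ X]
    [AddCommGroup Q] [Module ℂ Q] [FiniteDimensional ℂ Q]
    {π : X →ₗ[ℂ] Q} {σ : Q →ₗ[ℂ] X} (hσ : π ∘ₗ σ = LinearMap.id) (D : Module.End ℂ Q) (μ : ℂ) :
    Module.End.HasEigenvalue (σ ∘ₗ D ∘ₗ π : Module.End ℂ X) μ ↔
      D.HasEigenvalue μ ∨ (μ = 0 ∧ Module.finrank ℂ X ≠ Module.finrank ℂ Q) := by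
  have hπσ : ∀ q, π (σ q) = q := fun q => LinearMap.congr_fun hσ q
  have hσinj : ∀ q, σ q = 0 → q = 0 := fun q hq => by rw [← hπσ q, hq, map_zero]
  have hsurj : Function.Surjective π := fun q => ⟨σ q, hπσ q⟩
  constructor
  · intro h
    obtain ⟨f, hf⟩ := h.exists_hasEigenvector
    have h1 : σ (D (π f)) = μ • f := hf.apply_eq_smul
    by_cases hp : π f = 0
    · rw [hp, map_zero, map_zero] at h1
      have hμ : μ = 0 := by
        rcases smul_eq_zero.1 h1.symm with h | h
        · exact h
        · exact absurd h hf.2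
      refine Or.inr ⟨hμ, fun he => hf.2 ?_⟩
      have := (LinearMap.injective_iff_surjective_of_finrank_eq_finrank he (f := π)).2 hsurj
      exact this (by rw [hp, map_zero])
    · left
      refine Module.End.hasEigenvalue_of_hasEigenvector (x := π f) ⟨?_, hp⟩
      rw [Module.End.mem_eigenspace_iff, ← hπσ (D (π f)), h1, map_smul]
  · rintro (h | ⟨rfl, h⟩)
    · obtain ⟨q, hq⟩ := h.exists_hasEigenvector
      refine Module.End.hasEigenvalue_of_hasEigenvector (x := σ q)
        ⟨?_, fun h => hq.2 (hσinj q h)⟩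
      rw [Module.End.mem_eigenspace_iff]
      simp only [LinearMap.comp_apply, hπσ, hq.apply_eq_smul, map_smul]
    · have : ¬ Function.Injective π := fun hi =>
        h (LinearEquiv.finrank_eq (LinearEquiv.ofBijective π ⟨hi, hsurj⟩))
      rw [← LinearMap.ker_eq_bot, Submodule.eq_bot_iff] at this
      push Not at this
      obtain ⟨f, hf, hf0⟩ := this
      refine Module.End.hasEigenvalue_of_hasEigenvector (x := f) ⟨?_, hf0⟩
      rw [Module.End.mem_eigenspace_iff]
      simp [LinearMap.mem_ker.1 hf]

theorem hasEigenvalue_transpose {n : Type*} [Fintype n] [DecidableEq n] (M : Matrix n n ℂ) (μ : ℂ) :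
    Module.End.HasEigenvalue M.transpose.mulVecLin μ ↔
      Module.End.HasEigenvalue M.mulVecLin μ := by
  rw [← Matrix.toLin'_apply', ← Matrix.toLin'_apply', Module.End.hasEigenvalue_iff_isRoot_charpoly,
    Module.End.hasEigenvalue_iff_isRoot_charpoly, Matrix.charpoly_toLin', Matrix.charpoly_toLin',
    Matrix.charpoly_transpose]

open Classical in
/-- A matrix of the residue operator on the products of the two bases, with the prescribed
eigenvalues. -/
theorem exists_residueMatrix (hA : A.C1Cofinite) (hB : B.C1Cofinite) (bA : HomogeneousBases A)
    (bB : HomogeneousBases B) :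
    ∃ d : Matrix (bA.small × bB.small) (bA.small × bB.small) ℂ,
      (∀ x, fusionOp A B (x.1.1 ⊗ₜ x.2.1) - ∑ y, d x y • (y.1.1 ⊗ₜ[ℂ] y.2.1) ∈ relations A B) ∧
      ∀ μ, Module.End.HasEigenvalue d.mulVecLin μ ↔ μ ∈ residueEigenvalues A B := by
  have := finiteDimensional_fusionQuotient hA hB
  set π := leadingMap bA.small bB.small with hπ
  -- The products of basis vectors span the quotient but need not be independent in it; the section
  -- picks coordinates, and its choice does not affect the eigenvalues.
  obtain ⟨σ, hσ⟩ := π.exists_rightInverse_of_surjective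
    (LinearMap.range_eq_top.2 (leadingMap_surjective bA.spansModC1 bB.spansModC1))
  set D : Module.End ℂ (bA.small × bB.small → ℂ) := σ ∘ₗ residueOp A B ∘ₗ π with hD
  have hπ1 : ∀ x, π (Pi.single x 1) = (relations A B).mkQ (x.1.1 ⊗ₜ x.2.1) := fun x => by
    rw [hπ, leadingMap, Fintype.linearCombination_apply_single, one_smul]
  -- Row `x` of `d` holds the coordinates of the image of the basis vector `x`, which is a column of
  -- the matrix of `D`.
  refine ⟨(LinearMap.toMatrix' D).transpose, fun x => ?_, fun μ => ?_⟩
  · rw [← Submodule.Quotient.mk_eq_zero, ← Submodule.mkQ_apply, map_sub, sub_eq_zero, map_sum]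
    have h1 : π (D (Pi.single x 1)) = residueOp A B (π (Pi.single x 1)) := by
      rw [hD]
      exact LinearMap.congr_fun hσ _
    rw [hπ1] at h1
    have h2 : (relations A B).mkQ (fusionOp A B (x.1.1 ⊗ₜ x.2.1)) = π (D (Pi.single x 1)) := by
      rw [h1]
      rfl
    rw [h2, hπ, leadingMap, Fintype.linearCombination_apply]
    refine Finset.sum_congr rfl fun y _ => ?_
    rw [map_smul, Matrix.transpose_apply, LinearMap.toMatrix'_apply]
  · rw [hasEigenvalue_transpose, ← Matrix.toLin'_apply', Matrix.toLin'_toMatrix', hD,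
      hasEigenvalue_lift_iff hσ, residueEigenvalues]
    simp [← bA.card_small, ← bB.card_small]

end Reduction

/-! ### Generalized eigenspaces and intertwining maps. -/

section GeneralizedEigenspaces

theorem pow_sub_smul_one_comp {X Y : Type*} [AddCommGroup X] [Module ℂ X] [AddCommGroup Y]
    [Module ℂ Y] {f : Module.End ℂ X} {g : Module.End ℂ Y} (φ : X →ₗ[ℂ] Y) {a b : ℂ}
    (h : ∀ x, g (φ x) - b • φ x = φ (f x - a • x)) (k : ℕ) (x : X) :
    ((g - b • (1 : Module.End ℂ Y)) ^ k) (φ x) =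
      φ (((f - a • (1 : Module.End ℂ X)) ^ k) x) := by
  induction k generalizing x with
  | zero => simp
  | succ k ih =>
    rw [pow_succ, pow_succ, Module.End.mul_apply, Module.End.mul_apply, ← ih]
    congr 1
    simpa using h x

theorem mem_maxGenEigenspace_of_comp {X Y : Type*} [AddCommGroup X] [Module ℂ X] [AddCommGroup Y]
    [Module ℂ Y] {f : Module.End ℂ X} {g : Module.End ℂ Y} (φ : X →ₗ[ℂ] Y) {a b : ℂ}
    (h : ∀ x, g (φ x) - b • φ x = φ (f x - a • x)) {x : X} (hx : x ∈ f.maxGenEigenspace a) :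
    φ x ∈ g.maxGenEigenspace b := by
  rw [Module.End.mem_maxGenEigenspace] at hx ⊢
  obtain ⟨k, hk⟩ := hx
  exact ⟨k, by rw [pow_sub_smul_one_comp φ h, hk, map_zero]⟩

theorem le_iSup_inf_maxGenEigenspace {X : Type*} [AddCommGroup X] [Module ℂ X]
    (f : Module.End ℂ X) (p : Submodule ℂ X) [FiniteDimensional ℂ p] (h : ∀ x ∈ p, f x ∈ p) :
    p ≤ ⨆ μ, p ⊓ f.maxGenEigenspace μ := by
  have h1 := Module.End.iSup_maxGenEigenspace_eq_top (f.restrict h)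
  have h2 := congrArg (Submodule.map p.subtype) h1
  rw [Submodule.map_iSup, Submodule.map_top, Submodule.range_subtype] at h2
  refine h2.ge.trans (iSup_mono fun μ => le_inf ?_ ?_)
  · exact Submodule.map_subtype_le _ _
  · rintro _ ⟨x, hx, rfl⟩
    exact mem_maxGenEigenspace_of_comp p.subtype (fun x => by simp) hx

end GeneralizedEigenspaces

/-! ### Generalized `L(0)`-weights of graded modules. -/

section Weights

variable {V : Type v} [AddCommGroup V] [Module ℂ V] [VertexOperatorAlgebra V]

variable (V) in
/-- The generalized `L(0)`-eigenspace. -/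
def genWt (W : Type u) [AddCommGroup W] [Module ℂ W] [VertexModule V W] (μ : ℂ) : Submodule ℂ W :=
  Module.End.maxGenEigenspace (vmode (conf : V) 1 : Module.End ℂ W) μ

theorem iSupIndep_genWt (W : Type u) [AddCommGroup W] [Module ℂ W] [VertexModule V W] :
    iSupIndep (genWt V W) :=
  Module.End.independent_maxGenEigenspace _

theorem vmode_mem_genWt {W : Type u} [AddCommGroup W] [Module ℂ W] [VertexModule V W] {n : ℤ}
    {α : V} (hα : α ∈ wtSpace V n) (k : ℤ) {μ : ℂ} {w : W} (hw : w ∈ genWt V W μ) :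
    vmode α k w ∈ genWt V W (μ + ((n - k - 1 : ℤ) : ℂ)) := by
  refine mem_maxGenEigenspace_of_comp (vmode α k : Module.End ℂ W) (fun x => ?_) hw
  rw [vmode_conf_one_comm hα, map_sub, map_smul]
  push_cast
  module

namespace NGradedModule

variable (W : NGradedModule.{v, u} V)

/-- Degree `m` is spanned by finitely many generators and by the images of `V₍ₙ₎ × W₍ₘ₋ₙ₎` under
`(α, w) ↦ α₋₁ w` for `1 ≤ n ≤ m`; weight spaces of `V` are finite dimensional and the lower degrees
are so by induction. -/
theorem finiteDimensional_gr (h : W.C1Cofinite) (m : ℕ) : FiniteDimensional ℂ (W.gr m) := by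
  obtain ⟨s, hs⟩ := W.exists_spansModC1 h
  induction m using Nat.strong_induction_on with
  | _ m ih =>
    let bil : V →ₗ[ℂ] W →ₗ[ℂ] W := (LinearMap.proj (-1)) ∘ₗ (vmode : V →ₗ[ℂ] (ℤ → Module.End ℂ W))
    have hle : W.gr m ≤ Submodule.span ℂ (s : Set W) ⊔
        ⨆ n ∈ Finset.Icc 1 m, Submodule.map₂ bil (wtSpace V n) (W.gr (m - n)) := by
      refine (hs.gr_le m).trans (sup_le_sup (Submodule.span_mono fun x hx => hx.1) ?_)
      rw [Submodule.span_le]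
      rintro _ ⟨n, hn, α, hα, k, hk, w, hw, rfl⟩
      refine Submodule.mem_iSup_of_mem n (Submodule.mem_iSup_of_mem (by simp; omega) ?_)
      have : k = m - n := by omega
      subst this
      exact Submodule.apply_mem_map₂ bil hα hw
    have hfg : (Submodule.span ℂ (s : Set W) ⊔
        ⨆ n ∈ Finset.Icc 1 m, Submodule.map₂ bil (wtSpace V n) (W.gr (m - n))).FG := by
      refine Submodule.FG.sup ⟨s, rfl⟩ (Submodule.fg_biSup _ _ fun n hn => ?_)
      rw [Finset.mem_Icc] at hn
      have h1 := VertexOperatorAlgebra.weights_finite (V := V) n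
      have h2 := ih (m - n) (by omega)
      exact Submodule.FG.map₂ _ (Module.Finite.iff_fg.1 h1) (Module.Finite.iff_fg.1 h2)
    have := Module.Finite.iff_fg.2 hfg
    exact Submodule.finiteDimensional_of_le hle

theorem sum_proj_eq (w : W) : ∃ M : ℕ, ∀ n, M ≤ n → ∑ m ∈ Finset.range n, W.proj m w = w := by
  induction w using W.hom_induction with
  | add x y hx hy =>
    obtain ⟨M₁, h₁⟩ := hx
    obtain ⟨M₂, h₂⟩ := hy
    refine ⟨max M₁ M₂, fun n hn => ?_⟩
    simp_rw [map_add, Finset.sum_add_distrib]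
    rw [h₁ n (by omega), h₂ n (by omega)]
  | hom m x hx =>
    refine ⟨m + 1, fun n hn => ?_⟩
    simp_rw [W.proj_of_mem hx]
    rw [Finset.sum_ite_eq, if_pos (Finset.mem_range.2 (by omega))]

theorem dualLE_apply {N : ℕ} {θ : Module.Dual ℂ W} (hθ : θ ∈ W.dualLE N) (w : W) :
    θ w = ∑ m ∈ Finset.range (N + 1), θ (W.proj m w) := by
  obtain ⟨M, hM⟩ := W.sum_proj_eq w
  conv_lhs => rw [← hM (max M (N + 1)) (by omega), map_sum]
  refine (Finset.sum_subset (Finset.range_mono (by omega)) fun m _ hm => ?_).symm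
  exact hθ m (by simpa [Nat.lt_succ_iff] using hm) _ (W.proj_mem m w)

theorem finiteDimensional_dualLE (h : W.C1Cofinite) (N : ℕ) :
    FiniteDimensional ℂ (W.dualLE N) := by
  have := W.finiteDimensional_gr h
  let f : W.dualLE N →ₗ[ℂ] (∀ m : Fin (N + 1), W.gr m →ₗ[ℂ] ℂ) :=
    LinearMap.pi fun m => (LinearMap.lcomp ℂ ℂ (W.gr m).subtype) ∘ₗ (W.dualLE N).subtype
  refine Module.Finite.of_injective f ?_
  rw [← LinearMap.ker_eq_bot, Submodule.eq_bot_iff]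
  rintro ⟨θ, hθ⟩ h0
  ext w
  change θ w = 0
  rw [W.dualLE_apply hθ]
  refine Finset.sum_eq_zero fun m hm => ?_
  have := LinearMap.congr_fun (congrFun (LinearMap.mem_ker.1 h0) ⟨m, Finset.mem_range.1 hm⟩)
    ⟨W.proj m w, W.proj_mem m w⟩
  exact this

theorem gr_le_iSup_genWt (h : W.C1Cofinite) (m : ℕ) : W.gr m ≤ ⨆ μ, W.gr m ⊓ genWt V W μ := by
  have := W.finiteDimensional_gr h m
  exact le_iSup_inf_maxGenEigenspace _ _ fun x hx => W.vmode_conf_one_mem_gr hx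

theorem iSup_genWt (h : W.C1Cofinite) : ⨆ μ, genWt V W μ = ⊤ := by
  rw [eq_top_iff, ← W.iSup_gr]
  exact iSup_le fun m => (W.gr_le_iSup_genWt h m).trans (iSup_mono fun μ => inf_le_right)

/-- The part of `W₍ₘ₎` of the generalized `L(0)`-weights with real part at least `ρ`. -/
def grGE (m : ℕ) (ρ : ℝ) : Submodule ℂ W := ⨆ μ, ⨆ (_ : ρ ≤ μ.re), W.gr m ⊓ genWt V W μ

theorem grGE_anti (m : ℕ) {ρ ρ' : ℝ} (h : ρ ≤ ρ') : W.grGE m ρ' ≤ W.grGE m ρ :=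
  iSup_mono fun _ => iSup_mono' fun h' => ⟨h.trans h', le_rfl⟩

/-- For `α` of weight `n`, the mode `α₋₁` raises the degree and the `L(0)`-weight by the same number
`n`. A lower bound for weight minus degree on the finitely many generators therefore holds
everywhere. -/
theorem exists_gr_le_grGE (h : W.C1Cofinite) : ∃ r : ℝ, ∀ m : ℕ, W.gr m ≤ W.grGE m (m + r) := by
  obtain ⟨s, hs⟩ := W.exists_spansModC1 h
  have h1 : ∀ m : ℕ, ∀ x ∈ W.gr m, ∃ ρ : ℝ, x ∈ W.grGE m ρ := by
    intro m x hx
    refine Submodule.iSup_induction _ (motive := fun x => ∃ ρ : ℝ, x ∈ W.grGE m ρ)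
      (W.gr_le_iSup_genWt h m hx) (fun μ x hx => ?_) ⟨0, Submodule.zero_mem _⟩ ?_
    · exact ⟨μ.re, Submodule.mem_iSup_of_mem μ (Submodule.mem_iSup_of_mem le_rfl hx)⟩
    · rintro x y ⟨ρ, hρ⟩ ⟨ρ', hρ'⟩
      exact ⟨min ρ ρ', Submodule.add_mem _ (W.grGE_anti m (min_le_left _ _) hρ)
        (W.grGE_anti m (min_le_right _ _) hρ')⟩
  -- The bound is chosen as a function of all vectors; its value at an inhomogeneous one is
  -- arbitrary and plays no role.
  have h2 : ∀ x : W, ∃ r : ℝ, x ∈ W.gr (W.grade x) → x ∈ W.grGE (W.grade x) (W.grade x + r) := by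
    intro x
    by_cases hx : x ∈ W.gr (W.grade x)
    · obtain ⟨ρ, hρ⟩ := h1 _ x hx
      exact ⟨ρ - W.grade x, fun _ => by simpa using hρ⟩
    · exact ⟨0, fun h => absurd h hx⟩
  choose f hf using h2
  obtain ⟨r, hr⟩ : ∃ r : ℝ, ∀ x ∈ s, r ≤ f x := by
    obtain ⟨r, hr⟩ := (s.finite_toSet.image f).bddBelow
    exact ⟨r, fun x hx => hr ⟨x, hx, rfl⟩⟩
  refine ⟨r, fun m => ?_⟩
  induction m using Nat.strong_induction_on with
  | _ m ih =>
    intro w hw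
    refine hs.map_mem LinearMap.id (W.grGE m (m + r)) (fun x hx hxm => ?_) ?_ hw
    · rw [LinearMap.id_apply]
      by_cases h0 : x = 0
      · rw [h0]; exact Submodule.zero_mem _
      · have hg := W.grade_eq h0 hxm
        have := hf x (hg.symm ▸ hxm)
        rw [hg] at this
        exact W.grGE_anti m (by linarith [hr x hx]) this
    · intro n hn α hα k hk w hw
      have hle : W.grGE k (k + r) ≤ (W.grGE m (m + r)).comap (vmode α (-1) : Module.End ℂ W) := by
        refine iSup_le fun μ => iSup_le fun hμ => ?_
        rintro x ⟨hx1, hx2⟩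
        refine Submodule.mem_iSup_of_mem (μ + ((n - (-1) - 1 : ℤ) : ℂ))
          (Submodule.mem_iSup_of_mem ?_ ⟨?_, vmode_mem_genWt hα _ hx2⟩)
        · rw [← hk]
          push_cast
          simp
          linarith
        · exact hk ▸ W.vmode_neg_one_mem_gr hα hx1
      exact hle (ih k (by omega) hw)

/-- The weights on which functionals in `W^∨₍≤N₎` can be nonzero. -/
theorem finite_weights_dualLE (h : W.C1Cofinite) (N : ℕ) :
    ∃ S : Set ℂ, S.Finite ∧ ∀ θ ∈ W.dualLE N, ∀ μ ∉ S, ∀ w ∈ genWt V W μ, θ w = 0 := by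
  have hfd := W.finiteDimensional_gr h
  -- The weights that occur in degrees up to `N`: each such degree is finite dimensional and its
  -- generalized weight spaces are independent, so only finitely many are nonzero.
  refine ⟨⋃ m ∈ Finset.range (N + 1), {μ | W.gr m ⊓ genWt V W μ ≠ ⊥}, ?_, ?_⟩
  · refine Set.Finite.biUnion (Finset.finite_toSet _) fun m _ => ?_
    have hind : iSupIndep fun μ => (genWt V W μ).comap (W.gr m).subtype := by
      intro μ
      rw [Submodule.disjoint_def]
      intro x hx hx'
      have h1 : ((W.gr m).subtype x) ∈ ⨆ ν, ⨆ (_ : ν ≠ μ), genWt V W ν := by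
        refine (?_ : ⨆ ν, ⨆ (_ : ν ≠ μ), (genWt V W ν).comap (W.gr m).subtype ≤
          (⨆ ν, ⨆ (_ : ν ≠ μ), genWt V W ν).comap (W.gr m).subtype) hx'
        exact iSup_le fun ν => iSup_le fun hν => Submodule.comap_mono
          (le_iSup_of_le ν (le_iSup_of_le hν le_rfl))
      have := Submodule.disjoint_def.1 (iSupIndep_genWt W μ) _ hx h1
      exact Subtype.ext this
    refine (WellFoundedGT.finite_ne_bot_of_iSupIndep hind).subset fun μ hμ h0 => hμ ?_
    rw [Submodule.eq_bot_iff]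
    rintro x ⟨hx1, hx2⟩
    have : (⟨x, hx1⟩ : W.gr m) ∈ (genWt V W μ).comap (W.gr m).subtype := hx2
    have h0' : (genWt V W μ).comap (W.gr m).subtype = ⊥ := h0
    rw [h0', Submodule.mem_bot] at this
    exact congrArg Subtype.val this
  · intro θ hθ μ hμ w hw
    rw [W.dualLE_apply hθ]
    refine Finset.sum_eq_zero fun m hm => ?_
    have hm' : W.gr m ⊓ genWt V W μ = ⊥ := by
      by_contra hne
      exact hμ (Set.mem_biUnion hm hne)
    -- `L(0)` preserves degrees and so commutes with the projection, which therefore preserves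
    -- generalized weights.
    have : W.proj m w ∈ W.gr m ⊓ genWt V W μ := by
      refine ⟨W.proj_mem m w, mem_maxGenEigenspace_of_comp (W.proj m) (fun x => ?_) hw⟩
      rw [map_sub, map_smul]
      congr 1
      induction x using W.hom_induction with
      | add x y hx hy => simp only [map_add, hx, hy]
      | hom k x hx =>
        rw [W.proj_of_mem hx, W.proj_of_mem (W.vmode_conf_one_mem_gr hx)]
        split_ifs <;> simp
    rw [hm', Submodule.mem_bot] at this
    rw [this, map_zero]

end NGradedModule

namespace LogIntertwiningOperator

variable {A B W : NGradedModule.{v, u} V} (Y : LogIntertwiningOperator A B W)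

/-- The commutator with `L(0)` involves only `L(0) v` and `L(-1) v`; the latter is `d/dz`, whose
action on the powers of `log z` brings in the mode with `h + 1`. -/
theorem conf_one_mode (h : ℕ) (s : ℂ) (v : A) (u : B) :
    vmode (conf : V) 1 (Y.mode h s v u) = Y.mode h s (vmode (conf : V) 1 v) u +
      Y.mode h s v (vmode (conf : V) 1 u) - (s + 1) • Y.mode h s v u +
        ((h : ℂ) + 1) • Y.mode (h + 1) s v u := by
  have h1 := Y.commutator conf 1 h s v u
  rw [finsum_eq_sum_range (n := 2)] at h1
  · simp only [Finset.sum_range_succ, Finset.sum_range_zero, Nat.cast_zero, Nat.cast_one,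
      Ring.choose_zero_right, Ring.choose_one_right, Int.cast_one, one_smul, Y.derivative,
      sub_zero, add_sub_cancel_right, zero_add] at h1
    rw [sub_eq_iff_eq_add] at h1
    rw [h1]
    module
  · intro j hj
    have : Ring.choose (1 : ℤ) j = 0 := by
      have := Ring.choose_natCast (R := ℤ) 1 j
      rw [Nat.cast_one, Nat.choose_eq_zero_of_lt (by omega)] at this
      simpa using this
    simp [this]

/-- On a mode, `L(0) - (a + b - s - 1)` acts as the sum of `L(0) - a` on `v`, `L(0) - b` on `u` and
a multiple of the passage from `h` to `h + 1`. The first two are nilpotent on the given vectors, the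
third because powers of the logarithm are bounded by `K`. -/
theorem mode_mem_genWt (h : ℕ) (s : ℂ) {a b : ℂ} {v : A} {u : B} (hv : v ∈ genWt V A a)
    (hu : u ∈ genWt V B b) : Y.mode h s v u ∈ genWt V W (a + b - s - 1) := by
  -- The number `i + j + (K + 1 - h)` bounds how often the three nilpotent parts can act; each of
  -- them lowers it by one.
  have key : ∀ n : ℕ, ∀ (h i j : ℕ) (v : A) (u : B), i + j + (Y.K + 1 - h) ≤ n →
      (((vmode (conf : V) 1 : Module.End ℂ A) - a • (1 : Module.End ℂ A)) ^ i) v = 0 →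
      (((vmode (conf : V) 1 : Module.End ℂ B) - b • (1 : Module.End ℂ B)) ^ j) u = 0 →
      (((vmode (conf : V) 1 : Module.End ℂ W) - (a + b - s - 1) • (1 : Module.End ℂ W)) ^ n)
        (Y.mode h s v u) = 0 := by
    intro n
    induction n with
    | zero =>
      intro h i j v u hn _ _
      rw [Y.mode_eq_zero h (by omega)]
      simp
    | succ n ih =>
      intro h i j v u hn hi hj
      rw [pow_succ, Module.End.mul_apply]
      have e : ((vmode (conf : V) 1 : Module.End ℂ W) - (a + b - s - 1) • (1 : Module.End ℂ W))
          (Y.mode h s v u) =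
          Y.mode h s (((vmode (conf : V) 1 : Module.End ℂ A) - a • (1 : Module.End ℂ A)) v) u +
          Y.mode h s v (((vmode (conf : V) 1 : Module.End ℂ B) - b • (1 : Module.End ℂ B)) u) +
          ((h : ℂ) + 1) • Y.mode (h + 1) s v u := by
        simp only [LinearMap.sub_apply, LinearMap.smul_apply, Module.End.one_apply,
          Y.conf_one_mode, map_sub, map_smul]
        module
      rw [e, map_add, map_add, map_smul]
      have h1 : (((vmode (conf : V) 1 : Module.End ℂ W) -
          (a + b - s - 1) • (1 : Module.End ℂ W)) ^ n) (Y.mode h s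
            (((vmode (conf : V) 1 : Module.End ℂ A) - a • (1 : Module.End ℂ A)) v) u) = 0 := by
        rcases i with _ | i
        · have : v = 0 := by simpa using hi
          simp [this]
        · rw [pow_succ, Module.End.mul_apply] at hi
          exact ih h i j _ _ (by omega) hi hj
      have h2 : (((vmode (conf : V) 1 : Module.End ℂ W) -
          (a + b - s - 1) • (1 : Module.End ℂ W)) ^ n) (Y.mode h s v
            (((vmode (conf : V) 1 : Module.End ℂ B) - b • (1 : Module.End ℂ B)) u)) = 0 := by
        rcases j with _ | j
        · have : u = 0 := by simpa using hj
          simp [this]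
        · rw [pow_succ, Module.End.mul_apply] at hj
          exact ih h i j _ _ (by omega) hi hj
      rw [h1, h2]
      by_cases hK : Y.K < h + 1
      · rw [Y.mode_eq_zero _ hK]
        simp
      · rw [ih (h + 1) i j v u (by omega) hi hj]
        simp
  obtain ⟨i, hi⟩ := (Module.End.mem_maxGenEigenspace _ _ _).1 hv
  obtain ⟨j, hj⟩ := (Module.End.mem_maxGenEigenspace _ _ _).1 hu
  exact (Module.End.mem_maxGenEigenspace _ _ _).2 ⟨_, key _ h i j v u le_rfl hi hj⟩

end LogIntertwiningOperator

end Weights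

/-! ### Coefficients of intertwining operators twisted by the degrees. -/

section GradedModes

variable {V : Type v} [AddCommGroup V] [Module ℂ V] [VertexOperatorAlgebra V]
  {A B W : NGradedModule.{v, u} V}

/-- The linear map which is given by the bilinear map `f a b` on `A₍ₐ₎ ⊗ B₍ᵦ₎`. -/
def glue₂ {M : Type*} [AddCommGroup M] [Module ℂ M] (f : ℕ → ℕ → (A →ₗ[ℂ] B →ₗ[ℂ] M)) :
    A ⊗[ℂ] B →ₗ[ℂ] M :=
  TensorProduct.lift (A.glue fun a => B.glue ∘ₗ LinearMap.pi (f a))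

theorem glue₂_tmul {M : Type*} [AddCommGroup M] [Module ℂ M] (f : ℕ → ℕ → (A →ₗ[ℂ] B →ₗ[ℂ] M))
    {a b : ℕ} {u : A} {w : B} (hu : u ∈ A.gr a) (hw : w ∈ B.gr b) :
    glue₂ f (u ⊗ₜ w) = f a b u w := by
  rw [glue₂, TensorProduct.lift.tmul, A.glue_of_mem _ hu, LinearMap.comp_apply,
    B.glue_of_mem _ hw, LinearMap.pi_apply]

namespace LogIntertwiningOperator

variable (Y : LogIntertwiningOperator A B W)

/-- The coefficient of `z^e log^h z` in `z^(gr u + gr w) 𝒴(u, z) w`. -/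
def gmode (h : ℕ) (e : ℂ) : A ⊗[ℂ] B →ₗ[ℂ] W :=
  glue₂ fun a b => Y.mode h ((a : ℂ) + b - e - 1)

variable {Y}

theorem gmode_tmul (h : ℕ) (e : ℂ) {a b : ℕ} {u : A} {w : B} (hu : u ∈ A.gr a) (hw : w ∈ B.gr b) :
    Y.gmode h e (u ⊗ₜ w) = Y.mode h ((a : ℂ) + b - e - 1) u w :=
  glue₂_tmul _ hu hw

theorem mode_eq_gmode (h : ℕ) (s : ℂ) {a b : ℕ} {u : A} {w : B} (hu : u ∈ A.gr a)
    (hw : w ∈ B.gr b) : Y.mode h s u w = Y.gmode h ((a : ℂ) + b - s - 1) (u ⊗ₜ w) := by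
  rw [gmode_tmul h _ hu hw]
  congr 1
  ring_nf

theorem gmode_eq_zero {h : ℕ} (hK : Y.K < h) (e : ℂ) (x : A ⊗[ℂ] B) : Y.gmode h e x = 0 := by
  induction x using tensor_hom_induction with
  | add x y hx hy => rw [map_add, hx, hy, add_zero]
  | hom a u hu b w hw => rw [gmode_tmul h e hu hw, Y.mode_eq_zero h hK]; rfl

theorem mode_neg_one (α : V) (h : ℕ) (s : ℂ) (u : A) (w : B) : ∃ M₀ : ℕ, ∀ M, M₀ ≤ M →
    Y.mode h s (vmode α (-1) u) w = ∑ j ∈ Finset.range M,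
      (vmode α (-1 - (j : ℤ)) (Y.mode h (s + j) u w) +
        Y.mode h (s - 1 - j) u (vmode α (j : ℤ) w)) := by
  obtain ⟨L, hL⟩ := exists_vmode_eq_zero α w
  obtain ⟨n₀, hn₀⟩ := Y.truncation h s u w
  refine ⟨max L n₀, fun M hM => ?_⟩
  rw [Y.associator α (-1) h s u w, finsum_eq_sum_range (n := M)]
  · refine Finset.sum_congr rfl fun j _ => ?_
    rw [neg_one_pow_mul_choose_neg_one, one_smul, Int.cast_neg, Int.cast_one]
    norm_num
    ring_nf
  · intro j hj
    rw [hL j (by omega), hn₀ j (by omega)]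
    simp

/-- The associator for `α₋₁`: the twist by the degree turns `z^(-1-j) 𝒴(u, z) αⱼ w` into a term with
exponent `e` again, and all these terms are subtracted in the relation. What is left has `α₋₁₋ⱼ` on
the outside and a coefficient of smaller exponent. -/
theorem gmode_innerRelation {n : ℕ} {α : V} (hα : α ∈ wtSpace V n) (h : ℕ) (e : ℂ) {a b : ℕ} {u : A}
    {w : B} (hu : u ∈ A.gr a) (hw : w ∈ B.gr b) : ∃ M : ℕ,
    Y.gmode h e (innerRelation A B α u w) = ∑ j ∈ Finset.range M,
      vmode α (-1 - (j : ℤ)) (Y.gmode h (e - n - j) (u ⊗ₜ w)) := by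
  obtain ⟨L, hL⟩ := exists_vmode_eq_zero α w
  obtain ⟨M₀, hM₀⟩ := mode_neg_one (Y := Y) α h ((a + n : ℕ) + b - e - 1) u w
  refine ⟨max L M₀, ?_⟩
  rw [innerRelation_eq (L := max L M₀) (fun j hj => hL j (by omega)), map_sub, map_sum,
    gmode_tmul h e (A.vmode_neg_one_mem_gr hα hu) hw, hM₀ _ (le_max_right _ _),
    ← Finset.sum_sub_distrib]
  refine Finset.sum_congr rfl fun j _ => ?_
  have h2 : Y.gmode h e (u ⊗ₜ vmode α (j : ℤ) w) =
      Y.mode h (((a + n : ℕ) : ℂ) + b - e - 1 - 1 - j) u (vmode α (j : ℤ) w) := by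
    rcases B.vmode_nat_mem_gr hα j hw with h0 | ⟨k, hk, hm⟩
    · simp [h0]
    · rw [gmode_tmul h e hu hm]
      congr 3
      have : (b : ℂ) + n = k + (j + 1) := by exact_mod_cast hk.symm
      push_cast
      linear_combination -this
  rw [h2, add_sub_cancel_right, gmode_tmul h _ hu hw]
  congr 4
  push_cast
  ring

/-- The commutator formula for `α₋₁`; the degree drop of `αⱼ u` compensates the power `z^(-1-j)`,
and `choose (-1) j = (-1)^j` gives the signs. -/
theorem gmode_outerRelation {n : ℕ} {α : V} (hα : α ∈ wtSpace V n) (h : ℕ) (e : ℂ) {a b : ℕ} {u : A}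
    {w : B} (hu : u ∈ A.gr a) (hw : w ∈ B.gr b) :
    Y.gmode h e (outerRelation A B α u w) = vmode α (-1) (Y.gmode h (e - n) (u ⊗ₜ w)) := by
  obtain ⟨L, hL⟩ := exists_vmode_eq_zero α u
  have h1 := Y.commutator α (-1) h ((a : ℂ) + b + n - e - 1) u w
  rw [finsum_eq_sum_range (n := L) (fun j hj => by rw [hL j hj]; simp), sub_eq_iff_eq_add] at h1
  rw [outerRelation_eq hL, map_add, map_sum, gmode_tmul h e hu (B.vmode_neg_one_mem_gr hα hw),
    gmode_tmul h _ hu hw]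
  have e1 : ((a : ℂ) + b - (e - n) - 1) = (a : ℂ) + b + n - e - 1 := by ring
  have e2 : ((a : ℂ) + (b + n : ℕ) - e - 1) = (a : ℂ) + b + n - e - 1 := by push_cast; ring
  rw [e1, e2, h1, add_comm]
  congr 1
  refine Finset.sum_congr rfl fun j _ => ?_
  rw [map_smul, Int.choose_neg_one]
  push_cast
  congr 1
  rcases A.vmode_nat_mem_gr hα j hu with h0 | ⟨k, hk, hm⟩
  · simp [h0]
  · rw [gmode_tmul h e hm hw]
    congr 3
    have : (a : ℂ) + n = k + (j + 1) := by exact_mod_cast hk.symm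
    linear_combination -this

/-- Used with `Z = C₁(W)`, where the hypothesis is automatic, and with `Z = ⊥`, where it holds once
the coefficients of smaller exponents vanish. -/
theorem gmode_mem_of_mem_relations {h : ℕ} {e : ℂ} {Z : Submodule ℂ W}
    (hZ : ∀ n : ℕ, 1 ≤ n → ∀ α ∈ wtSpace V n, ∀ (j : ℕ) (x : A ⊗[ℂ] B),
      vmode α (-1 - (j : ℤ)) (Y.gmode h (e - n - j) x) ∈ Z) {r : A ⊗[ℂ] B}
    (hr : r ∈ relations A B) : Y.gmode h e r ∈ Z := by
  have : relations A B ≤ Z.comap (Y.gmode h e) := by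
    rw [relations, Submodule.span_le]
    rintro x ⟨n, hn, α, hα, a, u, hu, b, w, hw, rfl | rfl⟩
    · simp only [SetLike.mem_coe, Submodule.mem_comap]
      rw [gmode_outerRelation hα h e hu hw]
      simpa using hZ n hn α hα 0 (u ⊗ₜ w)
    · simp only [SetLike.mem_coe, Submodule.mem_comap]
      obtain ⟨M, hM⟩ := gmode_innerRelation (Y := Y) hα h e hu hw
      rw [hM]
      exact Submodule.sum_mem _ fun j _ => hZ n hn α hα j _
  exact this hr

/-- On `z^(gr u + gr w) 𝒴(u, z) w` the operator `fusionOp` is `z d/dz`, whose coefficient at `z^e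
log^h z` also receives a contribution from `log^(h+1) z`. -/
theorem gmode_fusionOp (h : ℕ) (e : ℂ) (x : A ⊗[ℂ] B) :
    Y.gmode h e (fusionOp A B x) =
      e • Y.gmode h e x + ((h : ℂ) + 1) • Y.gmode (h + 1) e x := by
  induction x using tensor_hom_induction with
  | add x y hx hy => simp only [map_add, hx, hy]; module
  | hom a u hu b w hw =>
    rw [fusionOp_tmul hu hw, map_add, map_smul, gmode_tmul h e hu hw, gmode_tmul (h + 1) e hu hw,
      gmode_tmul h e (A.vmode_conf_zero_mem_gr hu) hw, Y.derivative]
    have : (((a + 1 : ℕ) : ℂ) + b - e - 1 - 1) = (a : ℂ) + b - e - 1 := by push_cast; ring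
    rw [this]
    push_cast
    module

/-- Away from the eigenvalues of the residue, the coefficients are determined by those of smaller
exponents. -/
theorem gmode_mem_of_not_hasEigenvalue [FiniteDimensional ℂ (FusionQuotient A B)] {e : ℂ}
    (he : ¬ (residueOp A B).HasEigenvalue e) {Z : Submodule ℂ W}
    (hZ : ∀ (h n : ℕ), 1 ≤ n → ∀ α ∈ wtSpace V n, ∀ (j : ℕ) (x : A ⊗[ℂ] B),
      vmode α (-1 - (j : ℤ)) (Y.gmode h (e - n - j) x) ∈ Z) (h : ℕ) (x : A ⊗[ℂ] B) :
    Y.gmode h e x ∈ Z := by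
  have hinj : Function.Injective (residueOp A B - e • (1 : Module.End ℂ (FusionQuotient A B))) := by
    rw [← LinearMap.ker_eq_bot]
    rw [Module.End.hasEigenvalue_iff, not_not, Module.End.eigenspace_def] at he
    convert he using 2
  have hsurj := LinearMap.injective_iff_surjective.1 hinj
  -- Descending induction on `h`, starting above `K` where the modes vanish. Bijectivity of
  -- `residueOp - e` writes `x` as `(fusionOp - e) y` modulo relations, and this maps to the
  -- coefficient of `y` with `h + 1`.
  induction hd : Y.K + 1 - h generalizing h x with
  | zero => rw [gmode_eq_zero (by omega)]; exact Submodule.zero_mem _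
  | succ d ih =>
    obtain ⟨q, hq⟩ := hsurj ((relations A B).mkQ x)
    obtain ⟨y, rfl⟩ := (relations A B).mkQ_surjective q
    have h1 : x - (fusionOp A B y - e • y) ∈ relations A B := by
      rw [← Submodule.Quotient.mk_eq_zero, ← Submodule.mkQ_apply, map_sub, sub_eq_zero, ← hq]
      simp [residueOp]
    have h2 := gmode_mem_of_mem_relations (Y := Y) (hZ h) h1
    rw [map_sub, map_sub, gmode_fusionOp, map_smul, add_sub_cancel_left] at h2
    exact (Submodule.sub_mem_iff_left _ (Submodule.smul_mem _ _ (ih (h + 1) y (by omega)))).1 h2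

variable (Y) in
-- Truncation is assumed one pair of vectors at a time. A common bound is taken over the finitely
-- many products of generators and powers of the logarithm; the relations carry it to all tensors,
-- because they replace a tensor by ones of smaller total degree or by coefficients of smaller
-- exponents.
theorem gmode_truncation (hA : A.C1Cofinite) (hB : B.C1Cofinite) (e : ℂ) :
    ∃ n₀ : ℕ, ∀ n : ℕ, n₀ ≤ n → ∀ (h : ℕ) (x : A ⊗[ℂ] B), Y.gmode h (e - n) x = 0 := by
  obtain ⟨s, hs⟩ := A.exists_spansModC1 hA
  obtain ⟨t, ht⟩ := B.exists_spansModC1 hB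
  have h1 : ∀ (h : ℕ) (x : A ⊗[ℂ] B), ∃ n₀ : ℕ, ∀ n : ℕ, n₀ ≤ n → Y.gmode h (e - n) x = 0 := by
    intro h x
    induction x using tensor_hom_induction with
    | add x y hx hy =>
      obtain ⟨n₁, hn₁⟩ := hx
      obtain ⟨n₂, hn₂⟩ := hy
      refine ⟨max n₁ n₂, fun n hn => ?_⟩
      rw [map_add, hn₁ n (by omega), hn₂ n (by omega), add_zero]
    | hom a u hu b w hw =>
      obtain ⟨n₀, hn₀⟩ := Y.truncation h ((a : ℂ) + b - e - 1) u w
      refine ⟨n₀, fun n hn => ?_⟩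
      rw [gmode_tmul h _ hu hw, ← hn₀ n hn]
      congr 3
      ring
  choose N hN using h1
  obtain ⟨n₀, hn₀⟩ : ∃ n₀ : ℕ, ∀ h ≤ Y.K, ∀ p ∈ s, ∀ q ∈ t, N h (p ⊗ₜ q) ≤ n₀ := by
    refine ⟨(Finset.range (Y.K + 1)).sup fun h => s.sup fun p => t.sup fun q => N h (p ⊗ₜ q),
      fun h hh p hp q hq => ?_⟩
    refine le_trans ?_ (Finset.le_sup (f := fun h => s.sup fun p => t.sup fun q => N h (p ⊗ₜ q))
      (Finset.mem_range.2 (Nat.lt_succ_of_le hh)))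
    refine le_trans ?_ (Finset.le_sup (f := fun p => t.sup fun q => N h (p ⊗ₜ q)) hp)
    exact Finset.le_sup (f := fun q => N h (p ⊗ₜ q)) hq
  refine ⟨n₀, fun n hn h x => ?_⟩
  have key : ∀ D : ℕ, ∀ a b, a + b = D → ∀ u ∈ A.gr a, ∀ w ∈ B.gr b, ∀ n, n₀ ≤ n →
      Y.gmode h (e - n) (u ⊗ₜ[ℂ] w) = 0 := by
    intro D
    induction D using Nat.strong_induction_on with
    | _ D ih =>
      intro a b hab u hu w hw n hn
      rw [← Submodule.mem_bot (R := ℂ)]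
      refine hs.map_mem (Y.gmode h (e - n) ∘ₗ (TensorProduct.mk ℂ A B).flip w) ⊥ ?_ ?_ hu
      · intro p hp hpa
        refine ht.map_mem (Y.gmode h (e - n) ∘ₗ TensorProduct.mk ℂ A B p) ⊥ ?_ ?_ hw
        · intro q hq hqb
          rw [Submodule.mem_bot]
          by_cases hh : h ≤ Y.K
          · exact hN h _ n ((hn₀ h hh p hp q hq).trans hn)
          · exact gmode_eq_zero (Y := Y) (Nat.lt_of_not_le hh) _ (p ⊗ₜ q)
        · intro m hm α hα k hk w' hw'
          rw [Submodule.mem_bot]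
          have h2 := gmode_outerRelation (Y := Y) hα h (e - n) hpa hw'
          obtain ⟨L, hL⟩ := exists_vmode_eq_zero α p
          have e1 : e - n - m = e - ((n + m : ℕ) : ℂ) := by push_cast; ring
          rw [outerRelation_eq hL, map_add, map_sum, e1,
            ih (a + k) (by omega) _ _ rfl _ hpa _ hw' _ (by omega), map_zero,
            Finset.sum_eq_zero, add_zero] at h2
          · exact h2
          · intro j _
            rw [map_smul]
            rcases A.vmode_nat_mem_gr hα j hpa with h0 | ⟨k', hk', hm'⟩
            · simp [h0]
            · rw [ih (k' + k) (by omega) _ _ rfl _ hm' _ hw' n hn, smul_zero]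
      · intro m hm α hα k hk u' hu'
        rw [Submodule.mem_bot]
        obtain ⟨M, h2⟩ := gmode_innerRelation (Y := Y) hα h (e - n) hu' hw
        obtain ⟨L, hL⟩ := exists_vmode_eq_zero α w
        rw [innerRelation_eq hL, map_sub, map_sum, Finset.sum_eq_zero, sub_zero] at h2
        · refine h2.trans (Finset.sum_eq_zero fun j _ => ?_)
          have e1 : e - n - m - j = e - ((n + m + j : ℕ) : ℂ) := by push_cast; ring
          rw [e1, ih (k + b) (by omega) _ _ rfl _ hu' _ hw _ (by omega), map_zero]
        · intro j _
          rcases B.vmode_nat_mem_gr hα j hw with h0 | ⟨k', hk', hm'⟩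
          · simp [h0]
          · exact ih (k + k') (by omega) _ _ rfl _ hu' _ hm' n hn
  induction x using tensor_hom_induction with
  | add x y hx hy => rw [map_add, hx, hy, add_zero]
  | hom a u hu b w hw => exact key _ a b rfl u hu w hw n hn

/-- If no `e - m` with `m ≥ 0` were an eigenvalue, then starting from the uniform truncation bound
and moving up in steps of one, each coefficient would be determined by vanishing ones, so that the
one at `e` would vanish as well. -/
theorem gmode_exponents (hA : A.C1Cofinite) (hB : B.C1Cofinite) {h : ℕ} {e : ℂ} {x : A ⊗[ℂ] B}
    (hx : Y.gmode h e x ≠ 0) : ∃ e₀ : ℂ, (residueOp A B).HasEigenvalue e₀ ∧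
      ∃ k : ℕ, e = e₀ + k := by
  have := finiteDimensional_fusionQuotient hA hB
  by_contra hcon
  push Not at hcon
  obtain ⟨n₀, hn₀⟩ := Y.gmode_truncation hA hB e
  have key : ∀ d m : ℕ, n₀ ≤ m + d → ∀ (h : ℕ) (x : A ⊗[ℂ] B), Y.gmode h (e - m) x = 0 := by
    intro d
    induction d with
    | zero => exact fun m hm h x => hn₀ m hm h x
    | succ d ih =>
      intro m hm h x
      have hne : ¬ (residueOp A B).HasEigenvalue (e - m) := fun he =>
        hcon _ he m (by ring)
      rw [← Submodule.mem_bot (R := ℂ)]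
      refine gmode_mem_of_not_hasEigenvalue hne (fun h n hn α hα j x => ?_) h x
      have e1 : e - m - n - j = e - ((m + n + j : ℕ) : ℂ) := by push_cast; ring
      rw [e1, ih (m + n + j) (by omega), map_zero]
      exact Submodule.zero_mem _
  exact hx (by simpa using key n₀ 0 (by omega) h x)

end LogIntertwiningOperator

end GradedModes

/-! ### Stable subspaces, and gradings by real parts of weights. -/

section Submodules

variable {V : Type v} [AddCommGroup V] [Module ℂ V] [VertexOperatorAlgebra V]

/-- A submodule of a `V`-module. -/
@[reducible]
def VertexModule.ofStable {W : Type u} [AddCommGroup W] [Module ℂ W] [VertexModule V W]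
    (U : Submodule ℂ W) (hU : ∀ (α : V) (n : ℤ), ∀ x ∈ U, vmode α n x ∈ U) :
    VertexModule V U where
  vmode :=
    { toFun := fun α n => (vmode α n : Module.End ℂ W).restrict (hU α n)
      map_add' := fun α β => by
        ext n x
        simp
      map_smul' := fun c α => by
        ext n x
        simp }
  truncation α w := by
    obtain ⟨N, hN⟩ := VertexModule.truncation α (w : W)
    exact ⟨N, fun n hn => Subtype.ext (hN n hn)⟩
  vac_mode n w := Subtype.ext <| by
    have := VertexModule.vac_mode (V := V) n (w : W)
    refine this.trans ?_
    split_ifs <;> rfl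
  borcherds α β w l m n := Subtype.ext <| by
    have hinj : Function.Injective (U.subtype.toAddMonoidHom) := U.injective_subtype
    refine (AddMonoidHom.map_finsum_of_injective U.subtype.toAddMonoidHom hinj _).trans
      (Eq.trans ?_ (AddMonoidHom.map_finsum_of_injective U.subtype.toAddMonoidHom hinj _).symm)
    exact VertexModule.borcherds α β (w : W) l m n

theorem iSup_int_le_of_floor {W : Type u} [AddCommGroup W] [Module ℂ W] [VertexModule V W] {ρ : ℝ}
    (h : ⨆ μ : ℂ, ⨆ (_ : ρ ≤ μ.re), genWt V W μ = ⊤) {μ : ℂ} (hμ : ⌊μ.re⌋ < ⌊ρ⌋) :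
    genWt V W μ = ⊥ := by
  by_contra hne
  have : μ ∈ {μ : ℂ | ρ ≤ μ.re} := (iSupIndep_genWt (V := V) W).mem_of_biSup_eq_top h hne
  exact absurd (Int.floor_le_floor this) (not_le.2 hμ)

/-- The sum of the generalized weight spaces whose weights have real part in `[c, c + 1)`. -/
def wtBlock (V : Type v) [AddCommGroup V] [Module ℂ V] [VertexOperatorAlgebra V]
    (W : Type u) [AddCommGroup W] [Module ℂ W] [VertexModule V W] (c : ℤ) : Submodule ℂ W :=
  ⨆ μ ∈ {μ : ℂ | ⌊μ.re⌋ = c}, genWt V W μ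

theorem vmode_mem_wtBlock {W : Type u} [AddCommGroup W] [Module ℂ W] [VertexModule V W] {n : ℤ}
    {α : V} (hα : α ∈ wtSpace V n) (k : ℤ) {c : ℤ} {w : W} (hw : w ∈ wtBlock V W c) :
    vmode α k w ∈ wtBlock V W (c + n - k - 1) := by
  have hle : wtBlock V W c ≤
      (wtBlock V W (c + n - k - 1)).comap (vmode α k : Module.End ℂ W) := by
    refine iSup_le fun μ => iSup_le fun hμ x hx => ?_
    refine Submodule.mem_iSup_of_mem (μ + ((n - k - 1 : ℤ) : ℂ))
      (Submodule.mem_iSup_of_mem ?_ (vmode_mem_genWt hα k hx))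
    rw [Set.mem_ofPred_eq] at hμ ⊢
    rw [Complex.add_re, Complex.intCast_re, Int.floor_add_intCast, hμ]
    ring
  exact hle hw

/-- A `V`-module whose generalized weights have real part at least `ρ` is `ℕ`-gradable. -/
@[reducible]
def NGradedModule.ofWeights (W : Type u) [AddCommGroup W] [Module ℂ W] [VertexModule V W] {ρ : ℝ}
    (h : ⨆ μ : ℂ, ⨆ (_ : ρ ≤ μ.re), genWt V W μ = ⊤) : NGradedModule.{v, u} V where
  carrier := W
  -- Modes shift weights by integers, hence the floor of the real part by the same integers;
  -- subtracting `⌊ρ⌋` makes the degrees start at `0`.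
  gr m := wtBlock V W (m + ⌊ρ⌋)
  isInternal := by
    apply DirectSum.isInternal_submodule_of_iSupIndep_of_iSup_eq_top
    · intro m
      refine Disjoint.mono_right ?_ ((iSupIndep_genWt (V := V) W).disjoint_biSup_biSup
        (s := {μ : ℂ | ⌊μ.re⌋ = m + ⌊ρ⌋}) (t := {μ : ℂ | ⌊μ.re⌋ ≠ m + ⌊ρ⌋}) ?_)
      · refine iSup_le fun k => iSup_le fun hk => ?_
        refine iSup_le fun μ => iSup_le fun hμ => ?_
        refine le_iSup_of_le μ (le_iSup_of_le ?_ le_rfl)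
        rw [Set.mem_ofPred_eq] at hμ ⊢
        omega
      · rw [Set.disjoint_left]
        exact fun μ h1 h2 => h2 h1
    · rw [eq_top_iff, ← h]
      refine iSup_le fun μ => iSup_le fun hμ => ?_
      have h1 := Int.floor_le_floor hμ
      refine le_iSup_of_le (⌊μ.re⌋ - ⌊ρ⌋).toNat (le_iSup_of_le μ (le_iSup_of_le ?_ le_rfl))
      rw [Set.mem_ofPred_eq]
      omega
  vmode_mem n α hα k m w hw m' hm' := by
    have := vmode_mem_wtBlock hα k hw
    rwa [show (m : ℤ) + ⌊ρ⌋ + n - k - 1 = m' + ⌊ρ⌋ by omega] at this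
  vmode_eq_zero n α hα k m w hw hm' := by
    have h1 := vmode_mem_wtBlock hα k hw
    have h2 : wtBlock V W (m + ⌊ρ⌋ + n - k - 1) = ⊥ := by
      rw [eq_bot_iff]
      refine iSup_le fun μ => iSup_le fun hμ => ?_
      rw [Set.mem_ofPred_eq] at hμ
      exact (iSup_int_le_of_floor h (by omega)).le
    rwa [h2, Submodule.mem_bot] at h1

end Submodules

/-! ### Fusion products are spanned by modes and `C₁`-cofinite. -/

namespace LogIntertwiningOperator

variable {V : Type v} [AddCommGroup V] [Module ℂ V] [VertexOperatorAlgebra V]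
  {A B T : NGradedModule.{v, u} V} (Y : LogIntertwiningOperator A B T)

/-- The span of all coefficients of an intertwining operator. -/
def modeSpan : Submodule ℂ T :=
  Submodule.span ℂ {x | ∃ (h : ℕ) (s : ℂ) (v : A) (u : B), x = Y.mode h s v u}

theorem mode_mem_modeSpan (h : ℕ) (s : ℂ) (v : A) (u : B) : Y.mode h s v u ∈ Y.modeSpan :=
  Submodule.subset_span ⟨h, s, v, u, rfl⟩

theorem vmode_mem_modeSpan (α : V) (n : ℤ) : ∀ x ∈ Y.modeSpan, vmode α n x ∈ Y.modeSpan := by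
  have : Y.modeSpan ≤ Y.modeSpan.comap (vmode α n : Module.End ℂ T) := by
    rw [modeSpan, Submodule.span_le]
    rintro x ⟨h, s, v, u, rfl⟩
    simp only [SetLike.mem_coe, Submodule.mem_comap]
    have h1 := Y.commutator α n h s v u
    obtain ⟨L, hL⟩ := exists_vmode_eq_zero α v
    rw [finsum_eq_sum_range (n := L) (fun j hj => by rw [hL j hj]; simp), sub_eq_iff_eq_add] at h1
    rw [h1]
    exact Submodule.add_mem _ (Submodule.sum_mem _ fun j _ => Submodule.smul_mem _ _
      (Y.mode_mem_modeSpan _ _ _ _)) (Y.mode_mem_modeSpan _ _ _ _)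
  exact this

/-- The coefficients span a `V`-module with generalized weights of bounded below real part. -/
theorem exists_weight_bound (hA : A.C1Cofinite) (hB : B.C1Cofinite) :
    letI := VertexModule.ofStable Y.modeSpan Y.vmode_mem_modeSpan
    ∃ ρ : ℝ, ⨆ μ : ℂ, ⨆ (_ : ρ ≤ μ.re), genWt V Y.modeSpan μ = ⊤ := by
  let _ := VertexModule.ofStable Y.modeSpan Y.vmode_mem_modeSpan
  have hfd := finiteDimensional_fusionQuotient hA hB
  obtain ⟨rA, hrA⟩ := A.exists_gr_le_grGE hA
  obtain ⟨rB, hrB⟩ := B.exists_gr_le_grGE hB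
  obtain ⟨r₀, hr₀⟩ : ∃ r₀ : ℝ, ∀ μ, (residueOp A B).HasEigenvalue μ → r₀ ≤ μ.re := by
    obtain ⟨r, hr⟩ := ((Module.End.finite_hasEigenvalue (residueOp A B)).image
      Complex.re).bddBelow
    exact ⟨r, fun μ hμ => hr ⟨μ, hμ, rfl⟩⟩
  -- A mode of vectors of weights `μ`, `ν` and degrees `a`, `b` has weight `(μ - a) + (ν - b) + e`
  -- with `e = a + b - s - 1`. The three real parts are at least `rA`, `rB` and `r₀`, the last
  -- because `e` exceeds an eigenvalue of the residue by a natural number.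
  refine ⟨r₀ + rA + rB, ?_⟩
  set Z : Submodule ℂ Y.modeSpan :=
    ⨆ μ : ℂ, ⨆ (_ : r₀ + rA + rB ≤ μ.re), genWt V Y.modeSpan μ with hZ
  let φ (h : ℕ) (s : ℂ) (v : A) (u : B) : Y.modeSpan :=
    ⟨Y.mode h s v u, Y.mode_mem_modeSpan h s v u⟩
  have hadd₁ : ∀ h s x y u, φ h s (x + y) u = φ h s x u + φ h s y u := fun h s x y u =>
    Subtype.ext (by simp [φ])
  have hadd₂ : ∀ h s v x y, φ h s v (x + y) = φ h s v x + φ h s v y := fun h s v x y =>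
    Subtype.ext (by simp [φ])
  have key : ∀ h s v u, φ h s v u ∈ Z := by
    intro h s v u
    induction v using A.hom_induction with
    | add x y hx hy => rw [hadd₁]; exact Submodule.add_mem _ hx hy
    | hom a v hv =>
    induction u using B.hom_induction with
    | add x y hx hy => rw [hadd₂]; exact Submodule.add_mem _ hx hy
    | hom b u hu =>
    have hzero₁ : φ h s 0 u ∈ Z := by
      have : φ h s 0 u = 0 := Subtype.ext (by simp [φ])
      rw [this]; exact Submodule.zero_mem _
    refine Submodule.iSup_induction _ (motive := fun v => φ h s v u ∈ Z) (hrA a hv) ?_ hzero₁ ?_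
    swap
    · intro x y hx hy; rw [hadd₁]; exact Submodule.add_mem _ hx hy
    intro μ v hv'
    by_cases hμ : (a : ℝ) + rA ≤ μ.re
    swap
    · rw [iSup_neg hμ, Submodule.mem_bot] at hv'
      rw [hv']
      exact hzero₁
    rw [iSup_pos hμ] at hv'
    have hzero₂ : φ h s v 0 ∈ Z := by
      have : φ h s v 0 = 0 := Subtype.ext (by simp [φ])
      rw [this]; exact Submodule.zero_mem _
    refine Submodule.iSup_induction _ (motive := fun u => φ h s v u ∈ Z) (hrB b hu) ?_ hzero₂ ?_
    swap
    · intro x y hx hy; rw [hadd₂]; exact Submodule.add_mem _ hx hy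
    intro ν u hu'
    by_cases hν : (b : ℝ) + rB ≤ ν.re
    swap
    · rw [iSup_neg hν, Submodule.mem_bot] at hu'
      rw [hu']
      exact hzero₂
    rw [iSup_pos hν] at hu'
    by_cases h0 : Y.mode h s v u = 0
    · have : φ h s v u = 0 := Subtype.ext h0
      rw [this]; exact Submodule.zero_mem _
    have h1 := Y.mode_mem_genWt h s hv'.2 hu'.2
    rw [mode_eq_gmode h s hv'.1 hu'.1] at h0
    obtain ⟨e₀, he₀, k, hk⟩ := gmode_exponents hA hB h0
    have hre := congrArg Complex.re hk
    simp only [Complex.add_re, Complex.sub_re, Complex.natCast_re, Complex.one_re] at hre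
    refine Submodule.mem_iSup_of_mem (μ + ν - s - 1) (Submodule.mem_iSup_of_mem ?_ ?_)
    · simp only [Complex.add_re, Complex.sub_re, Complex.one_re]
      linarith [hr₀ e₀ he₀, (Nat.cast_nonneg k : (0 : ℝ) ≤ k)]
    · obtain ⟨k, hk⟩ := (Module.End.mem_maxGenEigenspace _ _ _).1 h1
      refine (Module.End.mem_maxGenEigenspace _ _ _).2 ⟨k, Subtype.ext ?_⟩
      exact (pow_sub_smul_one_comp (f := (vmode (conf : V) 1 : Module.End ℂ Y.modeSpan))
        Y.modeSpan.subtype (fun x => by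
          rw [map_sub, map_smul]; rfl) k (φ h s v u)).symm.trans hk
  rw [eq_top_iff]
  rintro ⟨x, hx⟩ -
  refine Submodule.span_induction (p := fun x hx => (⟨x, hx⟩ : Y.modeSpan) ∈ Z) ?_
    (Submodule.zero_mem _) ?_ ?_ hx
  · rintro x ⟨h, s, v, u, rfl⟩
    exact key h s v u
  · intro x y hx hy h1 h2
    exact Submodule.add_mem _ h1 h2
  · intro c x hx h1
    exact Submodule.smul_mem _ c h1

/-- An intertwining operator with values in a `V`-module is also one with values in the submodule
generated by its coefficients. -/
def corestrict (D : NGradedModule.{v, u} V) (i : D →ₗ[ℂ] T) (hi : Function.Injective i)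
    (hiV : ∀ (α : V) (n : ℤ) (x : D), i (vmode α n x) = vmode α n (i x))
    (f : ℕ → ℂ → A →ₗ[ℂ] B →ₗ[ℂ] D) (hf : ∀ h s v u, i (f h s v u) = Y.mode h s v u) :
    LogIntertwiningOperator A B D where
  K := Y.K
  mode := f
  mode_eq_zero h hK s := by
    ext v u
    apply hi
    rw [hf, Y.mode_eq_zero h hK s]
    simp
  truncation h s v u := by
    obtain ⟨n₀, hn₀⟩ := Y.truncation h s v u
    refine ⟨n₀, fun n hn => hi ?_⟩
    rw [hf, hn₀ n hn, map_zero]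
  commutator α m h s v u := by
    apply hi
    rw [map_sub, hiV, hf, hf, Y.commutator]
    refine Eq.trans ?_ (AddMonoidHom.map_finsum_of_injective i.toAddMonoidHom hi _).symm
    refine finsum_congr fun j => ?_
    simp [hf]
  associator α m h s v u := by
    apply hi
    rw [hf, Y.associator]
    refine Eq.trans ?_ (AddMonoidHom.map_finsum_of_injective i.toAddMonoidHom hi _).symm
    refine finsum_congr fun j => ?_
    simp [hf, hiV]
  derivative h s v u := by
    apply hi
    rw [hf, Y.derivative]
    simp [hf]

/-- The span of the modes is itself an `ℕ`-gradable module by the weight bound, so it may be used as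
a target in the universal property. The resulting map, followed by the inclusion, is an endomorphism
of `T` fixing all modes, hence the identity by uniqueness, and the inclusion is onto. -/
theorem modeSpan_eq_top (hA : A.C1Cofinite) (hB : B.C1Cofinite) (hY : IsFusionProduct Y) :
    Y.modeSpan = ⊤ := by
  let _ := VertexModule.ofStable Y.modeSpan Y.vmode_mem_modeSpan
  obtain ⟨ρ, hρ⟩ := Y.exists_weight_bound hA hB
  let D := NGradedModule.ofWeights Y.modeSpan hρ
  let i : D →ₗ[ℂ] T := Y.modeSpan.subtype
  let f : ℕ → ℂ → A →ₗ[ℂ] B →ₗ[ℂ] D := fun h s => LinearMap.mk₂ ℂ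
    (fun v u => (⟨Y.mode h s v u, Y.mode_mem_modeSpan h s v u⟩ : Y.modeSpan))
    (fun _ _ _ => Subtype.ext (by simp; rfl)) (fun _ _ _ => Subtype.ext (by simp; rfl))
    (fun _ _ _ => Subtype.ext (by simp; rfl)) (fun _ _ _ => Subtype.ext (by simp; rfl))
  have hi : Function.Injective i := Y.modeSpan.injective_subtype
  have hiV : ∀ (α : V) (n : ℤ) (x : D), i (vmode α n x) = vmode α n (i x) := fun _ _ _ => rfl
  have hf : ∀ h s v u, i (f h s v u) = Y.mode h s v u := fun _ _ _ _ => rfl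
  obtain ⟨φ, ⟨hφV, hφ⟩, -⟩ := hY D (Y.corestrict D i hi hiV f hf)
  obtain ⟨ψ, -, hψ⟩ := hY T Y
  have h1 := hψ LinearMap.id ⟨fun _ _ _ => rfl, fun _ _ _ _ => rfl⟩
  have h2 := hψ (i ∘ₗ φ) ⟨fun α n w => by simp [hφV, hiV], fun h s v u => by
    rw [LinearMap.comp_apply, hφ]
    exact hf h s v u⟩
  rw [eq_top_iff]
  rintro x -
  have h3 := LinearMap.congr_fun (h1.trans h2.symm) x
  rw [LinearMap.id_apply] at h3
  rw [h3]
  exact (φ x).2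

/-- Modulo `C₁(T)` every `gmode` kills the relations and so factors through the finite dimensional
`FusionQuotient`. It is zero modulo `C₁(T)` unless its exponent is one of the finitely many
eigenvalues of the residue and `h ≤ K`. Since the modes span `T`, finitely many finite dimensional
images span `T / C₁(T)`. -/
theorem c1Cofinite_of_isFusionProduct (hA : A.C1Cofinite) (hB : B.C1Cofinite)
    (hY : IsFusionProduct Y) : T.C1Cofinite := by
  have hfd := finiteDimensional_fusionQuotient hA hB
  have hZ : ∀ (e : ℂ) (h n : ℕ), 1 ≤ n → ∀ α ∈ wtSpace V n, ∀ (j : ℕ) (x : A ⊗[ℂ] B),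
      vmode α (-1 - (j : ℤ)) (Y.gmode h (e - n - j) x) ∈ T.C1 :=
    fun e h n hn α hα j x => T.vmode_neg_mem_C1 hn hα j _
  let F : ℕ → ℂ → (FusionQuotient A B →ₗ[ℂ] T ⧸ T.C1) := fun h e =>
    (relations A B).liftQ (T.C1.mkQ ∘ₗ Y.gmode h e) fun r hr => by
      rw [LinearMap.mem_ker, LinearMap.comp_apply, Submodule.mkQ_apply,
        Submodule.Quotient.mk_eq_zero]
      exact gmode_mem_of_mem_relations (hZ e h) hr
  have hE := Module.End.finite_hasEigenvalue (residueOp A B)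
  set R : Submodule ℂ (T ⧸ T.C1) := ⨆ h ∈ Finset.range (Y.K + 1), ⨆ e ∈ hE.toFinset,
    LinearMap.range (F h e) with hR
  have hRfg : R.FG := Submodule.fg_biSup _ _ fun h _ => Submodule.fg_biSup _ _ fun e _ =>
    Module.Finite.iff_fg.1 inferInstance
  have hRtop : R = ⊤ := by
    have h1 : Y.modeSpan ≤ R.comap T.C1.mkQ := by
      rw [modeSpan, Submodule.span_le]
      rintro x ⟨h, s, v, u, rfl⟩
      simp only [SetLike.mem_coe]
      induction v using A.hom_induction with
      | add x y hx hy => rw [map_add]; exact Submodule.add_mem _ hx hy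
      | hom a v hv =>
      induction u using B.hom_induction with
      | add x y hx hy => rw [map_add]; exact Submodule.add_mem _ hx hy
      | hom b u hu =>
      rw [mode_eq_gmode h s hv hu, Submodule.mem_comap]
      set e := (a : ℂ) + b - s - 1
      by_cases hK : Y.K < h
      · rw [gmode_eq_zero hK, map_zero]; exact Submodule.zero_mem _
      by_cases he : (residueOp A B).HasEigenvalue e
      · refine Submodule.mem_iSup_of_mem h (Submodule.mem_iSup_of_mem
          (Finset.mem_range.2 (by omega)) (Submodule.mem_iSup_of_mem e
          (Submodule.mem_iSup_of_mem (hE.mem_toFinset.2 he) ?_)))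
        exact ⟨(relations A B).mkQ (v ⊗ₜ u), rfl⟩
      · have := gmode_mem_of_not_hasEigenvalue he (hZ e) h (v ⊗ₜ u)
        rw [← Submodule.Quotient.mk_eq_zero] at this
        rw [Submodule.mkQ_apply, this]
        exact Submodule.zero_mem _
    rw [Y.modeSpan_eq_top hA hB hY, top_le_iff] at h1
    rw [eq_top_iff]
    rintro q -
    obtain ⟨x, rfl⟩ := T.C1.mkQ_surjective q
    have : x ∈ R.comap T.C1.mkQ := by rw [h1]; trivial
    exact this
  rw [hRtop] at hRfg
  exact ⟨hRfg⟩

end LogIntertwiningOperator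

/-! ### Eigenvalues of block and column-supported matrices. -/

section Eigenvalues

open Module.End

/-- The last nonzero vector among the `N^m x` is still an eigenvector of `S`, by commutation, and is
killed by `N`. -/
theorem hasEigenvalue_add_of_isNilpotent {X : Type*} [AddCommGroup X] [Module ℂ X]
    {S N : Module.End ℂ X} (h : Commute S N) (hN : IsNilpotent N) {μ : ℂ} (hS : S.HasEigenvalue μ) :
    (S + N).HasEigenvalue μ := by
  obtain ⟨x, hx⟩ := hS.exists_hasEigenvector
  obtain ⟨k, hk⟩ := hN
  classical
  have hex : ∃ m, (N ^ m) x = 0 := ⟨k, by rw [hk]; rfl⟩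
  have hpos : Nat.find hex ≠ 0 := fun h0 => hx.2 (by simpa [h0] using Nat.find_spec hex)
  obtain ⟨m, hm⟩ := Nat.exists_eq_succ_of_ne_zero hpos
  have hz : (N ^ (m + 1)) x = 0 := by
    have := Nat.find_spec hex
    rwa [hm] at this
  refine hasEigenvalue_of_hasEigenvector (x := (N ^ m) x) ⟨?_, Nat.find_min hex (by omega)⟩
  rw [mem_eigenspace_iff, LinearMap.add_apply, ← Module.End.mul_apply, ← Module.End.mul_apply,
    ← pow_succ', (h.pow_right m).eq, Module.End.mul_apply, hx.apply_eq_smul, map_smul, hz,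
    add_zero]

theorem hasEigenvalue_add_iff_of_isNilpotent {X : Type*} [AddCommGroup X] [Module ℂ X]
    {S N : Module.End ℂ X} (h : Commute S N) (hN : IsNilpotent N) (μ : ℂ) :
    (S + N).HasEigenvalue μ ↔ S.HasEigenvalue μ := by
  refine ⟨fun hS => ?_, hasEigenvalue_add_of_isNilpotent h hN⟩
  have := hasEigenvalue_add_of_isNilpotent (S := S + N) (N := -N)
    ((h.add_left (Commute.refl N)).neg_right) hN.neg hS
  rwa [add_neg_cancel_right] at this

variable {Y X κ : Type*}

/-- The operator on functions on `Y × X × κ` acting by `g y + d` on the slices in `X`. -/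
def sliceOp [Fintype X] (g : Y → ℂ) (d : Matrix X X ℂ) : Module.End ℂ (Y × X × κ → ℂ) where
  toFun f i := g i.1 * f i + ∑ x', d i.2.1 x' * f (i.1, x', i.2.2)
  map_add' f f' := by
    ext i
    simp only [Pi.add_apply, mul_add, Finset.sum_add_distrib]
    ring
  map_smul' c f := by
    ext i
    simp only [Pi.smul_apply, smul_eq_mul, RingHom.id_apply, mul_add, Finset.mul_sum]
    congr 1
    · ring
    · exact Finset.sum_congr rfl fun x' _ => by ring

/-- The operator on functions on `Y × X × κ` acting by a matrix on the last component. -/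
def lastOp [Fintype κ] (n : Matrix κ κ ℂ) : Module.End ℂ (Y × X × κ → ℂ) where
  toFun f i := ∑ k', n i.2.2 k' * f (i.1, i.2.1, k')
  map_add' f f' := by
    ext i
    simp only [Pi.add_apply, mul_add, Finset.sum_add_distrib]
  map_smul' c f := by
    ext i
    simp only [Pi.smul_apply, smul_eq_mul, RingHom.id_apply, Finset.mul_sum]
    exact Finset.sum_congr rfl fun x' _ => by ring

theorem commute_sliceOp_lastOp [Fintype X] [Fintype κ] (g : Y → ℂ) (d : Matrix X X ℂ)
    (n : Matrix κ κ ℂ) :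
    Commute (sliceOp (κ := κ) g d) (lastOp n) := by
  ext f i
  simp only [Module.End.mul_apply, sliceOp, lastOp, LinearMap.coe_mk, AddHom.coe_mk, mul_add,
    Finset.sum_add_distrib, Finset.mul_sum]
  congr 1
  · exact Finset.sum_congr rfl fun _ _ => by ring
  · rw [Finset.sum_comm]
    exact Finset.sum_congr rfl fun _ _ => Finset.sum_congr rfl fun _ _ => by ring

/-- Each application looks up values at strictly larger rank, and the rank is bounded. -/
theorem isNilpotent_lastOp [Fintype κ] {n : Matrix κ κ ℂ} {rank : κ → ℕ}
    (hn : ∀ k k', n k k' ≠ 0 → rank k < rank k') :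
    IsNilpotent (lastOp (Y := Y) (X := X) n) := by
  have key : ∀ (m : ℕ) (f : Y × X × κ → ℂ) (i : Y × X × κ),
      Finset.univ.sup rank < rank i.2.2 + m → ((lastOp n) ^ m) f i = 0 := by
    intro m
    induction m with
    | zero =>
      intro f i hi
      exact absurd (Finset.le_sup (f := rank) (Finset.mem_univ i.2.2)) (by omega)
    | succ m ih =>
      intro f i hi
      rw [pow_succ', Module.End.mul_apply]
      refine Finset.sum_eq_zero fun k' _ => ?_
      by_cases h0 : n i.2.2 k' = 0
      · rw [h0, zero_mul]
      · have := hn _ _ h0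
        rw [ih f (i.1, i.2.1, k') (by simp only; omega), mul_zero]
  refine ⟨Finset.univ.sup rank + 1, ?_⟩
  ext f i
  exact key _ f i (by omega)

/-- For fixed `y` and `k` the operator acts on the slice in `X` as `g y + d`, without mixing slices;
an eigenvector of one slice extends by zero. -/
theorem hasEigenvalue_sliceOp_iff [Fintype X] [Nonempty κ] (g : Y → ℂ) (d : Matrix X X ℂ) (μ : ℂ) :
    (sliceOp (κ := κ) g d).HasEigenvalue μ ↔
      ∃ y, Module.End.HasEigenvalue d.mulVecLin (μ - g y) := by
  classical
  constructor
  · intro h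
    obtain ⟨f, hf⟩ := h.exists_hasEigenvector
    obtain ⟨⟨y, x, k⟩, hi⟩ := Function.ne_iff.1 hf.2
    refine ⟨y, hasEigenvalue_of_hasEigenvector (x := fun x => f (y, x, k)) ⟨?_, fun h0 => hi ?_⟩⟩
    · rw [mem_eigenspace_iff]
      ext x
      have := congrFun hf.apply_eq_smul (y, x, k)
      simp only [sliceOp, LinearMap.coe_mk, AddHom.coe_mk, Pi.smul_apply, smul_eq_mul] at this
      simp only [Matrix.mulVecLin_apply, Matrix.mulVec, dotProduct, Pi.smul_apply, smul_eq_mul]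
      linear_combination this
    · exact congrFun h0 x
  · rintro ⟨y, h⟩
    obtain ⟨v, hv⟩ := h.exists_hasEigenvector
    obtain ⟨k⟩ := ‹Nonempty κ›
    obtain ⟨x, hx⟩ := Function.ne_iff.1 hv.2
    refine hasEigenvalue_of_hasEigenvector
      (x := fun i : Y × X × κ => if i.1 = y ∧ i.2.2 = k then v i.2.1 else 0) ⟨?_, fun h0 => hx ?_⟩
    · rw [mem_eigenspace_iff]
      ext ⟨y', x, k'⟩
      simp only [sliceOp, LinearMap.coe_mk, AddHom.coe_mk, Pi.smul_apply, smul_eq_mul]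
      by_cases hc : y' = y ∧ k' = k
      · have := congrFun hv.apply_eq_smul x
        simp only [Matrix.mulVecLin_apply, Matrix.mulVec, dotProduct, Pi.smul_apply,
          smul_eq_mul] at this
        simp only [hc, and_self, if_true, this]
        ring
      · simp [hc]
    · simpa using congrFun h0 (y, x, k)

/-- `M f` depends only on the components of `f` in `p`. For `μ ≠ 0` the other components of an
eigenvector are recovered as `μ⁻¹ M f`, so nothing is lost or gained by restricting to the block. -/
theorem hasEigenvalue_iff_of_columns {ι Z : Type*} [Fintype ι] {p : ι → Prop} [DecidablePred p]
    {M : Matrix ι ι ℂ} (hM : ∀ i j, ¬ p j → M i j = 0) (τ : {i // p i} ≃ Z)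
    (L : Module.End ℂ (Z → ℂ))
    (hL : ∀ (f : Z → ℂ) (i : {i // p i}), ∑ j : {i // p i}, M i j * f (τ j) = L f (τ i))
    {μ : ℂ} (hμ : μ ≠ 0) :
    Module.End.HasEigenvalue M.mulVecLin μ ↔ L.HasEigenvalue μ := by
  have hsum : ∀ (f : ι → ℂ) (i : ι), M.mulVecLin f i = ∑ j : {i // p i}, M i j * f j := by
    intro f i
    rw [Matrix.mulVecLin_apply, Matrix.mulVec, dotProduct,
      ← Finset.sum_subtype (Finset.univ.filter p) (by simp) (fun j => M i j * f j)]
    refine (Finset.sum_subset (Finset.filter_subset _ _) fun j _ hj => ?_).symm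
    rw [hM i j (by simpa using hj), zero_mul]
  constructor
  · intro h
    obtain ⟨f, hf⟩ := h.exists_hasEigenvector
    have hf1 : ∀ i, M.mulVecLin f i = μ * f i := fun i => congrFun hf.apply_eq_smul i
    refine hasEigenvalue_of_hasEigenvector (x := fun z => f (τ.symm z)) ⟨?_, fun h0 => hf.2 ?_⟩
    · rw [mem_eigenspace_iff]
      ext z
      obtain ⟨i, rfl⟩ := τ.surjective z
      rw [← hL]
      simp only [Equiv.symm_apply_apply, Pi.smul_apply, smul_eq_mul]
      rw [← hsum, hf1]
    · ext i
      have h1 := hf1 i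
      rw [hsum, Finset.sum_eq_zero] at h1
      · simpa [hμ] using h1.symm
      · intro j _
        have := congrFun h0 (τ j)
        simp only [Equiv.symm_apply_apply, Pi.zero_apply] at this
        rw [this, mul_zero]
  · intro h
    obtain ⟨f, hf⟩ := h.exists_hasEigenvector
    have hf1 : ∀ z, L f z = μ * f z := fun z => congrFun hf.apply_eq_smul z
    have hext : ∀ i : {i // p i}, μ⁻¹ * ∑ j : {i // p i}, M i j * f (τ j) = f (τ i) := fun i => by
      rw [hL, hf1, inv_mul_cancel_left₀ hμ]
    refine hasEigenvalue_of_hasEigenvector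
      (x := fun i => μ⁻¹ * ∑ j : {i // p i}, M i j * f (τ j)) ⟨?_, fun h0 => hf.2 ?_⟩
    · rw [mem_eigenspace_iff]
      ext i
      rw [hsum, Pi.smul_apply, smul_eq_mul, mul_inv_cancel_left₀ hμ]
      exact Finset.sum_congr rfl fun j _ => by rw [hext]
    · ext z
      obtain ⟨i, rfl⟩ := τ.surjective z
      rw [← hext i]
      exact congrFun h0 i

end Eigenvalues

/-! ### Values of Laurent polynomials. -/

section LaurentValue

/-- Evaluation of Laurent polynomials at a nonzero number, as a ring homomorphism. -/
def laurentEval (c : ℂ) (hc : c ≠ 0) : ℂ[T;T⁻¹] →+* ℂ :=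
  LaurentPolynomial.eval₂ (RingHom.id ℂ) (Units.mk0 c hc)

theorem laurentValue_add (p q : ℂ[T;T⁻¹]) (c : ℂ) :
    laurentValue (p + q) c = laurentValue p c + laurentValue q c :=
  Finsupp.sum_add_index' (fun _ => by simp) (fun _ _ _ => by ring)

theorem laurentValue_C_mul_T (a : ℂ) (n : ℤ) (c : ℂ) :
    laurentValue (LaurentPolynomial.C a * LaurentPolynomial.T n) c = a * c ^ n := by
  rw [← LaurentPolynomial.single_eq_C_mul_T]
  exact Finsupp.sum_single_index (by simp)

theorem laurentValue_eq_laurentEval (p : ℂ[T;T⁻¹]) {c : ℂ} (hc : c ≠ 0) :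
    laurentValue p c = laurentEval c hc p := by
  induction p using LaurentPolynomial.induction_on' with
  | add p q hp hq => rw [laurentValue_add, hp, hq, map_add]
  | C_mul_T n a =>
    rw [laurentValue_C_mul_T, laurentEval, LaurentPolynomial.eval₂_C_mul_T]
    simp

/-- The only pole is at the origin, which `c + ε t` does not reach for `|t| < |c|`. -/
theorem differentiableOn_laurentValue (p : ℂ[T;T⁻¹]) (c ε : ℂ) (hε : ‖ε‖ = 1) :
    DifferentiableOn ℂ (fun t => laurentValue p (c + ε * t)) (Metric.ball 0 ‖c‖) := by
  induction p using LaurentPolynomial.induction_on' with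
  | add p q hp hq => simp_rw [laurentValue_add]; exact hp.add hq
  | C_mul_T n a =>
    simp_rw [laurentValue_C_mul_T]
    refine (DifferentiableOn.zpow (by fun_prop) (Or.inl fun t ht h0 => ?_)).const_mul a
    rw [mem_ball_zero_iff] at ht
    have : c = -(ε * t) := eq_neg_of_add_eq_zero_left h0
    rw [this, norm_neg, norm_mul, hε, one_mul] at ht
    exact lt_irrefl _ ht

end LaurentValue

/-! ### Ward identities and their consequences for twisted functions. -/

section Ward

variable {V : Type v} [AddCommGroup V] [Module ℂ V] [VertexOperatorAlgebra V]
  {W P Q S : NGradedModule.{v, u} V} {N : ℕ} {κ : Type} {M : Type*} [AddCommGroup M] [Module ℂ M]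

/-- The Ward identity
`Φ(α₋₁ p) = ∑ⱼ x^j Φ(θ α₋₁₋ⱼ) + ∑ᵢ (x - y)^(-1-i) Φ(αᵢ q) + ∑ᵢ (x - z)^(-1-i) Φ(αᵢ s)`
for insertions of `p`, `q`, `s` at the points `x`, `y`, `z`. -/
def WardIdentity (Φ : κ → W.dualLE N → P → Q → S → M) (x y z : Module.End ℂ M) : Prop :=
  ∀ (k : κ) (θ : W.dualLE N) (p : P) (q : Q) (s : S) (n : ℕ), 1 ≤ n → ∀ α ∈ wtSpace V n,
    ∀ L L' : ℕ, (∀ j : ℕ, L ≤ j → vmode α (j : ℤ) q = 0) →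
      (∀ j : ℕ, L' ≤ j → vmode α (j : ℤ) s = 0) →
    ∃ (m : ℕ) (η : ℕ → W.dualLE N) (Ψ Ψ' : ℕ → M),
      (∀ i : ℕ, ((x - y) ^ (i + 1)) (Ψ i) = Φ k θ p (vmode α (i : ℤ) q) s) ∧
      (∀ i : ℕ, ((x - z) ^ (i + 1)) (Ψ' i) = Φ k θ p q (vmode α (i : ℤ) s)) ∧
      Φ k θ (vmode α (-1) p) q s = ∑ j ∈ Finset.range m, (x ^ j) (Φ k (η j) p q s) +
        ∑ i ∈ Finset.range L, Ψ i + ∑ i ∈ Finset.range L', Ψ' i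

/-- Allows the Ward identities to be proved once for series in two variables and then specialized.
The quotients `Ψ`, `Ψ'` may be mapped along because only their products with powers of the
differences are prescribed. -/
theorem WardIdentity.comp {M' : Type*} [AddCommGroup M'] [Module ℂ M']
    {Φ : κ → W.dualLE N → P → Q → S → M} {x y z : Module.End ℂ M} (h : WardIdentity Φ x y z)
    (f : M →ₗ[ℂ] M') {x' y' z' : Module.End ℂ M'} (hx : ∀ m, f (x m) = x' (f m))
    (hy : ∀ m, f (y m) = y' (f m)) (hz : ∀ m, f (z m) = z' (f m)) :
    WardIdentity (fun k θ p q s => f (Φ k θ p q s)) x' y' z' := by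
  have hpow : ∀ (a : Module.End ℂ M) (a' : Module.End ℂ M'), (∀ m, f (a m) = a' (f m)) →
      ∀ (i : ℕ) (m : M), f ((a ^ i) m) = (a' ^ i) (f m) := by
    intro a a' haa i
    induction i with
    | zero => simp
    | succ i ih => intro m; rw [pow_succ', pow_succ', Module.End.mul_apply, haa, ih]; rfl
  intro k θ p q s n hn α hα L L' hL hL'
  obtain ⟨m, η, Ψ, Ψ', h1, h2, h3⟩ := h k θ p q s n hn α hα L L' hL hL'
  refine ⟨m, η, fun i => f (Ψ i), fun i => f (Ψ' i), fun i => ?_, fun i => ?_, ?_⟩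
  · simp only [← h1, hpow (x - y) (x' - y') (fun m => by simp [hx, hy])]
  · simp only [← h2, hpow (x - z) (x' - z') (fun m => by simp [hx, hz])]
  · simp only [h3, map_add, map_sum, hpow x x' hx]

/-- The Ward identity for homogeneous vectors after multiplication with a power of `t`. -/
theorem WardIdentity.twisted {Φ : κ → W.dualLE N → P → Q → S → M}
    {act : ℂ[T;T⁻¹] →ₐ[ℂ] Module.End ℂ M} {x y z : ℂ[T;T⁻¹]}
    (h : WardIdentity Φ (act x) (act y) (act z)) {t r r' : ℂ[T;T⁻¹]} (hr : r * (x - y) = t)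
    (hr' : r' * (x - z) = t) (k : κ) (θ : W.dualLE N) {n : ℕ} (hn : 1 ≤ n) {α : V}
    (hα : α ∈ wtSpace V n) {a b d : ℕ} {p : P} {q : Q} {s : S} (hq : q ∈ Q.gr b)
    (hs : s ∈ S.gr d) : ∃ (m : ℕ) (η : ℕ → W.dualLE N),
      act (t ^ (a + n + b + d)) (Φ k θ (vmode α (-1) p) q s) =
        ∑ j ∈ Finset.range m, act (t ^ n * x ^ j) (act (t ^ (a + b + d)) (Φ k (η j) p q s)) +
        ∑ i ∈ Finset.range (b + n), act (r ^ (i + 1))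
          (act (t ^ (a + (b + n - (i + 1)) + d)) (Φ k θ p (vmode α (i : ℤ) q) s)) +
        ∑ i ∈ Finset.range (d + n), act (r' ^ (i + 1))
          (act (t ^ (a + b + (d + n - (i + 1)))) (Φ k θ p q (vmode α (i : ℤ) s))) := by
  obtain ⟨m, η, Ψ, Ψ', h1, h2, h3⟩ := h k θ p q s n hn α hα (b + n) (d + n)
    (fun j hj => Q.vmode_eq_zero n α hα _ b q hq (by omega))
    (fun j hj => S.vmode_eq_zero n α hα _ d s hs (by omega))
  refine ⟨m, η, ?_⟩
  rw [h3, map_add, map_add, map_sum, map_sum, map_sum]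
  congr 1
  · congr 1
    · refine Finset.sum_congr rfl fun j _ => ?_
      rw [← map_pow, ← Module.End.mul_apply, ← Module.End.mul_apply, ← map_mul, ← map_mul]
      congr 2
      ring
    · refine Finset.sum_congr rfl fun i hi => ?_
      rw [Finset.mem_range] at hi
      -- The power `t^(i+1) = (r (x - y))^(i+1)` cancels the denominator of `Ψ i`. The remaining
      -- exponent of `t` is the total degree of the new insertions.
      rw [← h1, ← map_sub, ← map_pow, ← Module.End.mul_apply, ← Module.End.mul_apply, ← map_mul,
        ← map_mul, mul_assoc, mul_comm (t ^ _), ← mul_assoc, ← mul_pow, hr, ← pow_add]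
      congr 3
      omega
  · refine Finset.sum_congr rfl fun i hi => ?_
    rw [Finset.mem_range] at hi
    rw [← h2, ← map_sub, ← map_pow, ← Module.End.mul_apply, ← Module.End.mul_apply, ← map_mul,
      ← map_mul, mul_assoc, mul_comm (t ^ _), ← mul_assoc, ← mul_pow, hr', ← pow_add]
    congr 3
    omega

/-- Four-point functions with insertions of `p`, `q`, `s` at `zp`, `zq`, `zs`, with values in a
module over the Laurent polynomials, together with the derivation `δ = t d/dzp`, `t = zp - zq`. -/
structure WardSystem (W P Q S : NGradedModule.{v, u} V) (N : ℕ) (κ : Type) [Fintype κ]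
    (M : Type*) [AddCommGroup M] [Module ℂ M] (act : ℂ[T;T⁻¹] →ₐ[ℂ] Module.End ℂ M) where
  Φ : κ → W.dualLE N → P → Q → S → M
  lin_θ : ∀ k p q s, IsLinearMap ℂ fun θ => Φ k θ p q s
  lin_p : ∀ k θ q s, IsLinearMap ℂ fun p => Φ k θ p q s
  lin_q : ∀ k θ p s, IsLinearMap ℂ fun q => Φ k θ p q s
  lin_s : ∀ k θ p q, IsLinearMap ℂ fun s => Φ k θ p q s
  zp : ℂ[T;T⁻¹]
  zq : ℂ[T;T⁻¹]
  zs : ℂ[T;T⁻¹]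
  t : ℂ[T;T⁻¹]
  t_eq : zp - zq = t
  isUnit_ps : IsUnit (zp - zs)
  isUnit_qs : IsUnit (zq - zs)
  ward_p : WardIdentity Φ (act zp) (act zq) (act zs)
  ward_q : WardIdentity (fun k θ q p s => Φ k θ p q s) (act zq) (act zp) (act zs)
  ward_s : WardIdentity (fun k θ s p q => Φ k θ p q s) (act zs) (act zp) (act zq)
  δ : Module.End ℂ M
  δ_t : ∀ m, δ (act t m) = act t m + act t (δ m)
  /-- the contribution of the logarithm of `t` -/
  n : Matrix κ κ ℂ
  rank : κ → ℕ
  rank_lt : ∀ k k', n k k' ≠ 0 → rank k < rank k'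
  /-- the contribution of the other logarithm -/
  l : Matrix κ κ ℂ[T;T⁻¹]
  δ_Φ : ∀ k θ p q s, δ (Φ k θ p q s) = act t (Φ k θ (vmode (conf : V) 0 p) q s) +
    ∑ k', n k k' • Φ k' θ p q s + ∑ k', act (t * l k k') (Φ k' θ p q s)

namespace WardSystem

variable [Fintype κ] {act : ℂ[T;T⁻¹] →ₐ[ℂ] Module.End ℂ M} (X : WardSystem W P Q S N κ M act)

theorem δ_pow (g : ℕ) (m : M) :
    X.δ (act (X.t ^ g) m) = (g : ℂ) • act (X.t ^ g) m + act (X.t ^ g) (X.δ m) := by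
  induction g generalizing m with
  | zero => simp
  | succ g ih =>
    rw [pow_succ, map_mul, Module.End.mul_apply, ih, X.δ_t, map_add]
    simp only [Module.End.mul_apply]
    push_cast
    module

/-- The linear map `p ⊗ q ↦ t^(gr p + gr q + d) Φ(θ, p, q, s)`. -/
def twist (k : κ) (θ : W.dualLE N) (s : S) (d : ℕ) : P ⊗[ℂ] Q →ₗ[ℂ] M :=
  glue₂ fun a b => LinearMap.mk₂ ℂ (fun p q => act (X.t ^ (a + b + d)) (X.Φ k θ p q s))
    (fun p p' q => by rw [(X.lin_p k θ q s).map_add, map_add])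
    (fun c p q => by rw [(X.lin_p k θ q s).map_smul, map_smul])
    (fun p q q' => by rw [(X.lin_q k θ p s).map_add, map_add])
    (fun c p q => by rw [(X.lin_q k θ p s).map_smul, map_smul])

theorem twist_tmul (k : κ) (θ : W.dualLE N) (s : S) (d : ℕ) {a b : ℕ} {p : P} {q : Q}
    (hp : p ∈ P.gr a) (hq : q ∈ Q.gr b) :
    X.twist k θ s d (p ⊗ₜ q) = act (X.t ^ (a + b + d)) (X.Φ k θ p q s) := by
  rw [twist, glue₂_tmul _ hp hq, LinearMap.mk₂_apply]

/-- A submodule containing the twisted four-point functions of all generators contains all twisted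
four-point functions. -/
theorem act_mem {Z : Submodule ℂ M} (hZ : ∀ r, ∀ m ∈ Z, act r m ∈ Z)
    {sP : Finset P} {sQ : Finset Q} {sS : Finset S} (hP : P.SpansModC1 sP) (hQ : Q.SpansModC1 sQ)
    (hS : S.SpansModC1 sS)
    (hgen : ∀ k θ a b d, ∀ p ∈ sP, p ∈ P.gr a → ∀ q ∈ sQ, q ∈ Q.gr b → ∀ s ∈ sS, s ∈ S.gr d →
      act (X.t ^ (a + b + d)) (X.Φ k θ p q s) ∈ Z)
    (k : κ) (θ : W.dualLE N) {a b d : ℕ} {p : P} {q : Q} {s : S} (hp : p ∈ P.gr a)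
    (hq : q ∈ Q.gr b) (hs : s ∈ S.gr d) : act (X.t ^ (a + b + d)) (X.Φ k θ p q s) ∈ Z := by
  obtain ⟨vp, hvp⟩ := X.isUnit_ps.exists_left_inv
  obtain ⟨vq, hvq⟩ := X.isUnit_qs.exists_left_inv
  -- Induction on the total degree of the three insertions, with `k` and `θ` arbitrary since the
  -- Ward identities change the functional.
  induction hD : a + b + d using Nat.strong_induction_on generalizing a b d p q s k θ with
  | _ D ih =>
  have ih' : ∀ (k : κ) (θ : W.dualLE N) {a b d : ℕ} {p : P} {q : Q} {s : S}, p ∈ P.gr a →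
      q ∈ Q.gr b → s ∈ S.gr d → a + b + d < D → act (X.t ^ (a + b + d)) (X.Φ k θ p q s) ∈ Z :=
    fun k θ a b d p q s hp hq hs hlt => ih _ hlt k θ hp hq hs rfl
  subst hD
  refine hP.map_mem (act (X.t ^ (a + b + d)) ∘ₗ (X.lin_p k θ q s).mk') Z (fun p hpP hp => ?_) ?_ hp
  swap
  · intro n hn α hα a' ha' p' hp'
    -- `r = 1` because `zp - zq` is `t` itself, while `r' = t / (zp - zs)` makes sense because the
    -- third point stays away from the first.
    obtain ⟨m, η, h⟩ := X.ward_p.twisted (t := X.t) (r := 1) (r' := X.t * vp)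
      (by rw [one_mul, X.t_eq]) (by rw [mul_assoc, hvp, mul_one]) k θ hn hα (a := a') (p := p')
        hq hs
    subst ha'
    refine (congrArg (· ∈ Z) h).mpr (Z.add_mem (Z.add_mem (Z.sum_mem fun j _ => hZ _ _ ?_)
      (Z.sum_mem fun i hi => hZ _ _ ?_)) (Z.sum_mem fun i hi => hZ _ _ ?_))
    · exact ih' k _ hp' hq hs (by omega)
    · rw [Finset.mem_range] at hi
      exact ih' k θ hp' (Q.vmode_mem n α hα i b q hq _ (by omega)) hs (by omega)
    · rw [Finset.mem_range] at hi
      exact ih' k θ hp' hq (S.vmode_mem n α hα i d s hs _ (by omega)) (by omega)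
  refine hQ.map_mem (act (X.t ^ (a + b + d)) ∘ₗ (X.lin_q k θ p s).mk') Z (fun q hqQ hq => ?_) ?_ hq
  swap
  · intro n hn α hα b' hb' q' hq'
    obtain ⟨m, η, h⟩ := X.ward_q.twisted (t := X.t) (r := -1) (r' := X.t * vq)
      (by rw [← X.t_eq]; ring) (by rw [mul_assoc, hvq, mul_one]) k θ hn hα (a := b') (p := q') hp hs
    subst hb'
    rw [show b' + n + a + d = a + (b' + n) + d by ring] at h
    refine (congrArg (· ∈ Z) h).mpr (Z.add_mem (Z.add_mem (Z.sum_mem fun j _ => hZ _ _ ?_)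
      (Z.sum_mem fun i hi => hZ _ _ ?_)) (Z.sum_mem fun i hi => hZ _ _ ?_))
    · rw [add_comm b' a]
      exact ih' k _ hp hq' hs (by omega)
    · rw [Finset.mem_range] at hi
      rw [add_comm b']
      exact ih' k θ (P.vmode_mem n α hα i a p hp _ (by omega)) hq' hs (by omega)
    · rw [Finset.mem_range] at hi
      rw [add_comm b']
      exact ih' k θ hp hq' (S.vmode_mem n α hα i d s hs _ (by omega)) (by omega)
  refine hS.map_mem (act (X.t ^ (a + b + d)) ∘ₗ (X.lin_s k θ p q).mk') Z (fun s hsS hs => ?_) ?_ hs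
  · exact hgen k θ a b d p hpP hp q hqQ hq s hsS hs
  · intro n hn α hα d' hd' s' hs'
    obtain ⟨m, η, h⟩ := X.ward_s.twisted (t := X.t) (r := -(X.t * vp)) (r' := -(X.t * vq))
      (by linear_combination X.t * hvp) (by linear_combination X.t * hvq) k θ hn hα
      (a := d') (p := s') hp hq
    subst hd'
    rw [show d' + n + a + b = a + b + (d' + n) by ring] at h
    refine (congrArg (· ∈ Z) h).mpr (Z.add_mem (Z.add_mem (Z.sum_mem fun j _ => hZ _ _ ?_)
      (Z.sum_mem fun i hi => hZ _ _ ?_)) (Z.sum_mem fun i hi => hZ _ _ ?_))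
    · rw [show d' + a + b = a + b + d' by ring]
      exact ih' k _ hp hq hs' (by omega)
    · rw [Finset.mem_range] at hi
      rw [show d' + (a + n - (i + 1)) + b = a + n - (i + 1) + b + d' by ring]
      exact ih' k θ (P.vmode_mem n α hα i a p hp _ (by omega)) hq hs' (by omega)
    · rw [Finset.mem_range] at hi
      rw [show d' + a + (b + n - (i + 1)) = a + (b + n - (i + 1)) + d' by ring]
      exact ih' k θ hp (Q.vmode_mem n α hα i b q hq _ (by omega)) hs' (by omega)

/-- The twisted four-point functions of the relations are divisible by `t`. -/
theorem twist_relations_mem {Z : Submodule ℂ M} (hZ : ∀ r, ∀ m ∈ Z, act r m ∈ Z)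
    (hall : ∀ k θ a b d, ∀ p ∈ P.gr a, ∀ q ∈ Q.gr b, ∀ s ∈ S.gr d,
      act (X.t ^ (a + b + d)) (X.Φ k θ p q s) ∈ Z) (k : κ) (θ : W.dualLE N) {d : ℕ} {s : S}
    (hs : s ∈ S.gr d) {x : P ⊗[ℂ] Q} (hx : x ∈ relations P Q) :
    X.twist k θ s d x ∈ Z.map (act X.t) := by
  obtain ⟨vp, hvp⟩ := X.isUnit_ps.exists_left_inv
  obtain ⟨vq, hvq⟩ := X.isUnit_qs.exists_left_inv
  -- Two kinds of terms are divisible by `t`: those with `θ` shifted, which carry `t^n` with `n ≥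
  -- 1`, and those with a mode on `s`, which carry a positive power of `t` over a difference that is
  -- a unit.
  have hdiv : ∀ (r : ℂ[T;T⁻¹]) (m : M), m ∈ Z → act (X.t * r) m ∈ Z.map (act X.t) := by
    intro r m hm
    rw [map_mul]
    exact ⟨_, hZ r m hm, rfl⟩
  have hdiv' : ∀ (r : ℂ[T;T⁻¹]) (i : ℕ) (m : M), m ∈ Z →
      act ((X.t * r) ^ (i + 1)) m ∈ Z.map (act X.t) := by
    intro r i m hm
    rw [show (X.t * r) ^ (i + 1) = X.t * (r * (X.t * r) ^ i) by ring]
    exact hdiv _ m hm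
  have hdiv'' : ∀ (r : ℂ[T;T⁻¹]) {n : ℕ} (m : M), 1 ≤ n → m ∈ Z →
      act (X.t ^ n * r) m ∈ Z.map (act X.t) := by
    intro r n m hn hm
    obtain ⟨n, rfl⟩ := Nat.exists_eq_add_of_le' hn
    rw [pow_succ', mul_assoc]
    exact hdiv _ m hm
  have hle : relations P Q ≤ (Z.map (act X.t)).comap (X.twist k θ s d) := by
    rw [relations, Submodule.span_le]
    rintro x ⟨n, hn, α, hα, a, p, hp, b, q, hq, rfl | rfl⟩
    · simp only [SetLike.mem_coe, Submodule.mem_comap]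
      rw [outerRelation_eq (L := a + n) (fun j hj => P.vmode_eq_zero n α hα _ a p hp (by omega)),
        map_add, map_sum, X.twist_tmul k θ s d hp (Q.vmode_neg_one_mem_gr hα hq)]
      obtain ⟨m, η, h⟩ := X.ward_q.twisted (t := X.t) (r := -1) (r' := X.t * vq)
        (by rw [← X.t_eq]; ring) (by rw [mul_assoc, hvq, mul_one]) k θ hn hα (a := b) (p := q) hp hs
      rw [show b + n + a + d = a + (b + n) + d by ring] at h
      -- The terms with modes on `p` carry no free factor of `t`. They have the sign `(-1)^(i+1)`
      -- from `zq - zp = -t` and cancel those with sign `(-1)^i` in the relation.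
      have hmid : ∑ i ∈ Finset.range (a + n), act ((-1 : ℂ[T;T⁻¹]) ^ (i + 1))
          (act (X.t ^ (b + (a + n - (i + 1)) + d)) (X.Φ k θ (vmode α (i : ℤ) p) q s)) +
          ∑ i ∈ Finset.range (a + n), X.twist k θ s d ((-1 : ℂ) ^ i • (vmode α (i : ℤ) p ⊗ₜ[ℂ] q))
            = 0 := by
        rw [← Finset.sum_add_distrib]
        refine Finset.sum_eq_zero fun i hi => ?_
        rw [Finset.mem_range] at hi
        have hm : vmode α (i : ℤ) p ∈ P.gr (a + n - (i + 1)) :=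
          P.vmode_mem n α hα i a p hp _ (by omega)
        rw [map_smul, X.twist_tmul k θ s d hm hq, add_comm b, map_pow, map_neg, map_one,
          show ((-1 : Module.End ℂ M) ^ (i + 1)) = ((-1 : ℂ) ^ (i + 1)) • (1 : Module.End ℂ M) by
            rcases neg_one_pow_eq_or (Module.End ℂ M) (i + 1) with h | h <;>
            rcases Nat.even_or_odd (i + 1) with h' | h' <;> simp [h'.neg_one_pow],
          LinearMap.smul_apply, Module.End.one_apply, pow_succ]
        module
      refine (congrArg (· ∈ Z.map (act X.t)) (?_ : _ = _)).mpr (Submodule.add_mem _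
        (Submodule.sum_mem (t := Finset.range m) (f := fun j => act (X.t ^ n * X.zq ^ j)
          (act (X.t ^ (b + a + d)) (X.Φ k (η j) p q s))) _ fun j _ => hdiv'' _ _ hn ?_)
        (Submodule.sum_mem (t := Finset.range (d + n)) (f := fun i => act ((X.t * vq) ^ (i + 1))
          (act (X.t ^ (b + a + (d + n - (i + 1)))) (X.Φ k θ p q (vmode α (i : ℤ) s)))) _
          fun i hi => hdiv' _ _ _ ?_))
      · rw [h]
        rw [← sub_eq_zero]
        refine Eq.trans ?_ hmid
        abel
      · rw [add_comm b]
        exact hall _ _ _ _ _ p hp q hq s hs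
      · rw [Finset.mem_range] at hi
        rw [add_comm b]
        exact hall _ _ _ _ _ p hp q hq _ (S.vmode_mem n α hα i d s hs _ (by omega))
    · simp only [SetLike.mem_coe, Submodule.mem_comap]
      rw [innerRelation_eq (L := b + n) (fun j hj => Q.vmode_eq_zero n α hα _ b q hq (by omega)),
        map_sub, map_sum, X.twist_tmul k θ s d (P.vmode_neg_one_mem_gr hα hp) hq]
      obtain ⟨m, η, h⟩ := X.ward_p.twisted (t := X.t) (r := 1) (r' := X.t * vp)
        (by rw [one_mul, X.t_eq]) (by rw [mul_assoc, hvp, mul_one]) k θ hn hα (a := a) (p := p)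
          hq hs
      have hmid : ∑ i ∈ Finset.range (b + n), act ((1 : ℂ[T;T⁻¹]) ^ (i + 1))
          (act (X.t ^ (a + (b + n - (i + 1)) + d)) (X.Φ k θ p (vmode α (i : ℤ) q) s)) =
          ∑ i ∈ Finset.range (b + n), X.twist k θ s d (p ⊗ₜ[ℂ] vmode α (i : ℤ) q) := by
        refine Finset.sum_congr rfl fun i hi => ?_
        rw [Finset.mem_range] at hi
        have hm : vmode α (i : ℤ) q ∈ Q.gr (b + n - (i + 1)) :=
          Q.vmode_mem n α hα i b q hq _ (by omega)
        rw [X.twist_tmul k θ s d hp hm, one_pow, map_one, Module.End.one_apply]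
      rw [h, hmid, add_right_comm, add_sub_cancel_right]
      refine Submodule.add_mem _ (Submodule.sum_mem _ fun j _ => hdiv'' _ _ hn ?_)
        (Submodule.sum_mem _ fun i hi => hdiv' _ _ _ ?_)
      · exact hall _ _ _ _ _ p hp q hq s hs
      · rw [Finset.mem_range] at hi
        exact hall _ _ _ _ _ p hp q hq _ (S.vmode_mem n α hα i d s hs _ (by omega))
  exact hle hx

/-- The derivative of the twisted four-point functions. -/
theorem δ_twist (k : κ) (θ : W.dualLE N) {a b d : ℕ} {p : P} {q : Q} (s : S) (hp : p ∈ P.gr a)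
    (hq : q ∈ Q.gr b) : X.δ (act (X.t ^ (a + b + d)) (X.Φ k θ p q s)) =
      (d : ℂ) • act (X.t ^ (a + b + d)) (X.Φ k θ p q s) +
        X.twist k θ s d (fusionOp P Q (p ⊗ₜ q)) +
        ∑ k', X.n k k' • act (X.t ^ (a + b + d)) (X.Φ k' θ p q s) +
        act X.t (∑ k', act (X.l k k') (act (X.t ^ (a + b + d)) (X.Φ k' θ p q s))) := by
  rw [X.δ_pow, X.δ_Φ, fusionOp_tmul hp hq, map_add (X.twist k θ s d),
    map_smul (X.twist k θ s d), X.twist_tmul k θ s d hp hq,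
    X.twist_tmul k θ s d (P.vmode_conf_zero_mem_gr hp) hq]
  simp only [map_add (act _), map_sum (act _)]
  -- The factor `t` in `δ = t d/dzp` is exactly the additional twist required by `L(-1) p`, whose
  -- degree is one higher.
  have e1 : act (X.t ^ (a + b + d)) (act X.t (X.Φ k θ (vmode (conf : V) 0 p) q s)) =
      act (X.t ^ (a + 1 + b + d)) (X.Φ k θ (vmode (conf : V) 0 p) q s) := by
    rw [← Module.End.mul_apply, ← map_mul, ← pow_succ]
    congr 3
    ring
  have e2 : ∀ k', act (X.t ^ (a + b + d)) (act (X.t * X.l k k') (X.Φ k' θ p q s)) =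
      act X.t (act (X.l k k') (act (X.t ^ (a + b + d)) (X.Φ k' θ p q s))) := by
    intro k'
    simp only [← Module.End.mul_apply, ← map_mul]
    congr 2
    ring
  simp only [e1, e2, map_smul]
  push_cast
  module

end WardSystem

end Ward

/-- Writes `sliceOp g d + lastOp n` as one matrix, acting on functions with values in any complex
vector space. It serves both for the differential equation and for the eigenvalue problem. -/
theorem sum_slice_last_smul {Y X κ M : Type*} [Fintype Y] [Fintype X] [Fintype κ] [DecidableEq Y]
    [DecidableEq X] [DecidableEq κ] [AddCommGroup M] [Module ℂ M] (g : Y → ℂ) (d : Matrix X X ℂ)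
    (n : Matrix κ κ ℂ) (f : Y × X × κ → M) (y : Y) (x : X) (k : κ) :
    ∑ z' : Y × X × κ, (if y = z'.1 then ((if k = z'.2.2 then (if x = z'.2.1 then g y else 0) +
      d x z'.2.1 else 0) + if x = z'.2.1 then n k z'.2.2 else 0) else 0) • f z' =
    g y • f (y, x, k) + ∑ x', d x x' • f (y, x', k) + ∑ k', n k k' • f (y, x, k') := by
  simp only [Fintype.sum_prod_type, ite_smul, zero_smul, add_smul, Finset.sum_ite_irrel,
    Finset.sum_const_zero, Finset.sum_ite_eq, Finset.mem_univ, if_true, Finset.sum_add_distrib]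

theorem sum_eq_sum_subtype {ι M : Type*} [Fintype ι] [AddCommMonoid M] {p : ι → Prop}
    [DecidablePred p] {f : ι → M} (h : ∀ j, ¬ p j → f j = 0) :
    ∑ j, f j = ∑ j : {j // p j}, f j := by
  rw [← Finset.sum_subtype (Finset.univ.filter p) (by simp) f]
  exact (Finset.sum_subset (Finset.filter_subset _ _) fun j _ hj => h j (by simpa using hj)).symm

theorem laurentValue_C (a c : ℂ) : laurentValue (LaurentPolynomial.C a) c = a := by
  simpa using laurentValue_C_mul_T a 0 c

namespace DualBasis

variable {V : Type v} [AddCommGroup V] [Module ℂ V] [VertexOperatorAlgebra V]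
  {W : NGradedModule.{v, u} V} {N : ℕ} (J : DualBasis W N)

/-- An element of the basis as an element of `W^∨₍≤N₎`. -/
def toDualLE (θ : J.elems) : W.dualLE N :=
  ⟨θ.1, J.span_eq ▸ Submodule.subset_span θ.2⟩

theorem map_mem {M : Type*} [AddCommGroup M] [Module ℂ M] (f : W.dualLE N →ₗ[ℂ] M)
    (Z : Submodule ℂ M) (h : ∀ θ, f (J.toDualLE θ) ∈ Z) (θ : W.dualLE N) : f θ ∈ Z := by
  obtain ⟨θ, hθ⟩ := θ
  have hθ' := hθ
  rw [← J.span_eq] at hθ'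
  induction hθ' using Submodule.span_induction with
  | mem x hx => exact h ⟨x, hx⟩
  | zero => exact (congrArg (· ∈ Z) (map_zero f)).mpr Z.zero_mem
  | add x y hx hy hx' hy' =>
    rw [J.span_eq] at hx hy
    exact (congrArg (· ∈ Z) (map_add f ⟨x, hx⟩ ⟨y, hy⟩)).mpr (Z.add_mem (hx' hx) (hy' hy))
  | smul c x hx hx' =>
    rw [J.span_eq] at hx
    exact (congrArg (· ∈ Z) (map_smul f c ⟨x, hx⟩)).mpr (Z.smul_mem c (hx' hx))

end DualBasis

/-! ### The coefficient matrix of an abstract system and its residue. -/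

namespace WardSystem

variable {V : Type v} [AddCommGroup V] [Module ℂ V] [VertexOperatorAlgebra V]
  {W P Q S : NGradedModule.{v, u} V} {N : ℕ} {κ : Type} {M : Type*} [AddCommGroup M] [Module ℂ M]
  [Fintype κ] {act : ℂ[T;T⁻¹] →ₐ[ℂ] Module.End ℂ M} (X : WardSystem W P Q S N κ M act)

/-- The vector of the twisted four-point functions of the elements of the given bases. -/
def G (J : DualBasis W N) (bP : HomogeneousBases P) (bQ : HomogeneousBases Q)
    (bS : HomogeneousBases S) (i : J.elems × bP.big × bQ.big × bS.big × κ) : M :=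
  act (X.t ^ (P.grade i.2.1.1 + Q.grade i.2.2.1.1 + S.grade i.2.2.2.1.1))
    (X.Φ i.2.2.2.2 (J.toDualLE i.1) i.2.1 i.2.2.1 i.2.2.2.1)

/-- The components of the index lie in the bases of the complements of `C₁`. -/
def IsSmall {J : DualBasis W N} {bP : HomogeneousBases P} {bQ : HomogeneousBases Q}
    {bS : HomogeneousBases S} (i : J.elems × bP.big × bQ.big × bS.big × κ) : Prop :=
  (i.2.1 : P) ∈ bP.small ∧ (i.2.2.1 : Q) ∈ bQ.small ∧ (i.2.2.2.1 : S) ∈ bS.small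

/-- Small indices, regrouped. -/
def smallEquiv (J : DualBasis W N) (bP : HomogeneousBases P) (bQ : HomogeneousBases Q)
    (bS : HomogeneousBases S) {ι : Type*} (e : ι ≃ J.elems × bP.big × bQ.big × bS.big × κ) :
    {i // IsSmall (e i)} ≃ (J.elems × bS.small) × (bP.small × bQ.small) × κ where
  toFun i := (((e i.1).1, ⟨_, i.2.2.2⟩), (⟨_, i.2.1⟩, ⟨_, i.2.2.1⟩), (e i.1).2.2.2.2)
  invFun z := ⟨e.symm (z.1.1, ⟨z.2.1.1.1, bP.small_subset z.2.1.1.2⟩,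
    ⟨z.2.1.2.1, bQ.small_subset z.2.1.2.2⟩, ⟨z.1.2.1, bS.small_subset z.1.2.2⟩, z.2.2), by
      rw [e.apply_symm_apply]; exact ⟨z.2.1.1.2, z.2.1.2.2, z.1.2.2⟩⟩
  left_inv i := by
    apply Subtype.ext
    simp
  right_inv z := by simp

open Classical in
-- By `act_mem` all derivatives lie in the Laurent span of the small components, which gives a
-- matrix with the required zero columns. For a small index, `δ_twist` involves the twist of
-- `fusionOp (p ⊗ q)`; replacing it by the residue matrix costs a relation, and the twist of a
-- relation is divisible by `t`. So at `t = 0` the small block is `gr(s)` plus the residue matrix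
-- plus the nilpotent contribution of the logarithm.
theorem exists_fuchsianMatrix (hP : P.C1Cofinite) (hQ : Q.C1Cofinite) (J : DualBasis W N)
    (bP : HomogeneousBases P) (bQ : HomogeneousBases Q) (bS : HomogeneousBases S) {ι : Type*}
    [Fintype ι] (e : ι ≃ J.elems × bP.big × bQ.big × bS.big × κ) {c : ℂ} (hc : c ≠ 0)
    (ht : laurentValue X.t c = 0) :
    ∃ Λ : Matrix ι ι ℂ[T;T⁻¹], (∀ i j, ¬ IsSmall (e j) → Λ i j = 0) ∧
      ((∃ j, IsSmall (e j)) → ∀ μ ≠ 0,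
        (Module.End.HasEigenvalue (Λ.map fun p => laurentValue p c).mulVecLin μ ↔
          ∃ ε ∈ residueEigenvalues P Q, ∃ s ∈ bS.small, μ = ε + S.grade s)) ∧
      ∀ i, X.δ (X.G J bP bQ bS (e i)) = ∑ j, act (Λ i j) (X.G J bP bQ bS (e j)) := by
  obtain ⟨dm, hdm, hdμ⟩ := exists_residueMatrix hP hQ bP bQ
  set G : ι → M := fun i => X.G J bP bQ bS (e i) with hG
  set τ := smallEquiv (κ := κ) J bP bQ bS e with hτ
  -- The span, over the Laurent polynomials, of the components with small index.
  let Z : Submodule ℂ M :=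
    { carrier := {m | ∃ r : ι → ℂ[T;T⁻¹], (∀ j, ¬ IsSmall (e j) → r j = 0) ∧
        m = ∑ j, act (r j) (G j)}
      add_mem' := by
        rintro _ _ ⟨r, hr, rfl⟩ ⟨r', hr', rfl⟩
        refine ⟨r + r', fun j hj => by simp [hr j hj, hr' j hj], ?_⟩
        simp [Finset.sum_add_distrib]
      zero_mem' := ⟨0, fun _ _ => rfl, by simp⟩
      smul_mem' := by
        rintro a _ ⟨r, hr, rfl⟩
        refine ⟨a • r, fun j hj => by simp [hr j hj], ?_⟩
        simp [Finset.smul_sum] }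
  have hC : ∀ (a : ℂ) (m : M), act (LaurentPolynomial.C a) m = a • m := fun a m => by
    rw [show LaurentPolynomial.C a = algebraMap ℂ ℂ[T;T⁻¹] a from rfl, act.commutes]
    rfl
  have hZ : ∀ r, ∀ m ∈ Z, act r m ∈ Z := by
    rintro a _ ⟨r, hr, rfl⟩
    refine ⟨fun j => a * r j, fun j hj => by simp [hr j hj], ?_⟩
    simp [map_sum]
  have hGZ : ∀ i, IsSmall (e i) → G i ∈ Z := by
    intro i hi
    refine ⟨Pi.single i 1, fun j hj => Pi.single_eq_of_ne (by rintro rfl; exact hj hi) _, ?_⟩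
    rw [Finset.sum_eq_single i (fun j _ hj => by simp [Pi.single_eq_of_ne hj]) (by simp)]
    simp
  have hall : ∀ k θ a b d, ∀ p ∈ P.gr a, ∀ q ∈ Q.gr b, ∀ s ∈ S.gr d,
      act (X.t ^ (a + b + d)) (X.Φ k θ p q s) ∈ Z := by
    intro k θ a b d p hp q hq s hs
    refine X.act_mem hZ bP.spansModC1 bQ.spansModC1 bS.spansModC1 ?_ k θ hp hq hs
    intro k θ a b d p hpP hp q hqQ hq s hsS hs
    refine J.map_mem (act (X.t ^ (a + b + d)) ∘ₗ (X.lin_θ k p q s).mk') Z (fun θ => ?_) θ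
    have hpP' := bP.small_subset hpP
    have hqQ' := bQ.small_subset hqQ
    have hsS' := bS.small_subset hsS
    have h := hGZ (e.symm (θ, ⟨p, hpP'⟩, ⟨q, hqQ'⟩, ⟨s, hsS'⟩, k))
      (by rw [e.apply_symm_apply]; exact ⟨hpP, hqQ, hsS⟩)
    simp only [hG, e.apply_symm_apply, WardSystem.G, P.grade_eq (bP.ne_zero hpP') hp,
      Q.grade_eq (bQ.ne_zero hqQ') hq, S.grade_eq (bS.ne_zero hsS') hs] at h
    exact h
  have htw : ∀ k θ d, ∀ s ∈ S.gr d, ∀ x, X.twist k θ s d x ∈ Z := by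
    intro k θ d s hs x
    induction x using tensor_hom_induction with
    | add x y hx hy => rw [map_add]; exact Z.add_mem hx hy
    | hom a p hp b q hq =>
      rw [X.twist_tmul k θ s d hp hq]
      exact hall k θ a b d p hp q hq s hs
  have hGτ : ∀ z, G (τ.symm z).1 = X.twist z.2.2 (J.toDualLE z.1.1) z.1.2.1 (S.grade z.1.2.1)
      (z.2.1.1.1 ⊗ₜ z.2.1.2.1) := by
    intro z
    rw [X.twist_tmul _ _ _ _ (bP.mem_gr_grade (bP.small_subset z.2.1.1.2))
      (bQ.mem_gr_grade (bQ.small_subset z.2.1.2.2))]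
    simp [hG, hτ, smallEquiv, WardSystem.G]
  let g : J.elems × bS.small → ℂ := fun y => S.grade y.2.1
  -- The predicted value of the small block at `t = 0`.
  let b : (J.elems × bS.small) × (bP.small × bQ.small) × κ →
      (J.elems × bS.small) × (bP.small × bQ.small) × κ → ℂ := fun z z' =>
    if z.1 = z'.1 then ((if z.2.2 = z'.2.2 then (if z.2.1 = z'.2.1 then g z.1 else 0) +
      dm z.2.1 z'.2.1 else 0) + if z.2.1 = z'.2.1 then X.n z.2.2 z'.2.2 else 0) else 0
  have hδ : ∀ i, ∃ r : ι → ℂ[T;T⁻¹], (∀ j, ¬ IsSmall (e j) → r j = 0) ∧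
      X.δ (G i) = ∑ j, act (r j) (G j) ∧
      ∀ (hi : IsSmall (e i)) (j) (hj : IsSmall (e j)),
        laurentValue (r j) c = b (τ ⟨i, hi⟩) (τ ⟨j, hj⟩) := by
    intro i
    obtain ⟨⟨θ, ⟨p, hp⟩, ⟨q, hq⟩, ⟨s, hs⟩, k⟩, rfl⟩ := e.symm.surjective i
    have hp' := bP.mem_gr_grade hp
    have hq' := bQ.mem_gr_grade hq
    have hs' := bS.mem_gr_grade hs
    have h := X.δ_twist k (J.toDualLE θ) (d := S.grade s) s hp' hq'
    have hl : ∑ k', act (X.l k k') (act (X.t ^ (P.grade p + Q.grade q + S.grade s))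
        (X.Φ k' (J.toDualLE θ) p q s)) ∈ Z :=
      Z.sum_mem fun k' _ => hZ _ _ (hall _ _ _ _ _ p hp' q hq' s hs')
    have hGi : G (e.symm (θ, ⟨p, hp⟩, ⟨q, hq⟩, ⟨s, hs⟩, k)) =
        act (X.t ^ (P.grade p + Q.grade q + S.grade s)) (X.Φ k (J.toDualLE θ) p q s) := by
      simp only [hG, e.apply_symm_apply, WardSystem.G]
    by_cases hi : IsSmall (e (e.symm (θ, ⟨p, hp⟩, ⟨q, hq⟩, ⟨s, hs⟩, k)))
    swap
    -- Rows outside the small indices do not affect nonzero eigenvalues, so any representation in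
    -- `Z` will do.
    · have hmem : X.δ (G (e.symm (θ, ⟨p, hp⟩, ⟨q, hq⟩, ⟨s, hs⟩, k))) ∈ Z := by
        rw [hGi, h]
        exact Z.add_mem (Z.add_mem (Z.add_mem (Z.smul_mem _ (hall _ _ _ _ _ p hp' q hq' s hs'))
          (htw _ _ _ s hs' _)) (Z.sum_mem fun k' _ =>
            Z.smul_mem _ (hall _ _ _ _ _ p hp' q hq' s hs'))) (hZ _ _ hl)
      obtain ⟨r, hr, hr'⟩ := hmem
      exact ⟨r, hr, hr', fun hi' => absurd hi' hi⟩
    · set z : (J.elems × bS.small) × (bP.small × bQ.small) × κ := τ ⟨_, hi⟩ with hz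
      have hz' : z = ((θ, ⟨s, by simpa using hi.2.2⟩), (⟨p, by simpa using hi.1⟩,
          ⟨q, by simpa using hi.2.1⟩), k) := by
        simp [hz, hτ, smallEquiv]
      obtain ⟨m, hmZ, hm⟩ := X.twist_relations_mem hZ hall k (J.toDualLE θ) hs' (hdm z.2.1)
      obtain ⟨r, hr, hr'⟩ := Z.add_mem hmZ hl
      -- Constant part plus a multiple of `t`, which vanishes at `c`; hence the value there is the
      -- prescribed one.
      refine ⟨fun j => (if hj : IsSmall (e j) then LaurentPolynomial.C (b z (τ ⟨j, hj⟩)) else 0) +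
        X.t * r j, fun j hj => by simp [hj, hr j hj], ?_, fun _ j hj => ?_⟩
      · have hsum : ∑ j, act (if hj : IsSmall (e j) then LaurentPolynomial.C (b z (τ ⟨j, hj⟩))
            else 0) (G j) = ∑ z', b z z' • G (τ.symm z').1 := by
          rw [← τ.sum_comp, sum_eq_sum_subtype (p := fun j => IsSmall (e j))
            (fun j hj => by simp [hj])]
          refine Finset.sum_congr rfl fun j _ => ?_
          rw [dif_pos j.2, τ.symm_apply_apply, hC]
        simp only [map_add, LinearMap.add_apply, Finset.sum_add_distrib, map_mul,
          Module.End.mul_apply, ← map_sum, ← hr', hsum]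
        rw [hm]
        simp only [b]
        rw [sum_slice_last_smul, hGi, h]
        simp only [hGτ, hz', map_sub, map_sum, map_smul,
          X.twist_tmul _ (J.toDualLE θ) s (S.grade s) hp' hq', g]
        abel
      · simp only [dif_pos hj]
        rw [laurentValue_eq_laurentEval _ hc] at ht ⊢
        rw [map_add, map_mul, ht, zero_mul, add_zero, ← laurentValue_eq_laurentEval,
          laurentValue_C]
  choose Λ hΛ1 hΛ2 hΛ3 using hδ
  refine ⟨Matrix.of Λ, hΛ1, ?_, hΛ2⟩
  rintro ⟨i₀, hi₀⟩ μ hμ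
  have hne : Nonempty κ := ⟨(e i₀).2.2.2.2⟩
  rw [hasEigenvalue_iff_of_columns (p := fun i => IsSmall (e i)) ?_ τ
    (sliceOp g dm + lastOp X.n) ?_ hμ, hasEigenvalue_add_iff_of_isNilpotent
    (commute_sliceOp_lastOp g dm X.n) (isNilpotent_lastOp X.rank_lt), hasEigenvalue_sliceOp_iff]
  · simp only [hdμ]
    constructor
    · rintro ⟨y, hy⟩
      exact ⟨_, hy, y.2.1, y.2.2, by simp [g]⟩
    · rintro ⟨ε, hε, s, hs, rfl⟩
      -- The existing small index supplies an element of `J_N`; without one there would be no slice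
      -- at all.
      exact ⟨((e i₀).1, ⟨s, hs⟩), by simpa [g] using hε⟩
  · intro i j hj
    rw [Matrix.map_apply, Matrix.of_apply, hΛ1 i j hj]
    simp [laurentValue]
  · intro f i
    have h1 : ∀ j : {i // IsSmall (e i)},
      ((Matrix.of Λ).map fun p => laurentValue p c) i j * f (τ j) =
        b (τ i) (τ j) • f (τ j) := fun j => by
      rw [Matrix.map_apply, Matrix.of_apply, hΛ3 i.1 i.2 j.1 j.2, smul_eq_mul]
    rw [Finset.sum_congr rfl fun j _ => h1 j, τ.sum_comp (fun z' => b (τ i) z' • f z')]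
    simp only [b]
    rw [sum_slice_last_smul]
    rfl

end WardSystem

/-! ## Two-variable series with finitely many total degrees -/

/-- Series `∑ H(a, b) p^a q^b` with finitely many values of `a + b`, the exponents `a` being bounded
below in every class modulo `ℤ`. -/
def seriesSpace : Submodule ℂ FormalSeries₂ where
  carrier := {H | (∃ E : Set ℂ, E.Finite ∧ ∀ a b, a + b ∉ E → H a b = 0) ∧
    ∀ a, ∃ n₀ : ℕ, ∀ n : ℕ, n₀ ≤ n → ∀ b, H (a - n) b = 0}
  add_mem' := by
    rintro H H' ⟨⟨E, hE, h⟩, ht⟩ ⟨⟨E', hE', h'⟩, ht'⟩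
    refine ⟨⟨E ∪ E', hE.union hE', fun a b hab => ?_⟩, fun a => ?_⟩
    · rw [Set.mem_union, not_or] at hab
      simp [h a b hab.1, h' a b hab.2]
    · obtain ⟨n, hn⟩ := ht a
      obtain ⟨n', hn'⟩ := ht' a
      exact ⟨max n n', fun m hm b => by
        simp [hn m (le_of_max_le_left hm), hn' m (le_of_max_le_right hm)]⟩
  zero_mem' := ⟨⟨∅, Set.finite_empty, fun _ _ _ => rfl⟩, fun _ => ⟨0, fun _ _ _ => rfl⟩⟩
  smul_mem' := by
    rintro c H ⟨⟨E, hE, h⟩, ht⟩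
    refine ⟨⟨E, hE, fun a b hab => by simp [h a b hab]⟩, fun a => ?_⟩
    obtain ⟨n, hn⟩ := ht a
    exact ⟨n, fun m hm b => by simp [hn m hm]⟩

namespace seriesSpace

theorem ext {H H' : seriesSpace} (h : ∀ a b, H.1 a b = H'.1 a b) : H = H' :=
  Subtype.ext (funext fun a => funext fun b => h a b)

theorem apply_congr (H : seriesSpace) {a a' b b' : ℂ} (ha : a = a') (hb : b = b') :
    H.1 a b = H.1 a' b' := by rw [ha, hb]

theorem finite_row (H : seriesSpace) (a : ℂ) : {b | H.1 a b ≠ 0}.Finite := by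
  obtain ⟨E, hE, h⟩ := H.2.1
  refine (hE.image fun e => e - a).subset fun b hb => ⟨a + b, ?_, by ring⟩
  by_contra h0
  exact hb (h a b h0)

theorem finite_column (H : seriesSpace) (b : ℂ) : {a | H.1 a b ≠ 0}.Finite := by
  obtain ⟨E, hE, h⟩ := H.2.1
  refine (hE.image fun e => e - b).subset fun a ha => ⟨a + b, ?_, by ring⟩
  by_contra h0
  exact ha (h a b h0)

/-- Multiplication with `p^m q^n`. -/
def shift (m n : ℤ) : Module.End ℂ seriesSpace where
  toFun H := ⟨fun a b => H.1 (a - m) (b - n), by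
    obtain ⟨⟨E, hE, h⟩, ht⟩ := H.2
    refine ⟨⟨(fun e => e + m + n) '' E, hE.image _, fun a b hab => h _ _ fun h0 =>
      hab ⟨_, h0, by ring⟩⟩, fun a => ?_⟩
    obtain ⟨n₀, hn⟩ := ht (a - m)
    exact ⟨n₀, fun k hk b => by
      beta_reduce; rw [sub_right_comm]; exact hn k hk _⟩⟩
  map_add' _ _ := rfl
  map_smul' _ _ := rfl

@[simp]
theorem shift_apply (m n : ℤ) (H : seriesSpace) (a b : ℂ) :
    (shift m n H).1 a b = H.1 (a - m) (b - n) := rfl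

@[simp]
theorem coe_add_apply (H H' : seriesSpace) (a b : ℂ) : (H + H').1 a b = H.1 a b + H'.1 a b := rfl

@[simp]
theorem coe_sub_apply (H H' : seriesSpace) (a b : ℂ) : (H - H').1 a b = H.1 a b - H'.1 a b := rfl

@[simp]
theorem coe_smul_apply (c : ℂ) (H : seriesSpace) (a b : ℂ) : (c • H).1 a b = c * H.1 a b := rfl

@[simp]
theorem coe_zero_apply (a b : ℂ) : (0 : seriesSpace).1 a b = 0 := rfl

theorem coe_sum_apply {ι : Type*} (s : Finset ι) (H : ι → seriesSpace) (a b : ℂ) :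
    (∑ i ∈ s, H i).1 a b = ∑ i ∈ s, (H i).1 a b := by
  rw [Submodule.coe_sum, Finset.sum_apply, Finset.sum_apply]

theorem shift_mul (m n m' n' : ℤ) : shift m n * shift m' n' = shift (m + m') (n + n') := by
  refine LinearMap.ext fun H => ext fun a b => ?_
  simp only [Module.End.mul_apply, shift_apply]
  exact apply_congr H (by push_cast; ring) (by push_cast; ring)

theorem shift_zero : shift 0 0 = 1 := by
  refine LinearMap.ext fun H => ext fun a b => ?_
  simp

theorem shift_pow (m n : ℤ) (i : ℕ) : shift m n ^ i = shift (i * m) (i * n) := by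
  induction i with
  | zero => simp [shift_zero]
  | succ i ih =>
    rw [pow_succ, ih, shift_mul]
    congr 1 <;> push_cast <;> ring

/-- `d/dp`. -/
def derivFst : Module.End ℂ seriesSpace where
  toFun H := ⟨fun a b => (a + 1) * H.1 (a + 1) b, by
    obtain ⟨⟨E, hE, h⟩, ht⟩ := H.2
    refine ⟨⟨(fun e => e - 1) '' E, hE.image _, fun a b hab => ?_⟩, fun a => ?_⟩
    · beta_reduce
      rw [h (a + 1) b fun h0 => hab ⟨_, h0, by ring⟩, mul_zero]
    · obtain ⟨n₀, hn⟩ := ht (a + 1)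
      exact ⟨n₀, fun k hk b => by beta_reduce; rw [sub_add_eq_add_sub, hn k hk, mul_zero]⟩⟩
  map_add' _ _ := ext fun a b => mul_add _ _ _
  map_smul' _ _ := ext fun a b => by simp; ring

@[simp]
theorem derivFst_apply (H : seriesSpace) (a b : ℂ) :
    (derivFst H).1 a b = (a + 1) * H.1 (a + 1) b := rfl

/-- `d/dq`. -/
def derivSnd : Module.End ℂ seriesSpace where
  toFun H := ⟨fun a b => (b + 1) * H.1 a (b + 1), by
    obtain ⟨⟨E, hE, h⟩, ht⟩ := H.2
    refine ⟨⟨(fun e => e - 1) '' E, hE.image _, fun a b hab => ?_⟩, fun a => ?_⟩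
    · beta_reduce
      rw [h a (b + 1) fun h0 => hab ⟨_, h0, by ring⟩, mul_zero]
    · obtain ⟨n₀, hn⟩ := ht a
      exact ⟨n₀, fun k hk b => by beta_reduce; rw [hn k hk, mul_zero]⟩⟩
  map_add' _ _ := ext fun a b => mul_add _ _ _
  map_smul' _ _ := ext fun a b => by simp; ring

@[simp]
theorem derivSnd_apply (H : seriesSpace) (a b : ℂ) :
    (derivSnd H).1 a b = (b + 1) * H.1 a (b + 1) := rfl

/-- Multiplication with `q^(-i-1) (1 - c p / q)^(-i-1)`, expanded in powers of `p / q`. -/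
def divPow (c : ℂ) (i : ℕ) (H : seriesSpace) : seriesSpace :=
  ⟨fun a b => ∑ᶠ j : ℕ, (((i + j).choose i : ℂ) * c ^ j) * H.1 (a - j) (b + 1 + i + j), by
    obtain ⟨⟨E, hE, h⟩, ht⟩ := H.2
    refine ⟨⟨(fun e => e - 1 - i) '' E, hE.image _, fun a b hab => ?_⟩, fun a => ?_⟩
    · refine finsum_eq_zero_of_forall_eq_zero fun j => ?_
      rw [h _ _ fun h0 => hab ⟨_, h0, by ring⟩, mul_zero]
    · obtain ⟨n₀, hn⟩ := ht a
      refine ⟨n₀, fun k hk b => finsum_eq_zero_of_forall_eq_zero fun j => ?_⟩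
      have := hn (k + j) (by omega) (b + 1 + i + j)
      rw [Nat.cast_add, ← sub_sub] at this
      rw [this, mul_zero]⟩

theorem divPow_apply (c : ℂ) (i : ℕ) (H : seriesSpace) {a : ℂ} {J : ℕ}
    (hJ : ∀ j : ℕ, J ≤ j → ∀ b, H.1 (a - j) b = 0) (b : ℂ) :
    (divPow c i H).1 a b = ∑ j ∈ Finset.range J,
      (((i + j).choose i : ℂ) * c ^ j) * H.1 (a - j) (b + 1 + i + j) :=
  finsum_eq_sum_range fun j hj => by rw [hJ j hj, mul_zero]

/-- Telescoping of the geometric series `∑ c^j p^j q^(-1-j)` multiplied by `q - c p`. -/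
theorem sub_divPow_zero (c : ℂ) (H : seriesSpace) :
    (shift 0 1 - c • shift 1 0) (divPow c 0 H) = H := by
  refine ext fun a b => ?_
  obtain ⟨J, hJ⟩ := H.2.2 a
  have hJ' : ∀ j : ℕ, J ≤ j → ∀ b, H.1 (a - (1 : ℤ) - j) b = 0 := fun j hj b => by
    have := hJ (j + 1) (by omega) b
    rw [← this]
    exact apply_congr H (by push_cast; ring) rfl
  simp only [LinearMap.sub_apply, LinearMap.smul_apply, coe_sub_apply, coe_smul_apply, shift_apply]
  rw [divPow_apply c 0 H (J := J + 1) (fun j hj b => by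
    simpa using hJ j (by omega) b), divPow_apply c 0 H hJ', Finset.sum_range_succ', Finset.mul_sum,
    add_sub_right_comm, ← Finset.sum_sub_distrib, Finset.sum_eq_zero]
  · simp
  · intro j _
    have e : H.1 (a - (0 : ℤ) - ((j + 1 : ℕ) : ℂ)) (b - (1 : ℤ) + 1 + (0 : ℕ) + ((j + 1 : ℕ) : ℂ)) =
        H.1 (a - (1 : ℤ) - j) (b - (0 : ℤ) + 1 + (0 : ℕ) + j) := by
      exact apply_congr H (by push_cast; ring) (by push_cast; ring)
    rw [e]
    simp only [Nat.choose_zero_right]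
    ring

/-- Pascal's rule for `choose (i + 1 + j) (i + 1)`, which is the recursion between the expansions of
consecutive negative powers of `q - c p`. -/
theorem sub_divPow_succ (c : ℂ) (i : ℕ) (H : seriesSpace) :
    (shift 0 1 - c • shift 1 0) (divPow c (i + 1) H) = divPow c i H := by
  refine ext fun a b => ?_
  obtain ⟨J, hJ⟩ := H.2.2 a
  have hJ' : ∀ j : ℕ, J ≤ j → ∀ b, H.1 (a - (1 : ℤ) - j) b = 0 := fun j hj b => by
    have := hJ (j + 1) (by omega) b
    rw [← this]
    exact apply_congr H (by push_cast; ring) rfl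
  simp only [LinearMap.sub_apply, LinearMap.smul_apply, coe_sub_apply, coe_smul_apply, shift_apply]
  rw [divPow_apply c (i + 1) H (J := J + 1) (fun j hj b => by
    simpa using hJ j (by omega) b), divPow_apply c (i + 1) H hJ',
    divPow_apply c i H (J := J + 1) (fun j hj b => hJ j (by omega) b), Finset.sum_range_succ',
    Finset.sum_range_succ' _ J, Finset.mul_sum, add_sub_right_comm, ← Finset.sum_sub_distrib]
  congr 1
  · refine Finset.sum_congr rfl fun j _ => ?_
    have e : H.1 (a - (0 : ℤ) - ((j + 1 : ℕ) : ℂ))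
        (b - (1 : ℤ) + 1 + ((i + 1 : ℕ) : ℂ) + ((j + 1 : ℕ) : ℂ)) =
        H.1 (a - (1 : ℤ) - j) (b - (0 : ℤ) + 1 + ((i + 1 : ℕ) : ℂ) + j) := by
      exact apply_congr H (by push_cast; ring) (by push_cast; ring)
    have e' : H.1 (a - ((j + 1 : ℕ) : ℂ)) (b + 1 + i + ((j + 1 : ℕ) : ℂ)) =
        H.1 (a - (1 : ℤ) - j) (b - (0 : ℤ) + 1 + ((i + 1 : ℕ) : ℂ) + j) := by
      exact apply_congr H (by push_cast; ring) (by push_cast; ring)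
    rw [e, e', show i + 1 + (j + 1) = (i + 1 + j) + 1 by ring, Nat.choose_succ_succ,
      show i + (j + 1) = i + 1 + j by ring]
    push_cast
    ring
  · simp only [Nat.add_zero, Nat.choose_self]
    congr 1
    exact apply_congr H (by push_cast; ring) (by push_cast; ring)

theorem sub_pow_divPow (c : ℂ) (i : ℕ) (H : seriesSpace) :
    ((shift 0 1 - c • shift 1 0) ^ (i + 1)) (divPow c i H) = H := by
  induction i with
  | zero => rw [pow_one, sub_divPow_zero]
  | succ i ih => rw [pow_succ, Module.End.mul_apply, sub_divPow_succ, ih]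

/-! ### Evaluation -/

section Evaluation

variable (ℓ : ℂ)

theorem hasFiniteSupport_row (H : seriesSpace) (a : ℂ) (f : ℂ → ℂ) :
    Function.HasFiniteSupport fun b => H.1 a b * f b :=
  (finite_row H a).subset fun _ hb => left_ne_zero_of_mul hb

theorem hasFiniteSupport_column (H : seriesSpace) (b : ℂ) (f : ℂ → ℂ) :
    Function.HasFiniteSupport fun a => H.1 a b * f a :=
  (finite_column H b).subset fun _ ha => left_ne_zero_of_mul ha

/-- Put `p = exp ℓ`. -/
def evalFst : seriesSpace →ₗ[ℂ] FormalSeries where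
  toFun H := H.1.evalFst ℓ
  map_add' H H' := by
    ext b
    simp only [FormalSeries₂.evalFst, coe_add_apply, add_mul, Pi.add_apply]
    exact finsum_add_distrib (hasFiniteSupport_column H b _) (hasFiniteSupport_column H' b _)
  map_smul' c H := by
    ext b
    simp only [FormalSeries₂.evalFst, coe_smul_apply, mul_assoc, Pi.smul_apply, smul_eq_mul,
      RingHom.id_apply, mul_finsum]

theorem evalFst_apply (H : seriesSpace) (b : ℂ) :
    evalFst ℓ H b = ∑ᶠ a : ℂ, H.1 a b * Complex.exp (a * ℓ) := rfl

theorem evalFst_shift_fst (H : seriesSpace) :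
    evalFst ℓ (shift 1 0 H) = Complex.exp ℓ • evalFst ℓ H := by
  ext b
  rw [Pi.smul_apply, evalFst_apply, evalFst_apply, smul_eq_mul, mul_finsum,
    ← finsum_comp_equiv (Equiv.addRight (1 : ℂ))]
  refine finsum_congr fun a => ?_
  simp only [shift_apply, Equiv.coe_addRight, Int.cast_one, Int.cast_zero, sub_zero,
    add_sub_cancel_right, add_mul, one_mul, Complex.exp_add]
  ring

theorem evalFst_shift_snd (H : seriesSpace) (b : ℂ) :
    evalFst ℓ (shift 0 1 H) b = evalFst ℓ H (b - 1) := by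
  rw [evalFst_apply, evalFst_apply]
  simp

theorem evalFst_derivSnd (H : seriesSpace) : evalFst ℓ (derivSnd H) = (evalFst ℓ H).deriv := by
  ext b
  rw [FormalSeries.deriv, evalFst_apply, evalFst_apply, mul_finsum]
  simp [mul_assoc]

/-- Put `q = exp ℓ`. -/
def evalSnd : seriesSpace →ₗ[ℂ] FormalSeries where
  toFun H := H.1.evalSnd ℓ
  map_add' H H' := by
    ext a
    simp only [FormalSeries₂.evalSnd, coe_add_apply, add_mul, Pi.add_apply]
    exact finsum_add_distrib (hasFiniteSupport_row H a _) (hasFiniteSupport_row H' a _)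
  map_smul' c H := by
    ext a
    simp only [FormalSeries₂.evalSnd, coe_smul_apply, mul_assoc, Pi.smul_apply, smul_eq_mul,
      RingHom.id_apply, mul_finsum]

theorem evalSnd_apply (H : seriesSpace) (a : ℂ) :
    evalSnd ℓ H a = ∑ᶠ b : ℂ, H.1 a b * Complex.exp (b * ℓ) := rfl

theorem evalSnd_shift_snd (H : seriesSpace) :
    evalSnd ℓ (shift 0 1 H) = Complex.exp ℓ • evalSnd ℓ H := by
  ext a
  rw [Pi.smul_apply, evalSnd_apply, evalSnd_apply, smul_eq_mul, mul_finsum,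
    ← finsum_comp_equiv (Equiv.addRight (1 : ℂ))]
  refine finsum_congr fun b => ?_
  simp only [shift_apply, Equiv.coe_addRight, Int.cast_one, Int.cast_zero, sub_zero,
    add_sub_cancel_right, add_mul, one_mul, Complex.exp_add]
  ring

theorem evalSnd_shift_fst (H : seriesSpace) (a : ℂ) :
    evalSnd ℓ (shift 1 0 H) a = evalSnd ℓ H (a - 1) := by
  rw [evalSnd_apply, evalSnd_apply]
  simp

theorem evalSnd_derivFst (H : seriesSpace) : evalSnd ℓ (derivFst H) = (evalSnd ℓ H).deriv := by
  ext a
  rw [FormalSeries.deriv, evalSnd_apply, evalSnd_apply, mul_finsum]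
  simp [mul_assoc]

/-- The coefficient of `p^j` in `(exp ℓ - p)^b`. -/
def sumWeight (j : ℕ) (b : ℂ) : ℂ := Ring.choose b j * Complex.exp ((b - j) * ℓ) * (-1) ^ j

theorem sumWeight_zero_add_one (b : ℂ) :
    sumWeight ℓ 0 (b + 1) = Complex.exp ℓ * sumWeight ℓ 0 b := by
  simp only [sumWeight, Ring.choose_zero_right, Nat.cast_zero, sub_zero, add_mul, Complex.exp_add]
  ring_nf

/-- The coefficients of `(x₀ - p)^(b+1) = (x₀ - p) (x₀ - p)^b` with `x₀ = exp ℓ`. -/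
theorem sumWeight_succ_add_one (j : ℕ) (b : ℂ) :
    sumWeight ℓ (j + 1) (b + 1) = Complex.exp ℓ * sumWeight ℓ (j + 1) b - sumWeight ℓ j b := by
  simp only [sumWeight, Ring.choose_succ_succ, Nat.cast_add, Nat.cast_one]
  rw [show (b - (j + 1)) * ℓ = (b - j) * ℓ - ℓ by ring,
    show (b + 1 - (j + 1)) * ℓ = (b - j) * ℓ by ring, Complex.exp_sub]
  field_simp
  ring

/-- The coefficients of `b (x₀ - p)^(b-1) = -d/dp (x₀ - p)^b`. -/
theorem mul_sumWeight_sub_one (j : ℕ) (b : ℂ) :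
    b * sumWeight ℓ j (b - 1) = -((j + 1) * sumWeight ℓ (j + 1) b) := by
  have h : b * Ring.choose (b - 1) j = (j + 1) * Ring.choose b (j + 1) := by
    have := Ring.choose_smul_choose b (n := j + 1) (k := 1) (by omega)
    simp only [Nat.choose_one_right, Ring.choose_one_right, Nat.cast_one, Nat.add_sub_cancel,
      nsmul_eq_mul] at this
    rw [← this]
    push_cast
    ring
  simp only [sumWeight, Nat.cast_add, Nat.cast_one, pow_succ]
  rw [show (b - 1 - j) * ℓ = (b - (j + 1)) * ℓ by ring]
  linear_combination Complex.exp ((b - (j + 1)) * ℓ) * (-1) ^ j * h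

/-- The coefficient of `p^j` in the series in `q = exp ℓ - p` with coefficients `H(a, ·)`. -/
def rowCoeff (H : seriesSpace) (j : ℕ) (a : ℂ) : ℂ := ∑ᶠ b : ℂ, H.1 a b * sumWeight ℓ j b

theorem rowCoeff_eq_zero {H : seriesSpace} {a : ℂ} (h : ∀ b, H.1 a b = 0) (j : ℕ) :
    rowCoeff ℓ H j a = 0 :=
  finsum_eq_zero_of_forall_eq_zero fun b => by rw [h, zero_mul]

theorem rowCoeff_add (H H' : seriesSpace) (j : ℕ) (a : ℂ) :
    rowCoeff ℓ (H + H') j a = rowCoeff ℓ H j a + rowCoeff ℓ H' j a := by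
  simp only [rowCoeff, coe_add_apply, add_mul]
  exact finsum_add_distrib (hasFiniteSupport_row H a _) (hasFiniteSupport_row H' a _)

theorem rowCoeff_smul (c : ℂ) (H : seriesSpace) (j : ℕ) (a : ℂ) :
    rowCoeff ℓ (c • H) j a = c * rowCoeff ℓ H j a := by
  simp only [rowCoeff, coe_smul_apply, mul_assoc, mul_finsum]

theorem evalSum_eq_sum (H : seriesSpace) {a : ℂ} {J : ℕ}
    (hJ : ∀ j : ℕ, J ≤ j → ∀ b, H.1 (a - j) b = 0) :
    H.1.evalSum ℓ a = ∑ j ∈ Finset.range J, rowCoeff ℓ H j (a - j) :=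
  finsum_eq_sum_range fun j hj => rowCoeff_eq_zero ℓ (hJ j hj) j

/-- Put `p + q = exp ℓ`. -/
def evalSum : seriesSpace →ₗ[ℂ] FormalSeries where
  toFun H := H.1.evalSum ℓ
  map_add' H H' := by
    ext a
    obtain ⟨n, hn⟩ := H.2.2 a
    obtain ⟨n', hn'⟩ := H'.2.2 a
    rw [Pi.add_apply, evalSum_eq_sum ℓ H (J := max n n') fun j hj => hn j (le_of_max_le_left hj),
      evalSum_eq_sum ℓ H' (J := max n n') fun j hj => hn' j (le_of_max_le_right hj),
      evalSum_eq_sum ℓ (H + H') (J := max n n') fun j hj b => by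
        rw [coe_add_apply, hn j (le_of_max_le_left hj), hn' j (le_of_max_le_right hj), add_zero],
      ← Finset.sum_add_distrib]
    exact Finset.sum_congr rfl fun j _ => rowCoeff_add ℓ H H' j _
  map_smul' c H := by
    ext a
    obtain ⟨n, hn⟩ := H.2.2 a
    rw [Pi.smul_apply, evalSum_eq_sum ℓ H hn, evalSum_eq_sum ℓ (c • H) (J := n) fun j hj b => by
      rw [coe_smul_apply, hn j hj, mul_zero], RingHom.id_apply, smul_eq_mul, Finset.mul_sum]
    exact Finset.sum_congr rfl fun j _ => rowCoeff_smul ℓ c H j _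

theorem evalSum_apply (H : seriesSpace) {a : ℂ} {J : ℕ}
    (hJ : ∀ j : ℕ, J ≤ j → ∀ b, H.1 (a - j) b = 0) :
    evalSum ℓ H a = ∑ j ∈ Finset.range J, rowCoeff ℓ H j (a - j) := evalSum_eq_sum ℓ H hJ

theorem rowCoeff_shift_snd_zero (H : seriesSpace) (a : ℂ) :
    rowCoeff ℓ (shift 0 1 H) 0 a = Complex.exp ℓ * rowCoeff ℓ H 0 a := by
  rw [rowCoeff, rowCoeff, mul_finsum, ← finsum_comp_equiv (Equiv.addRight (1 : ℂ))]
  refine finsum_congr fun b => ?_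
  rw [Equiv.coe_addRight, sumWeight_zero_add_one]
  simp
  ring

theorem rowCoeff_shift_snd_succ (H : seriesSpace) (j : ℕ) (a : ℂ) :
    rowCoeff ℓ (shift 0 1 H) (j + 1) a =
      Complex.exp ℓ * rowCoeff ℓ H (j + 1) a - rowCoeff ℓ H j a := by
  rw [rowCoeff, rowCoeff, rowCoeff, mul_finsum, ← finsum_comp_equiv (Equiv.addRight (1 : ℂ)),
    ← finsum_sub_distrib]
  · refine finsum_congr fun b => ?_
    rw [Equiv.coe_addRight, sumWeight_succ_add_one]
    simp
    ring
  · exact (finite_row H a).subset fun b hb => left_ne_zero_of_mul (right_ne_zero_of_mul hb)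
  · exact hasFiniteSupport_row H a _

theorem rowCoeff_derivSnd (H : seriesSpace) (j : ℕ) (a : ℂ) :
    rowCoeff ℓ (derivSnd H) j a = -((j + 1) * rowCoeff ℓ H (j + 1) a) := by
  rw [rowCoeff, rowCoeff, mul_finsum, ← finsum_neg_distrib,
    ← finsum_comp_equiv (Equiv.subRight (1 : ℂ))]
  refine finsum_congr fun b => ?_
  simp only [derivSnd_apply, Equiv.subRight_apply, sub_add_cancel]
  linear_combination H.1 a b * mul_sumWeight_sub_one ℓ j b

theorem rowCoeff_derivFst (H : seriesSpace) (j : ℕ) (a : ℂ) :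
    rowCoeff ℓ (derivFst H) j a = (a + 1) * rowCoeff ℓ H j (a + 1) := by
  rw [rowCoeff, rowCoeff, mul_finsum]
  exact finsum_congr fun b => by rw [derivFst_apply, mul_assoc]

theorem evalSum_shift_fst (H : seriesSpace) (a : ℂ) :
    evalSum ℓ (shift 1 0 H) a = evalSum ℓ H (a - 1) := by
  obtain ⟨n, hn⟩ := H.2.2 (a - 1)
  rw [evalSum_apply ℓ H hn, evalSum_apply ℓ (shift 1 0 H) (J := n) fun j hj b => by
    rw [shift_apply, sub_right_comm, Int.cast_one, hn j hj]]
  refine Finset.sum_congr rfl fun j _ => ?_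
  rw [rowCoeff, rowCoeff, sub_right_comm]
  simp

theorem evalSum_shift_snd (H : seriesSpace) (a : ℂ) :
    evalSum ℓ (shift 0 1 H) a = Complex.exp ℓ * evalSum ℓ H a - evalSum ℓ H (a - 1) := by
  obtain ⟨n, hn⟩ := H.2.2 a
  have hn' : ∀ j : ℕ, n ≤ j → ∀ b, H.1 (a - 1 - j) b = 0 := fun j hj b => by
    have := hn (j + 1) (by omega) b
    rw [← this]
    exact apply_congr H (by push_cast; ring) rfl
  rw [evalSum_apply ℓ H (J := n + 1) fun j hj => hn j (by omega), evalSum_apply ℓ H hn',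
    evalSum_apply ℓ (shift 0 1 H) (J := n + 1) fun j hj b => by
      rw [shift_apply, Int.cast_zero, sub_zero, hn j (by omega)],
    Finset.sum_range_succ', Finset.sum_range_succ' _ n, mul_add, Finset.mul_sum,
    add_sub_right_comm, ← Finset.sum_sub_distrib, rowCoeff_shift_snd_zero]
  congr 1
  refine Finset.sum_congr rfl fun j _ => ?_
  rw [rowCoeff_shift_snd_succ]
  congr 2
  push_cast
  ring

/-- The chain rule along `q = exp ℓ - p`, where `dq/dp = -1`. -/
theorem evalSum_deriv (H : seriesSpace) :
    evalSum ℓ (derivFst H - derivSnd H) = (evalSum ℓ H).deriv := by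
  ext a
  obtain ⟨n, hn⟩ := H.2.2 (a + 1)
  have hn' : ∀ j : ℕ, n ≤ j → ∀ b, H.1 (a - j) b = 0 := fun j hj b => by
    have := hn (j + 1) (by omega) b
    rw [← this]
    exact apply_congr H (by push_cast; ring) rfl
  rw [FormalSeries.deriv, evalSum_apply ℓ H (J := n + 1) fun j hj => hn j (by omega), map_sub,
    Pi.sub_apply, evalSum_apply ℓ (derivSnd H) (J := n) fun j hj b => by
      rw [derivSnd_apply, hn' j hj, mul_zero],
    evalSum_apply ℓ (derivFst H) (J := n + 1) fun j hj b => by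
      rw [derivFst_apply, sub_add_eq_add_sub, hn j (by omega), mul_zero],
    Finset.sum_range_succ', Finset.sum_range_succ' _ n, mul_add, Finset.mul_sum,
    add_sub_right_comm, ← Finset.sum_sub_distrib]
  congr 1
  · refine Finset.sum_congr rfl fun j _ => ?_
    rw [rowCoeff_derivSnd, rowCoeff_derivFst]
    have e1 : a - ((j + 1 : ℕ) : ℂ) + 1 = a - j := by push_cast; ring
    have e2 : a + 1 - ((j + 1 : ℕ) : ℂ) = a - j := by push_cast; ring
    rw [e1, e2]
    ring
  · rw [rowCoeff_derivFst]
    simp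

end Evaluation

end seriesSpace

/-! ## Actions of the Laurent polynomials on formal series -/

namespace FormalSeries

/-- The action of the powers of the variable by shifts. -/
def shiftHom : Multiplicative ℤ →* Module.End ℂ FormalSeries where
  toFun n :=
    { toFun := fun f e => f (e - (n.toAdd : ℤ))
      map_add' := fun _ _ => rfl
      map_smul' := fun _ _ => rfl }
  map_one' := by
    refine LinearMap.ext fun f => funext fun e => ?_
    simp
  map_mul' m n := by
    refine LinearMap.ext fun f => funext fun e => ?_
    simp only [LinearMap.coe_mk, AddHom.coe_mk, Module.End.mul_apply, toAdd_mul]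
    congr 1
    push_cast
    ring

/-- Multiplication with Laurent polynomials. -/
def laurentAct : ℂ[T;T⁻¹] →ₐ[ℂ] Module.End ℂ FormalSeries :=
  AddMonoidAlgebra.lift ℂ _ ℤ shiftHom

theorem laurentAct_apply (p : ℂ[T;T⁻¹]) (f : FormalSeries) : laurentAct p f = laurentMul p f := by
  rw [laurentAct, AddMonoidAlgebra.lift_apply, Finsupp.sum, LinearMap.sum_apply]
  ext e
  rw [Finset.sum_apply]
  rfl

theorem laurentAct_T (n : ℤ) (f : FormalSeries) (e : ℂ) :
    laurentAct (LaurentPolynomial.T n) f e = f (e - n) := by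
  rw [laurentAct, LaurentPolynomial.T, AddMonoidAlgebra.lift_single, one_smul]
  rfl

theorem laurentAct_C (a : ℂ) (f : FormalSeries) : laurentAct (LaurentPolynomial.C a) f = a • f := by
  rw [show LaurentPolynomial.C a = algebraMap ℂ ℂ[T;T⁻¹] a from rfl, laurentAct.commutes]
  rfl

/-- `d/dz` as a linear map. -/
def derivOp : Module.End ℂ FormalSeries where
  toFun := deriv
  map_add' f g := by ext e; simp [deriv]; ring
  map_smul' c f := by ext e; simp [deriv]; ring

theorem derivOp_T (f : FormalSeries) : derivOp (laurentAct (LaurentPolynomial.T 1) f) =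
    f + laurentAct (LaurentPolynomial.T 1) (derivOp f) := by
  ext e
  simp only [derivOp, deriv, LinearMap.coe_mk, AddHom.coe_mk, laurentAct_T, Pi.add_apply,
    Int.cast_one, add_sub_cancel_right, sub_add_cancel]
  ring

end FormalSeries

/-- Series whose exponents are bounded below in every class modulo `ℤ`. -/
def truncatedSeries : Submodule ℂ FormalSeries where
  carrier := {f | ∀ e, ∃ n₀ : ℕ, ∀ n : ℕ, n₀ ≤ n → f (e - n) = 0}
  add_mem' := by
    intro f g hf hg e
    obtain ⟨n, hn⟩ := hf e
    obtain ⟨n', hn'⟩ := hg e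
    exact ⟨max n n', fun m hm => by
      simp [hn m (le_of_max_le_left hm), hn' m (le_of_max_le_right hm)]⟩
  zero_mem' := fun _ => ⟨0, fun _ _ => rfl⟩
  smul_mem' := by
    intro c f hf e
    obtain ⟨n, hn⟩ := hf e
    exact ⟨n, fun m hm => by simp [hn m hm]⟩

namespace truncatedSeries

theorem ext {f g : truncatedSeries} (h : ∀ e, f.1 e = g.1 e) : f = g :=
  Subtype.ext (funext h)

theorem powerMul_apply (k : ℕ → ℂ) (f : truncatedSeries) {e : ℂ} {J : ℕ}
    (hJ : ∀ j : ℕ, J ≤ j → f.1 (e - j) = 0) :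
    FormalSeries.powerMul k f.1 e = ∑ j ∈ Finset.range J, k j * f.1 (e - j) :=
  finsum_eq_sum_range fun j hj => by rw [hJ j hj, mul_zero]

/-- Multiplication with a power series. -/
def powerOp (k : ℕ → ℂ) : Module.End ℂ truncatedSeries where
  toFun f := ⟨FormalSeries.powerMul k f.1, fun e => by
    obtain ⟨n₀, hn⟩ := f.2 e
    refine ⟨n₀, fun n hn' => finsum_eq_zero_of_forall_eq_zero fun j => ?_⟩
    rw [sub_sub, ← Nat.cast_add, hn _ (by omega), mul_zero]⟩
  map_add' f g := ext fun e => by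
    obtain ⟨n, hn⟩ := f.2 e
    obtain ⟨n', hn'⟩ := g.2 e
    have h : ∀ j : ℕ, max n n' ≤ j → (f + g).1 (e - j) = 0 := fun j hj => by
      simp [hn j (le_of_max_le_left hj), hn' j (le_of_max_le_right hj)]
    change FormalSeries.powerMul k (f + g).1 e =
      FormalSeries.powerMul k f.1 e + FormalSeries.powerMul k g.1 e
    rw [powerMul_apply k f fun j hj => hn j (le_of_max_le_left hj),
      powerMul_apply k g fun j hj => hn' j (le_of_max_le_right hj), powerMul_apply k (f + g) h,
      ← Finset.sum_add_distrib]
    exact Finset.sum_congr rfl fun j _ => mul_add _ _ _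
  map_smul' c f := ext fun e => by
    change FormalSeries.powerMul k (c • f.1) e = c * FormalSeries.powerMul k f.1 e
    simp only [FormalSeries.powerMul, mul_finsum]
    exact finsum_congr fun j => by simp; ring

theorem powerOp_coe (k : ℕ → ℂ) (f : truncatedSeries) :
    (powerOp k f).1 = FormalSeries.powerMul k f.1 := rfl

theorem powerOp_apply (k : ℕ → ℂ) (f : truncatedSeries) {e : ℂ} {J : ℕ}
    (hJ : ∀ j : ℕ, J ≤ j → f.1 (e - j) = 0) :
    (powerOp k f).1 e = ∑ j ∈ Finset.range J, k j * f.1 (e - j) := powerMul_apply k f hJ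

theorem powerOp_add (k k' : ℕ → ℂ) : powerOp (k + k') = powerOp k + powerOp k' := by
  refine LinearMap.ext fun f => ext fun e => ?_
  obtain ⟨J, hJ⟩ := f.2 e
  change _ = (powerOp k f).1 e + (powerOp k' f).1 e
  rw [powerOp_apply _ f hJ, powerOp_apply _ f hJ, powerOp_apply _ f hJ, ← Finset.sum_add_distrib]
  exact Finset.sum_congr rfl fun j _ => add_mul _ _ _

theorem powerOp_smul (c : ℂ) (k : ℕ → ℂ) : powerOp (c • k) = c • powerOp k := by
  refine LinearMap.ext fun f => ext fun e => ?_
  obtain ⟨J, hJ⟩ := f.2 e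
  change _ = c * (powerOp k f).1 e
  rw [powerOp_apply _ f hJ, powerOp_apply _ f hJ, Finset.mul_sum]
  exact Finset.sum_congr rfl fun j _ => mul_assoc _ _ _

theorem powerOp_one : powerOp (Pi.single 0 1) = 1 := by
  refine LinearMap.ext fun f => ext fun e => ?_
  obtain ⟨J, hJ⟩ := f.2 e
  rw [powerOp_apply _ f (J := J + 1) fun j hj => hJ j (by omega), Finset.sum_eq_single 0]
  · simp
  · intro j _ hj
    rw [Pi.single_eq_of_ne hj, zero_mul]
  · simp

/-- Multiplication with the variable. -/
def shift : Module.End ℂ truncatedSeries where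
  toFun f := ⟨fun e => f.1 (e - 1), fun e => by
    obtain ⟨n₀, hn⟩ := f.2 (e - 1)
    exact ⟨n₀, fun n hn' => by beta_reduce; rw [sub_right_comm, hn n hn']⟩⟩
  map_add' _ _ := rfl
  map_smul' _ _ := rfl

theorem shift_apply (f : truncatedSeries) (e : ℂ) : (shift f).1 e = f.1 (e - 1) := rfl

theorem commute_powerOp_shift (k : ℕ → ℂ) : Commute (powerOp k) shift := by
  refine LinearMap.ext fun f => ext fun e => ?_
  rw [Module.End.mul_apply, Module.End.mul_apply, shift_apply, powerOp_coe, powerOp_coe]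
  exact finsum_congr fun j => by rw [shift_apply, sub_right_comm]

theorem add_shift_mul_powerOp (c ε : ℂ) {k k' : ℕ → ℂ} (h0 : k' 0 = c * k 0)
    (hs : ∀ j, k' (j + 1) = c * k (j + 1) + ε * k j) :
    (c • 1 + ε • shift) * powerOp k = powerOp k' := by
  refine LinearMap.ext fun f => ext fun e => ?_
  obtain ⟨J, hJ⟩ := f.2 e
  have hJ' : ∀ j : ℕ, J ≤ j → f.1 (e - 1 - j) = 0 := fun j hj => by
    rw [show e - 1 - (j : ℂ) = e - ((j + 1 : ℕ) : ℂ) by push_cast; ring, hJ (j + 1) (by omega)]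
  change c * (powerOp k f).1 e + ε * (powerOp k f).1 (e - 1) = _
  rw [powerOp_apply _ f (J := J + 1) fun j hj => hJ j (by omega), powerOp_apply _ f hJ',
    powerOp_apply _ f (J := J + 1) fun j hj => hJ j (by omega), Finset.sum_range_succ',
    Finset.sum_range_succ' _ J, mul_add, Finset.mul_sum, Finset.mul_sum, add_right_comm,
    ← Finset.sum_add_distrib, h0, mul_assoc]
  congr 1
  refine Finset.sum_congr rfl fun j _ => ?_
  rw [hs, sub_sub, add_comm (1 : ℂ), Nat.cast_add, Nat.cast_one]
  ring

/-- The coefficients of the expansion of `(c + ε t)^n`. -/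
def binomialCoeff (c ε : ℂ) (n : ℤ) (j : ℕ) : ℂ :=
  ((Ring.choose n j : ℤ) : ℂ) * c ^ (n - (j : ℤ)) * ε ^ j

theorem binomialCoeff_zero (c ε : ℂ) : binomialCoeff c ε 0 = Pi.single 0 1 := by
  ext j
  rcases j with _ | j
  · simp [binomialCoeff]
  · simp [binomialCoeff, Ring.choose_zero_succ]

theorem add_shift_mul_binomial {c : ℂ} (hc : c ≠ 0) (ε : ℂ) (n : ℤ) :
    (c • 1 + ε • shift) * powerOp (binomialCoeff c ε n) = powerOp (binomialCoeff c ε (n + 1)) := by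
  refine add_shift_mul_powerOp c ε ?_ fun j => ?_
  · simp [binomialCoeff, zpow_add₀ hc]
    ring
  · simp only [binomialCoeff, Ring.choose_succ_succ, Nat.cast_add, Nat.cast_one, Int.cast_add]
    rw [show n + 1 - ((j : ℤ) + 1) = n - j by ring, show n - ((j : ℤ) + 1) = n - j - 1 by ring,
      zpow_sub_one₀ hc]
    field_simp
    ring

/-- Multiplication with `c + ε t`, as a unit. -/
def addShift (c ε : ℂ) (hc : c ≠ 0) : (Module.End ℂ truncatedSeries)ˣ where
  val := c • 1 + ε • shift
  inv := powerOp (binomialCoeff c ε (-1))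
  val_inv := by
    rw [add_shift_mul_binomial hc, neg_add_cancel, binomialCoeff_zero, powerOp_one]
  inv_val := by
    rw [(((Commute.one_right _).smul_right c).add_right
      ((commute_powerOp_shift _).smul_right ε)).eq, add_shift_mul_binomial hc, neg_add_cancel,
      binomialCoeff_zero, powerOp_one]

theorem addShift_zpow (c ε : ℂ) (hc : c ≠ 0) (n : ℤ) :
    ((addShift c ε hc ^ n : (Module.End ℂ truncatedSeries)ˣ) : Module.End ℂ truncatedSeries) =
      powerOp (binomialCoeff c ε n) := by
  induction n using Int.induction_on with
  | zero => rw [zpow_zero, Units.val_one, binomialCoeff_zero, powerOp_one]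
  | succ n ih =>
    rw [add_comm, zpow_one_add, Units.val_mul, ih, add_comm (1 : ℤ)]
    exact add_shift_mul_binomial hc ε n
  | pred n ih =>
    have h : (addShift c ε hc : Module.End ℂ truncatedSeries) *
        powerOp (binomialCoeff c ε (-(n : ℤ) - 1)) = powerOp (binomialCoeff c ε (-(n : ℤ))) := by
      have := add_shift_mul_binomial hc ε (-(n : ℤ) - 1)
      rwa [sub_add_cancel] at this
    rw [sub_eq_neg_add, zpow_add, Units.val_mul, ih, ← h, ← mul_assoc, zpow_neg_one,
      Units.inv_mul, one_mul, sub_eq_neg_add]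

/-- Multiplication with a Laurent polynomial in `c + ε t`, expanded in powers of `t`. -/
def expansionAct (c ε : ℂ) (hc : c ≠ 0) : ℂ[T;T⁻¹] →ₐ[ℂ] Module.End ℂ truncatedSeries :=
  AddMonoidAlgebra.lift ℂ _ ℤ ((Units.coeHom _).comp (zpowersHom _ (addShift c ε hc)))

/-- Connects the algebra homomorphism, convenient for the Ward system, with the explicit
coefficients that define a solution at the pole. -/
theorem expansionAct_eq (c ε : ℂ) (hc : c ≠ 0) (p : ℂ[T;T⁻¹]) :
    expansionAct c ε hc p = powerOp (expansionCoeff p c ε) := by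
  induction p using LaurentPolynomial.induction_on' with
  | add p q hp hq =>
    rw [map_add, hp, hq, ← powerOp_add]
    congr 1
    ext j
    exact (Finsupp.sum_add_index' (fun _ => by simp) (fun _ _ _ => by ring)).symm
  | C_mul_T n a =>
    rw [← LaurentPolynomial.single_eq_C_mul_T, expansionAct, AddMonoidAlgebra.lift_single]
    change a • ((addShift c ε hc ^ n : (Module.End ℂ truncatedSeries)ˣ) :
      Module.End ℂ truncatedSeries) = _
    rw [addShift_zpow, ← powerOp_smul]
    congr 1
    ext j
    exact (Finsupp.sum_single_index (h := fun (n : ℤ) a => a * binomialCoeff c ε n j)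
      (zero_mul _)).symm

theorem expansionAct_T_one (c ε : ℂ) (hc : c ≠ 0) :
    expansionAct c ε hc (LaurentPolynomial.T 1) = c • 1 + ε • shift := by
  rw [expansionAct, LaurentPolynomial.T, AddMonoidAlgebra.lift_single, one_smul]
  change ((addShift c ε hc ^ (1 : ℤ) : (Module.End ℂ truncatedSeries)ˣ) :
      Module.End ℂ truncatedSeries) = _
  rw [zpow_one]
  rfl

theorem expansionAct_C (c ε : ℂ) (hc : c ≠ 0) (a : ℂ) :
    expansionAct c ε hc (LaurentPolynomial.C a) = a • 1 := by
  rw [show LaurentPolynomial.C a = algebraMap ℂ ℂ[T;T⁻¹] a from rfl, AlgHom.commutes,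
    Algebra.algebraMap_eq_smul_one]

/-- `t d/dt`. -/
def euler : Module.End ℂ truncatedSeries where
  toFun f := ⟨fun e => e * f.1 e, fun e => by
    obtain ⟨n₀, hn⟩ := f.2 e
    exact ⟨n₀, fun n hn' => by beta_reduce; rw [hn n hn', mul_zero]⟩⟩
  map_add' _ _ := ext fun _ => mul_add _ _ _
  map_smul' _ _ := ext fun _ => mul_left_comm _ _ _

theorem euler_shift (f : truncatedSeries) : euler (shift f) = shift f + shift (euler f) := by
  refine ext fun e => ?_
  change e * f.1 (e - 1) = f.1 (e - 1) + (e - 1) * f.1 (e - 1)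
  ring

end truncatedSeries

namespace seriesSpace

/-- Put `q = exp ℓ`. -/
def evalSndTruncated (ℓ : ℂ) : seriesSpace →ₗ[ℂ] truncatedSeries :=
  LinearMap.codRestrict truncatedSeries (evalSnd ℓ) fun H a => by
    obtain ⟨n₀, hn⟩ := H.2.2 a
    exact ⟨n₀, fun n hn' => finsum_eq_zero_of_forall_eq_zero fun b => by rw [hn n hn', zero_mul]⟩

theorem evalSndTruncated_shift_fst (ℓ : ℂ) (H : seriesSpace) :
    evalSndTruncated ℓ (shift 1 0 H) = truncatedSeries.shift (evalSndTruncated ℓ H) :=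
  Subtype.ext (funext fun a => evalSnd_shift_fst ℓ H a)

theorem evalSndTruncated_shift_snd (ℓ : ℂ) (H : seriesSpace) :
    evalSndTruncated ℓ (shift 0 1 H) = Complex.exp ℓ • evalSndTruncated ℓ H :=
  Subtype.ext (evalSnd_shift_snd ℓ H)

theorem shift_evalSndTruncated_derivFst (ℓ : ℂ) (H : seriesSpace) :
    truncatedSeries.shift (evalSndTruncated ℓ (derivFst H)) =
      truncatedSeries.euler (evalSndTruncated ℓ H) := by
  refine truncatedSeries.ext fun a => ?_
  have h := congrFun (evalSnd_derivFst ℓ H) (a - 1)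
  rw [FormalSeries.deriv, sub_add_cancel] at h
  exact h

end seriesSpace

/-! ## Four-point functions as series -/

section SumLemmas

/-- The terms with `j < i` vanish, and the remaining ones are the expansion of a negative power of a
difference of points. -/
theorem sum_range_choose_mul {i J M : ℕ} (hM : i + J ≤ M) (f : ℕ → ℂ)
    (hf : ∀ j, J ≤ j → f (i + j) = 0) :
    ∑ j ∈ Finset.range M, (j.choose i : ℂ) * f j =
      ∑ j ∈ Finset.range J, ((i + j).choose i : ℂ) * f (i + j) := by
  rw [Finset.eventually_constant_sum (N := i + J) (fun j hj => ?_) hM, Finset.sum_range_add,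
    Finset.sum_eq_zero, zero_add]
  · intro j hj
    rw [Nat.choose_eq_zero_of_lt (Finset.mem_range.1 hj), Nat.cast_zero, zero_mul]
  · obtain ⟨k, rfl⟩ := Nat.exists_eq_add_of_le hj
    rw [add_assoc, hf _ (by omega), mul_zero]

end SumLemmas

section FourPointSeries

variable {V : Type v} [AddCommGroup V] [Module ℂ V] [VertexOperatorAlgebra V]
  {A B C W : NGradedModule.{v, u} V}

namespace NGradedModule

/-- The functional `θ α₋₁₋ⱼ`. -/
def dualShift {N n : ℕ} (hn : 1 ≤ n) {α : V} (hα : α ∈ wtSpace V n) (θ : W.dualLE N) (j : ℕ) :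
    W.dualLE N :=
  ⟨θ.1 ∘ₗ vmode α (-1 - (j : ℤ)), fun m hm w hw =>
    θ.2 _ (by omega) _ (W.vmode_neg_mem_gr hα j hw)⟩

theorem dualShift_apply {N n : ℕ} (hn : 1 ≤ n) {α : V} (hα : α ∈ wtSpace V n) (θ : W.dualLE N)
    (j : ℕ) (w : W) : (W.dualShift hn hα θ j).1 w = θ.1 (vmode α (-1 - (j : ℤ)) w) := rfl

/-- `α₋₁₋ⱼ` raises degrees by `n + j > N`. This cuts off the sum over functionals in the Ward
identities at `N`. -/
theorem dualShift_eq_zero {N n : ℕ} (hn : 1 ≤ n) {α : V} (hα : α ∈ wtSpace V n) (θ : W.dualLE N)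
    {j : ℕ} (hj : N ≤ j) : W.dualShift hn hα θ j = 0 := by
  refine Subtype.ext (LinearMap.ext fun w => ?_)
  rw [dualShift_apply]
  induction w using W.hom_induction with
  | add x y hx hy => rw [map_add, map_add, hx, hy]; simp
  | hom m w hw => exact θ.2 _ (by omega) _ (W.vmode_neg_mem_gr hα j hw)

end NGradedModule

namespace LogIntertwiningOperator

variable (Y : LogIntertwiningOperator A B W)

/-- The coefficient of `z^e log^h z`. -/
def coef (h : ℕ) (e : ℂ) : A →ₗ[ℂ] B →ₗ[ℂ] W := Y.mode h (-e - 1)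

theorem coef_eq_zero {h : ℕ} (hh : Y.K < h) (e : ℂ) : Y.coef h e = 0 := Y.mode_eq_zero h hh _

theorem coef_truncation (h : ℕ) (e : ℂ) (v : A) (u : B) :
    ∃ n₀ : ℕ, ∀ n : ℕ, n₀ ≤ n → Y.coef h (e - n) v u = 0 := by
  obtain ⟨n₀, hn⟩ := Y.truncation h (-e - 1) v u
  refine ⟨n₀, fun n hn' => ?_⟩
  rw [coef, show -(e - (n : ℂ)) - 1 = -e - 1 + n by ring, hn n hn']

theorem coef_mem_genWt {h : ℕ} {e a b : ℂ} {v : A} {u : B} (hv : v ∈ genWt V A a)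
    (hu : u ∈ genWt V B b) : Y.coef h e v u ∈ genWt V W (a + b + e) := by
  have := mode_mem_genWt (Y := Y) h (-e - 1) hv hu
  rwa [show a + b - (-e - 1) - 1 = a + b + e by ring] at this

theorem coef_conf (h : ℕ) (e : ℂ) (v : A) (u : B) :
    Y.coef h e (vmode (conf : V) 0 v) u =
      (e + 1) • Y.coef h (e + 1) v u + ((h : ℂ) + 1) • Y.coef (h + 1) (e + 1) v u := by
  rw [coef, coef, coef, Y.derivative, show -(e + 1) - 1 = -e - 1 - 1 by ring]
  congr 2
  ring

/-- The associator formula for the mode `-1 - j`, where `(-1)^i choose (-1-j) i = choose (i+j) i`;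
one bound `M` has to serve both kinds of terms. -/
theorem coef_vmode_neg_left (α : V) (j h : ℕ) (e : ℂ) (u : A) (w : B) {M : ℕ}
    (h1 : ∀ i : ℕ, M ≤ i → Y.coef h (e - i) u w = 0)
    (h2 : ∀ i : ℕ, M ≤ i → vmode α (i : ℤ) w = 0) :
    Y.coef h e (vmode α (-1 - (j : ℤ)) u) w = ∑ i ∈ Finset.range M, ((i + j).choose i : ℂ) •
      (vmode α (-1 - ((i + j : ℕ) : ℤ)) (Y.coef h (e - i) u w) +
        (-1 : ℂ) ^ j • Y.coef h (e + 1 + j + i) u (vmode α (i : ℤ) w)) := by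
  have e1 : ∀ i : ℕ, -e - 1 + (i : ℂ) = -(e - i) - 1 := fun i => by ring
  rw [coef, Y.associator, finsum_eq_sum_range (n := M)]
  · refine Finset.sum_congr rfl fun i _ => ?_
    rw [Int.choose_neg_one_sub, e1, coef, coef]
    have e2 : -e - 1 + ((-1 - (j : ℤ) : ℤ) : ℂ) - i = -(e + 1 + j + i) - 1 := by push_cast; ring
    have e3 : (-1 : ℂ) ^ (-1 - (j : ℤ)) = -(-1) ^ j := by
      rw [zpow_sub₀ (by norm_num), zpow_neg_one, zpow_natCast]
      rcases neg_one_pow_eq_or ℂ j with h | h <;> rw [h] <;> norm_num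
    have e4 : (-1 : ℂ) ^ i * (((-1) ^ i * ((i + j).choose i : ℤ) : ℤ) : ℂ) =
        ((i + j).choose i : ℂ) := by
      push_cast
      rw [← mul_assoc, ← mul_pow]
      norm_num
    rw [e2, e3, e4, show -1 - (j : ℤ) - i = -1 - ((i + j : ℕ) : ℤ) by push_cast; ring, neg_smul,
      sub_neg_eq_add]
  · intro i hi
    have := h1 i hi
    rw [coef, ← e1] at this
    rw [this, h2 i hi]
    simp

theorem vmode_nat_coef (α : V) (j h : ℕ) (e : ℂ) (v : A) (u : B) {L : ℕ}
    (hL : ∀ i : ℕ, L ≤ i → vmode α (i : ℤ) v = 0) :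
    vmode α (j : ℤ) (Y.coef h e v u) = Y.coef h e v (vmode α (j : ℤ) u) +
      ∑ i ∈ Finset.range L, (j.choose i : ℂ) • Y.coef h (e - j + i) (vmode α (i : ℤ) v) u := by
  rw [← sub_eq_iff_eq_add', coef, Y.commutator, finsum_eq_sum_range (n := L)]
  · refine Finset.sum_congr rfl fun i _ => ?_
    rw [Ring.choose_natCast, coef]
    congr 4
    · push_cast; ring
  · intro i hi
    rw [hL i hi]
    simp

theorem coef_vmode_neg_right (α : V) (j h : ℕ) (e : ℂ) (v : A) (u : B) {L : ℕ}
    (hL : ∀ i : ℕ, L ≤ i → vmode α (i : ℤ) v = 0) :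
    Y.coef h e v (vmode α (-1 - (j : ℤ)) u) = vmode α (-1 - (j : ℤ)) (Y.coef h e v u) -
      ∑ i ∈ Finset.range L, ((-1) ^ i * ((i + j).choose i : ℂ)) •
        Y.coef h (e + 1 + j + i) (vmode α (i : ℤ) v) u := by
  rw [eq_sub_iff_add_eq, ← eq_sub_iff_add_eq', coef, Y.commutator, finsum_eq_sum_range (n := L)]
  · refine Finset.sum_congr rfl fun i _ => ?_
    rw [Int.choose_neg_one_sub, coef]
    push_cast
    congr 4
    ring
  · intro i hi
    rw [hL i hi]
    simp

end LogIntertwiningOperator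

/-- Four-point functions with finitely many total degrees on generalized weight vectors have
finitely many total degrees. -/
theorem finite_totalDegree (hA : A.C1Cofinite) (hB : B.C1Cofinite) (hC : C.C1Cofinite)
    (f : A → B → C → FormalSeries₂) (h1 : ∀ v v' u w, f (v + v') u w = f v u w + f v' u w)
    (h2 : ∀ v u u' w, f v (u + u') w = f v u w + f v u' w)
    (h3 : ∀ v u w w', f v u (w + w') = f v u w + f v u w')
    (hf : ∀ μ ν ρ, ∀ v ∈ genWt V A μ, ∀ u ∈ genWt V B ν, ∀ w ∈ genWt V C ρ,
      ∃ E : Set ℂ, E.Finite ∧ ∀ a b, a + b ∉ E → f v u w a b = 0) (v : A) (u : B) (w : C) :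
    ∃ E : Set ℂ, E.Finite ∧ ∀ a b, a + b ∉ E → f v u w a b = 0 := by
  have hadd : ∀ f g : FormalSeries₂, (∃ E : Set ℂ, E.Finite ∧ ∀ a b, a + b ∉ E → f a b = 0) →
      (∃ E : Set ℂ, E.Finite ∧ ∀ a b, a + b ∉ E → g a b = 0) →
      ∃ E : Set ℂ, E.Finite ∧ ∀ a b, a + b ∉ E → (f + g) a b = 0 := by
    rintro f g ⟨E, hE, h⟩ ⟨E', hE', h'⟩
    refine ⟨E ∪ E', hE.union hE', fun a b hab => ?_⟩
    rw [Set.mem_union, not_or] at hab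
    simp [h a b hab.1, h' a b hab.2]
  -- A `C₁`-cofinite module is the sum of its generalized weight spaces, so an additive property may
  -- be checked on these, one insertion at a time.
  have hind : ∀ (X : NGradedModule.{v, u} V), X.C1Cofinite → ∀ (p : X → Prop),
      (∀ x y, p x → p y → p (x + y)) → (∀ μ, ∀ x ∈ genWt V X μ, p x) → ∀ x, p x := by
    intro X hX p ha hm x
    have hx : x ∈ ⨆ μ, genWt V X μ := by rw [X.iSup_genWt hX]; trivial
    exact Submodule.iSup_induction _ (motive := p) hx hm (hm 0 0 (Submodule.zero_mem _)) ha
  refine hind A hA (fun v => ∃ E : Set ℂ, E.Finite ∧ ∀ a b, a + b ∉ E → f v u w a b = 0)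
    (fun x y hx hy => by simp only [h1]; exact hadd _ _ hx hy) (fun μ v hv => ?_) v
  refine hind B hB (fun u => ∃ E : Set ℂ, E.Finite ∧ ∀ a b, a + b ∉ E → f v u w a b = 0)
    (fun x y hx hy => by simp only [h2]; exact hadd _ _ hx hy) (fun ν u hu => ?_) u
  exact hind C hC (fun w => ∃ E : Set ℂ, E.Finite ∧ ∀ a b, a + b ∉ E → f v u w a b = 0)
    (fun x y hx hy => by simp only [h3]; exact hadd _ _ hx hy)
    (fun ρ w hw => hf μ ν ρ v hv u hu w hw) w

end FourPointSeries

/-! ### Quotients by powers of the variables, and signs. -/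

namespace seriesSpace

theorem shift_snd_pow_apply (i : ℕ) (H : seriesSpace) :
    (shift 0 1 ^ (i + 1)) (shift 0 (-1 - i) H) = H := by
  rw [shift_pow, ← Module.End.mul_apply, shift_mul]
  have e : shift (((i + 1 : ℕ) : ℤ) * 0 + 0) (((i + 1 : ℕ) : ℤ) * 1 + (-1 - i)) = 1 := by
    rw [← shift_zero]; congr 1; omega
  rw [e, Module.End.one_apply]

theorem shift_fst_pow_apply (i : ℕ) (H : seriesSpace) :
    (shift 1 0 ^ (i + 1)) (shift (-1 - i) 0 H) = H := by
  rw [shift_pow, ← Module.End.mul_apply, shift_mul]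
  have e : shift (((i + 1 : ℕ) : ℤ) * 1 + (-1 - i)) (((i + 1 : ℕ) : ℤ) * 0 + 0) = 1 := by
    rw [← shift_zero]; congr 1; omega
  rw [e, Module.End.one_apply]

theorem end_sub_zero (D : Module.End ℂ seriesSpace) : D - 0 = D :=
  LinearMap.ext fun H => by rw [LinearMap.sub_apply, LinearMap.zero_apply, sub_zero]

theorem end_zero_sub (D : Module.End ℂ seriesSpace) : 0 - D = -D :=
  LinearMap.ext fun H => by
    rw [LinearMap.sub_apply, LinearMap.zero_apply, zero_sub, LinearMap.neg_apply]

theorem end_sub_comm (D D' : Module.End ℂ seriesSpace) : D - D' = -(D' - D) :=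
  LinearMap.ext fun H => by
    rw [LinearMap.neg_apply, LinearMap.sub_apply, LinearMap.sub_apply, neg_sub]

/-- Quotients by powers of `y - x` are obtained from those by powers of `x - y` through a sign, so
that the direction of expansion stays the same. -/
theorem pow_smul_of_eq_neg {D D' : Module.End ℂ seriesSpace} (hD : D' = -D) {i : ℕ}
    {H H' : seriesSpace} (h : (D ^ i) H = H') : (D' ^ i) ((-1 : ℂ) ^ i • H) = H' := by
  subst hD
  rw [← h]
  clear h
  induction i generalizing H with
  | zero => simp
  | succ i ih =>
    rw [pow_succ, pow_succ, pow_succ, Module.End.mul_apply, Module.End.mul_apply, ← ih, map_smul,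
      mul_smul, LinearMap.neg_apply]
    congr 2
    module

end seriesSpace

/-! ### Four-point functions of `A ⊠ (B ⊠ C)` and their Ward identities. -/

namespace RightFusion

variable {V : Type v} [AddCommGroup V] [Module ℂ V] [VertexOperatorAlgebra V]
  {A B C : NGradedModule.{v, u} V} (P : RightFusion A B C)

theorem F_apply (h k : ℕ) (θ : Module.Dual ℂ P.ABC) (v : A) (u : B) (w : C) (a b : ℂ) :
    P.F h k θ v u w a b = θ (P.YABC.coef h a v (P.YBC.coef k b u w)) := rfl

theorem c1Cofinite_BC (hB : B.C1Cofinite) (hC : C.C1Cofinite) : P.BC.C1Cofinite :=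
  LogIntertwiningOperator.c1Cofinite_of_isFusionProduct P.YBC hB hC P.fusionBC

theorem c1Cofinite_ABC (hA : A.C1Cofinite) (hB : B.C1Cofinite) (hC : C.C1Cofinite) :
    P.ABC.C1Cofinite :=
  LogIntertwiningOperator.c1Cofinite_of_isFusionProduct P.YABC hA (P.c1Cofinite_BC hB hC)
    P.fusionABC

variable (hA : A.C1Cofinite) (hB : B.C1Cofinite) (hC : C.C1Cofinite) {N : ℕ}

/-- The four-point function as a series in `y` and `x`. -/
def series (κ : ℕ × ℕ) (θ : P.ABC.dualLE N) (v : A) (u : B) (w : C) : seriesSpace :=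
  -- The first variable of `seriesSpace` must have truncated exponents uniformly in the second one.
  -- Here this is `y`, hence the interchange.
  ⟨fun b a => P.F κ.1 κ.2 θ.1 v u w a b, by
    constructor
    · obtain ⟨S, hS, h⟩ := P.ABC.finite_weights_dualLE (P.c1Cofinite_ABC hA hB hC) N
      refine finite_totalDegree hA hB hC (fun v u w b a => P.F κ.1 κ.2 θ.1 v u w a b)
        (fun v v' u w => ?_) (fun v u u' w => ?_) (fun v u w w' => ?_) ?_ v u w
      · ext a b; simp [F_apply]
      · ext a b; simp [F_apply]
      · ext a b; simp [F_apply]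
      · intro μ ν ρ v hv u hu w hw
        -- For vectors of weights `μ`, `ν`, `ρ` the coefficient of `y^b x^a` has weight `μ + ν + ρ +
        -- a + b`, on which `θ` vanishes unless it belongs to `S`.
        refine ⟨(fun e => e - (μ + ν + ρ)) '' S, hS.image _, fun b a hab => ?_⟩
        refine h θ.1 θ.2 _ (fun h0 => hab ⟨_, h0, ?_⟩) _
          (P.YABC.coef_mem_genWt hv (P.YBC.coef_mem_genWt hu hw))
        ring
    · intro b
      obtain ⟨n₀, hn⟩ := P.YBC.coef_truncation κ.2 b u w
      exact ⟨n₀, fun n hn' a => by beta_reduce; rw [F_apply, hn n hn', map_zero, map_zero]⟩⟩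

theorem series_apply (κ : ℕ × ℕ) (θ : P.ABC.dualLE N) (v : A) (u : B) (w : C) (b a : ℂ) :
    (P.series hA hB hC κ θ v u w).1 b a =
      θ.1 (P.YABC.coef κ.1 a v (P.YBC.coef κ.2 b u w)) := rfl

theorem series_dualShift {n : ℕ} (hn : 1 ≤ n) {α : V} (hα : α ∈ wtSpace V n) (κ : ℕ × ℕ)
    (θ : P.ABC.dualLE N) (j : ℕ) (v : A) (u : B) (w : C) (b a : ℂ) :
    (P.series hA hB hC κ (P.ABC.dualShift hn hα θ j) v u w).1 b a =
      θ.1 (vmode α (-1 - (j : ℤ)) (P.YABC.coef κ.1 a v (P.YBC.coef κ.2 b u w))) := rfl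

open seriesSpace

/-- The associator at `x` leaves `αᵢ` acting on `𝒴(u, y) w`; the commutator formula distributes it
over `u` and `w`. The terms with `u` assemble to powers of `(x - y)⁻¹` expanded in `y / x`. -/
theorem wardIdentity_A :
    WardIdentity (P.series hA hB hC (N := N)) (shift 0 1) (shift 1 0) 0 := by
  intro κ θ v u w n hn α hα L L' hL hL'
  refine ⟨N, P.ABC.dualShift hn hα θ,
    fun i => divPow 1 i (P.series hA hB hC κ θ v (vmode α (i : ℤ) u) w),
    fun i => shift 0 (-1 - i) (P.series hA hB hC κ θ v u (vmode α (i : ℤ) w)),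
    fun i => ?_, fun i => ?_, ?_⟩
  · have := sub_pow_divPow 1 i (P.series hA hB hC κ θ v (vmode α (i : ℤ) u) w)
    rwa [one_smul] at this
  · rw [end_sub_zero]
    exact shift_snd_pow_apply i _
  refine seriesSpace.ext fun b a => ?_
  obtain ⟨n₁, hn₁⟩ := P.YABC.coef_truncation κ.1 a v (P.YBC.coef κ.2 b u w)
  have hJ : ∀ i : ℕ, ∃ J : ℕ, ∀ j : ℕ, J ≤ j → ∀ a,
      (P.series hA hB hC κ θ v (vmode α (i : ℤ) u) w).1 (b - j) a = 0 :=
    fun i => (P.series hA hB hC κ θ v (vmode α (i : ℤ) u) w).2.2 b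
  choose J hJ using hJ
  obtain ⟨n₂, hn₂⟩ := exists_vmode_eq_zero α (P.YBC.coef κ.2 b u w)
  -- One cutoff beyond all truncations involved, so that every series becomes a sum over the same
  -- range and summations can be exchanged.
  set M := max (max n₁ n₂) (max (max N L') (L + (Finset.range L).sup J)) with hM
  have hMJ : ∀ i ∈ Finset.range L, i + J i ≤ M := fun i hi => by
    have := Finset.le_sup (f := J) hi
    rw [Finset.mem_range] at hi
    omega
  have key := P.YABC.coef_vmode_neg_left α 0 κ.1 a v (P.YBC.coef κ.2 b u w) (M := M)
    (fun i hi => hn₁ i (by omega)) (fun i hi => hn₂ i (by omega))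
  simp only [Nat.cast_zero, sub_zero, add_zero, Nat.choose_self, Nat.cast_one, one_smul,
    pow_zero] at key
  simp only [coe_add_apply, coe_sum_apply, shift_pow, shift_apply, series_dualShift]
  rw [series_apply, key, map_sum]
  simp only [map_add, Finset.sum_add_distrib]
  rw [add_assoc]
  congr 1
  · rw [← Finset.eventually_constant_sum (N := N) (n := M) (fun j hj => ?_) (by omega)]
    · refine Finset.sum_congr rfl fun j _ => ?_
      push_cast
      simp
    · have := LinearMap.congr_fun (congrArg Subtype.val (P.ABC.dualShift_eq_zero hn hα θ hj))
      exact this _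
  · have h3 : ∀ i ∈ Finset.range M, θ.1 (P.YABC.coef κ.1 (a + 1 + i) v
        (vmode α (i : ℤ) (P.YBC.coef κ.2 b u w))) =
        (P.series hA hB hC κ θ v u (vmode α (i : ℤ) w)).1 b (a + 1 + i) +
        ∑ r ∈ Finset.range L, (i.choose r : ℂ) *
          (P.series hA hB hC κ θ v (vmode α (r : ℤ) u) w).1 (b - i + r) (a + 1 + i) := by
      intro i _
      rw [P.YBC.vmode_nat_coef α i κ.2 b u w hL, map_add, map_add, map_sum, map_sum]
      simp only [map_smul, smul_eq_mul, series_apply]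
    rw [Finset.sum_congr rfl h3, Finset.sum_add_distrib, add_comm]
    congr 1
    -- For fixed `r`, the sum of `choose i r y^(i-r) x^(-1-i)` over `i` is `(x - y)^(-1-r)`.
    · rw [Finset.sum_comm]
      refine Finset.sum_congr rfl fun r hr => ?_
      rw [sum_range_choose_mul (hMJ r hr) (fun i =>
        (P.series hA hB hC κ θ v (vmode α (r : ℤ) u) w).1 (b - i + r) (a + 1 + i)),
        divPow_apply 1 r _ (hJ r)]
      · refine Finset.sum_congr rfl fun j _ => ?_
        rw [one_pow, mul_one]
        congr 1
        exact apply_congr _ (by push_cast; ring) (by push_cast; ring)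
      · intro j hj
        rw [← hJ r j hj (a + 1 + ((r + j : ℕ) : ℂ))]
        exact apply_congr _ (by push_cast; ring) rfl
    · rw [← Finset.eventually_constant_sum (N := L') (n := M) (fun j hj => ?_) (by omega)]
      · refine Finset.sum_congr rfl fun j _ => ?_
        exact apply_congr _ (by push_cast; ring) (by push_cast; ring)
      · rw [hL' j hj, series_apply, map_zero, map_zero, map_zero]

/-- The associator at `y` produces `α₋₁₋ⱼ` on the inner product, which is moved out to `θ` past
`𝒴(v, x)`. The commutators sum up to powers of `(y - x)⁻¹`, again expanded in `y / x`. -/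
theorem wardIdentity_B :
    WardIdentity (fun κ θ (u : B) (v : A) w => P.series hA hB hC (N := N) κ θ v u w)
      (shift 1 0) (shift 0 1) 0 := by
  intro κ θ u v w n hn α hα L L' hL hL'
  refine ⟨N, P.ABC.dualShift hn hα θ,
    fun i => (-1 : ℂ) ^ (i + 1) •
      divPow 1 i (P.series hA hB hC κ θ (vmode α (i : ℤ) v) u w),
    fun i => shift (-1 - i) 0 (P.series hA hB hC κ θ v u (vmode α (i : ℤ) w)),
    fun i => ?_, fun i => ?_, ?_⟩
  · have := sub_pow_divPow 1 i (P.series hA hB hC κ θ (vmode α (i : ℤ) v) u w)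
    rw [one_smul] at this
    exact pow_smul_of_eq_neg (end_sub_comm _ _) this
  · rw [end_sub_zero]
    exact shift_fst_pow_apply i _
  refine seriesSpace.ext fun b a => ?_
  obtain ⟨n₁, hn₁⟩ := P.YBC.coef_truncation κ.2 b u w
  have hJ : ∀ i : ℕ, ∃ J : ℕ, ∀ j : ℕ, J ≤ j → ∀ a,
      (P.series hA hB hC κ θ (vmode α (i : ℤ) v) u w).1 (b - j) a = 0 :=
    fun i => (P.series hA hB hC κ θ (vmode α (i : ℤ) v) u w).2.2 b
  choose J hJ using hJ
  set M := max n₁ (max (max N L') ((Finset.range L).sup J)) with hM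
  have hMJ : ∀ i ∈ Finset.range L, J i ≤ M := fun i hi => by
    have := Finset.le_sup (f := J) hi
    omega
  have key := P.YBC.coef_vmode_neg_left α 0 κ.2 b u w (M := M)
    (fun i hi => hn₁ i (by omega)) (fun i hi => hL' i (by omega))
  simp only [Nat.cast_zero, sub_zero, add_zero, Nat.choose_self, Nat.cast_one, one_smul,
    pow_zero] at key
  simp only [coe_add_apply, coe_sum_apply, shift_pow, shift_apply, series_dualShift]
  rw [series_apply, key, map_sum, map_sum]
  simp only [map_add, Finset.sum_add_distrib]
  congr 1
  · have h3 : ∀ j ∈ Finset.range M, θ.1 (P.YABC.coef κ.1 a v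
        (vmode α (-1 - (j : ℤ)) (P.YBC.coef κ.2 (b - j) u w))) =
        θ.1 (vmode α (-1 - (j : ℤ)) (P.YABC.coef κ.1 a v (P.YBC.coef κ.2 (b - j) u w))) +
        ∑ i ∈ Finset.range L, (-1 : ℂ) ^ (i + 1) * (((i + j).choose i : ℂ) *
          (P.series hA hB hC κ θ (vmode α (i : ℤ) v) u w).1 (b - j) (a + 1 + i + j)) := by
      intro j _
      rw [P.YABC.coef_vmode_neg_right α j κ.1 a v _ hL, map_sub, map_sum, sub_eq_add_neg,
        ← Finset.sum_neg_distrib]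
      congr 1
      refine Finset.sum_congr rfl fun i _ => ?_
      rw [map_smul, smul_eq_mul, series_apply, add_right_comm (a + 1)]
      ring
    rw [Finset.sum_congr rfl h3, Finset.sum_add_distrib]
    congr 1
    · rw [← Finset.eventually_constant_sum (N := N) (n := M) (fun j hj => ?_) (by omega)]
      · refine Finset.sum_congr rfl fun j _ => ?_
        push_cast
        simp
      · have := LinearMap.congr_fun (congrArg Subtype.val (P.ABC.dualShift_eq_zero hn hα θ hj))
        exact this _
    · rw [Finset.sum_comm]
      refine Finset.sum_congr rfl fun i hi => ?_
      rw [coe_smul_apply, divPow_apply 1 i _ (J := M) fun j hj => hJ i j ((hMJ i hi).trans hj),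
        Finset.mul_sum]
      simp
  · rw [← Finset.eventually_constant_sum (N := L') (n := M) (fun j hj => ?_) (by omega)]
    · refine Finset.sum_congr rfl fun j _ => ?_
      exact apply_congr (P.series hA hB hC κ θ v u (vmode α (j : ℤ) w)) (by push_cast; ring)
        (by push_cast; ring)
    · rw [hL' j hj, series_apply]
      simp

/-- Two commutators move `α₋₁` from `w` to the left, past `u` at `y` and past `v` at `x`. -/
theorem wardIdentity_C :
    WardIdentity (fun κ θ (w : C) (v : A) (u : B) => P.series hA hB hC (N := N) κ θ v u w)
      0 (shift 0 1) (shift 1 0) := by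
  intro κ θ w v u n hn α hα L L' hL hL'
  -- The point is `0`, so only the power `0^0 = 1` remains in the sum over functionals.
  refine ⟨1, P.ABC.dualShift hn hα θ,
    fun i => (-1 : ℂ) ^ (i + 1) •
      shift 0 (-1 - i) (P.series hA hB hC κ θ (vmode α (i : ℤ) v) u w),
    fun i => (-1 : ℂ) ^ (i + 1) •
      shift (-1 - i) 0 (P.series hA hB hC κ θ v (vmode α (i : ℤ) u) w),
    fun i => pow_smul_of_eq_neg (end_zero_sub _) (shift_snd_pow_apply i _),
    fun i => pow_smul_of_eq_neg (end_zero_sub _) (shift_fst_pow_apply i _), ?_⟩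
  refine seriesSpace.ext fun b a => ?_
  have key1 := P.YBC.coef_vmode_neg_right α 0 κ.2 b u w hL'
  have key2 := P.YABC.coef_vmode_neg_right α 0 κ.1 a v (P.YBC.coef κ.2 b u w) hL
  simp only [Nat.cast_zero, sub_zero, add_zero, Nat.choose_self, Nat.cast_one, mul_one] at key1 key2
  simp only [coe_add_apply, coe_sum_apply, Finset.sum_range_one, pow_zero, Module.End.one_apply,
    series_dualShift]
  rw [series_apply, key1, map_sub, key2, map_sub, map_sub, map_sum, map_sum, map_sum,
    Nat.cast_zero, sub_zero, sub_eq_add_neg, sub_eq_add_neg, ← Finset.sum_neg_distrib,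
    ← Finset.sum_neg_distrib]
  congr 1
  · congr 1
    refine Finset.sum_congr rfl fun i _ => ?_
    rw [map_smul, smul_eq_mul, coe_smul_apply, shift_apply, series_apply, pow_succ]
    push_cast
    ring_nf
  · refine Finset.sum_congr rfl fun i _ => ?_
    rw [map_smul, map_smul, smul_eq_mul, coe_smul_apply, shift_apply, series_apply, pow_succ]
    push_cast
    ring_nf

theorem series_conf_A (h k : ℕ) (θ : P.ABC.dualLE N) (v : A) (u : B) (w : C) :
    P.series hA hB hC (h, k) θ (vmode (conf : V) 0 v) u w =
      derivSnd (P.series hA hB hC (h, k) θ v u w) +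
        ((h : ℂ) + 1) • shift 0 (-1) (P.series hA hB hC (h + 1, k) θ v u w) := by
  refine seriesSpace.ext fun b a => ?_
  rw [coe_add_apply, coe_smul_apply, derivSnd_apply, shift_apply]
  simp only [series_apply, P.YABC.coef_conf, map_add, map_smul, smul_eq_mul]
  simp

theorem series_conf_B (h k : ℕ) (θ : P.ABC.dualLE N) (v : A) (u : B) (w : C) :
    P.series hA hB hC (h, k) θ v (vmode (conf : V) 0 u) w =
      derivFst (P.series hA hB hC (h, k) θ v u w) +
        ((k : ℂ) + 1) • shift (-1) 0 (P.series hA hB hC (h, k + 1) θ v u w) := by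
  refine seriesSpace.ext fun b a => ?_
  rw [coe_add_apply, coe_smul_apply, derivFst_apply, shift_apply]
  simp only [series_apply, P.YBC.coef_conf, map_add, map_smul, smul_eq_mul]
  simp

theorem series_eq_zero {h k : ℕ} (hk : P.YABC.K < h ∨ P.YBC.K < k) (θ : P.ABC.dualLE N) (v : A)
    (u : B) (w : C) : P.series hA hB hC (h, k) θ v u w = 0 := by
  refine seriesSpace.ext fun b a => ?_
  rw [series_apply, coe_zero_apply]
  rcases hk with hk | hk <;> simp [LogIntertwiningOperator.coef_eq_zero _ hk]

theorem isLinearMap_series_θ (κ : ℕ × ℕ) (v : A) (u : B) (w : C) :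
    IsLinearMap ℂ fun θ : P.ABC.dualLE N => P.series hA hB hC κ θ v u w :=
  ⟨fun _ _ => rfl, fun _ _ => rfl⟩

theorem isLinearMap_series_A (κ : ℕ × ℕ) (θ : P.ABC.dualLE N) (u : B) (w : C) :
    IsLinearMap ℂ fun v => P.series hA hB hC κ θ v u w :=
  ⟨fun _ _ => seriesSpace.ext fun _ _ => by simp [series_apply],
    fun _ _ => seriesSpace.ext fun _ _ => by simp [series_apply]⟩

theorem isLinearMap_series_B (κ : ℕ × ℕ) (θ : P.ABC.dualLE N) (v : A) (w : C) :
    IsLinearMap ℂ fun u => P.series hA hB hC κ θ v u w :=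
  ⟨fun _ _ => seriesSpace.ext fun _ _ => by simp [series_apply],
    fun _ _ => seriesSpace.ext fun _ _ => by simp [series_apply]⟩

theorem isLinearMap_series_C (κ : ℕ × ℕ) (θ : P.ABC.dualLE N) (v : A) (u : B) :
    IsLinearMap ℂ fun w => P.series hA hB hC κ θ v u w :=
  ⟨fun _ _ => seriesSpace.ext fun _ _ => by simp [series_apply],
    fun _ _ => seriesSpace.ext fun _ _ => by simp [series_apply]⟩

end RightFusion

/-- Regroups a finite double sum along the antidiagonals `i + j = n`, as required for the binomial
expansion of `x^n` with `x = (x - y) + y`. -/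
theorem sum_range_range_eq {N M M' : ℕ} (g : ℕ → ℕ → ℂ) (hNM : N ≤ M')
    (hN : ∀ j i, N ≤ i + j → g j i = 0) (hM : ∀ j i, M ≤ j → g j i = 0) :
    ∑ j ∈ Finset.range M, ∑ i ∈ Finset.range M', g j i =
      ∑ n ∈ Finset.range N, ∑ j ∈ Finset.range (n + 1), g j (n - j) := by
  rw [Finset.sum_range_diag_flip]
  have h1 : ∀ j ∈ Finset.range M, ∑ i ∈ Finset.range M', g j i =
      ∑ i ∈ Finset.range (N - j), g j i :=
    fun j _ => Finset.eventually_constant_sum (fun i hi => hN j i (by omega)) (by omega)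
  rw [Finset.sum_congr rfl h1,
    ← Finset.eventually_constant_sum (N := M) (n := max M N)
      (u := fun j => ∑ i ∈ Finset.range (N - j), g j i)
      (fun j hj => Finset.sum_eq_zero fun i _ => hM j i hj) (le_max_left _ _),
    ← Finset.eventually_constant_sum (N := N) (n := max M N)
      (u := fun j => ∑ i ∈ Finset.range (N - j), g j i)
      (fun j hj => by rw [Nat.sub_eq_zero_of_le hj, Finset.sum_range_zero]) (le_max_right _ _)]

namespace seriesSpace

/-- The binomial coefficient is kept in the form in which it arises from the associator. -/
theorem add_pow_apply (n : ℕ) (H : seriesSpace) (a b : ℂ) :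
    (((shift 1 0 + shift 0 1) ^ n) H).1 a b =
      ∑ j ∈ Finset.range (n + 1), ((n - j + j).choose (n - j) : ℂ) * H.1 (a - j)
        (b - (n - j : ℕ)) := by
  have hc : Commute (shift 1 0) (shift 0 1) := by
    rw [commute_iff_eq, shift_mul, shift_mul]
    rfl
  rw [hc.add_pow, LinearMap.sum_apply, coe_sum_apply]
  refine Finset.sum_congr rfl fun j hj => ?_
  rw [Finset.mem_range] at hj
  rw [← (Nat.cast_commute _ _).eq, Module.End.mul_apply, shift_pow, shift_pow, shift_mul]
  rw [Nat.sub_add_cancel (by omega), Nat.choose_symm (by omega), Module.End.natCast_apply,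
    ← Nat.cast_smul_eq_nsmul ℂ, coe_smul_apply, shift_apply]
  congr 1
  exact apply_congr H (by push_cast; ring) (by push_cast; ring)

theorem shift_add_eq : shift 1 0 + shift 0 1 = shift 0 1 - (-1 : ℂ) • shift 1 0 :=
  LinearMap.ext fun H => by
    rw [LinearMap.add_apply, LinearMap.sub_apply, LinearMap.smul_apply]
    module

theorem shift_add_sub_snd : shift 1 0 + shift 0 1 - shift 0 1 = shift 1 0 :=
  LinearMap.ext fun H => by
    rw [LinearMap.sub_apply, LinearMap.add_apply, add_sub_cancel_right]

end seriesSpace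

theorem WardIdentity.swap {V : Type v} [AddCommGroup V] [Module ℂ V] [VertexOperatorAlgebra V]
    {W P Q S : NGradedModule.{v, u} V} {N : ℕ} {κ : Type} {M : Type*} [AddCommGroup M] [Module ℂ M]
    {Φ : κ → W.dualLE N → P → Q → S → M} {x y z : Module.End ℂ M} (h : WardIdentity Φ x y z) :
    WardIdentity (fun k θ p s q => Φ k θ p q s) x z y := by
  intro k θ p s q n hn α hα L L' hL hL'
  obtain ⟨m, η, Ψ, Ψ', h1, h2, h3⟩ := h k θ p q s n hn α hα L' L hL' hL
  exact ⟨m, η, Ψ', Ψ, h2, h1, h3.trans (add_right_comm _ _ _)⟩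

/-! ### Four-point functions of `(A ⊠ B) ⊠ C` and their Ward identities. -/

namespace LeftFusion

variable {V : Type v} [AddCommGroup V] [Module ℂ V] [VertexOperatorAlgebra V]
  {A B C : NGradedModule.{v, u} V} (Q : LeftFusion A B C)

theorem F_apply (h k : ℕ) (θ : Module.Dual ℂ Q.ABC) (v : A) (u : B) (w : C) (a b : ℂ) :
    Q.F h k θ v u w a b = θ (Q.YABC.coef h b (Q.YAB.coef k a v u) w) := rfl

theorem c1Cofinite_AB (hA : A.C1Cofinite) (hB : B.C1Cofinite) : Q.AB.C1Cofinite :=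
  LogIntertwiningOperator.c1Cofinite_of_isFusionProduct Q.YAB hA hB Q.fusionAB

theorem c1Cofinite_ABC (hA : A.C1Cofinite) (hB : B.C1Cofinite) (hC : C.C1Cofinite) :
    Q.ABC.C1Cofinite :=
  LogIntertwiningOperator.c1Cofinite_of_isFusionProduct Q.YABC (Q.c1Cofinite_AB hA hB) hC
    Q.fusionABC

variable (hA : A.C1Cofinite) (hB : B.C1Cofinite) (hC : C.C1Cofinite) {N : ℕ}

/-- The four-point function as a series in `x - y` and `y`. -/
def series (κ : ℕ × ℕ) (θ : Q.ABC.dualLE N) (v : A) (u : B) (w : C) : seriesSpace :=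
  ⟨Q.F κ.1 κ.2 θ.1 v u w, by
    constructor
    · obtain ⟨S, hS, h⟩ := Q.ABC.finite_weights_dualLE (Q.c1Cofinite_ABC hA hB hC) N
      refine finite_totalDegree hA hB hC (Q.F κ.1 κ.2 θ.1)
        (fun v v' u w => ?_) (fun v u u' w => ?_) (fun v u w w' => ?_) ?_ v u w
      · ext a b; simp [F_apply]
      · ext a b; simp [F_apply]
      · ext a b; simp [F_apply]
      · intro μ ν ρ v hv u hu w hw
        refine ⟨(fun e => e - (μ + ν + ρ)) '' S, hS.image _, fun a b hab => ?_⟩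
        refine h θ.1 θ.2 _ (fun h0 => hab ⟨_, h0, ?_⟩) _
          (Q.YABC.coef_mem_genWt (Q.YAB.coef_mem_genWt hv hu) hw)
        ring
    · intro a
      obtain ⟨n₀, hn⟩ := Q.YAB.coef_truncation κ.2 a v u
      exact ⟨n₀, fun n hn' b => by
        rw [F_apply, hn n hn', map_zero, LinearMap.zero_apply, map_zero]⟩⟩

theorem series_apply (κ : ℕ × ℕ) (θ : Q.ABC.dualLE N) (v : A) (u : B) (w : C) (a b : ℂ) :
    (Q.series hA hB hC κ θ v u w).1 a b =
      θ.1 (Q.YABC.coef κ.1 b (Q.YAB.coef κ.2 a v u) w) := rfl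

theorem series_dualShift {n : ℕ} (hn : 1 ≤ n) {α : V} (hα : α ∈ wtSpace V n) (κ : ℕ × ℕ)
    (θ : Q.ABC.dualLE N) (j : ℕ) (v : A) (u : B) (w : C) (a b : ℂ) :
    (Q.series hA hB hC κ (Q.ABC.dualShift hn hα θ j) v u w).1 a b =
      θ.1 (vmode α (-1 - (j : ℤ)) (Q.YABC.coef κ.1 b (Q.YAB.coef κ.2 a v u) w)) := rfl

open seriesSpace

/-- Two nested associators, the inner one in `x - y` and the outer one in `y`. The point `x` is
represented by `(x - y) + y`, and negative powers of `x` are expanded in `(x - y) / y`. -/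
theorem wardIdentity_A : WardIdentity (Q.series hA hB hC (N := N)) (shift 1 0 + shift 0 1)
    (shift 0 1) 0 := by
  intro κ θ v u w n hn α hα L L' hL hL'
  refine ⟨N, Q.ABC.dualShift hn hα θ,
    fun i => shift (-1 - i) 0 (Q.series hA hB hC κ θ v (vmode α (i : ℤ) u) w),
    fun i => divPow (-1) i (Q.series hA hB hC κ θ v u (vmode α (i : ℤ) w)),
    fun i => ?_, fun i => ?_, ?_⟩
  · rw [shift_add_sub_snd]
    exact shift_fst_pow_apply i _
  · rw [end_sub_zero, shift_add_eq]
    exact sub_pow_divPow (-1) i _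
  refine seriesSpace.ext fun a b => ?_
  obtain ⟨n₁, hn₁⟩ := Q.YAB.coef_truncation κ.2 a v u
  set M := max n₁ L with hM
  have hX : ∀ j : ℕ, M ≤ j → Q.YAB.coef κ.2 (a - j) v u = 0 := fun j hj => hn₁ j (by omega)
  have hJ : ∀ j : ℕ, ∃ J : ℕ, ∀ i : ℕ, J ≤ i →
      Q.YABC.coef κ.1 (b - i) (Q.YAB.coef κ.2 (a - j) v u) w = 0 :=
    fun j => Q.YABC.coef_truncation κ.1 b _ w
  choose J hJ using hJ
  set M' := max (max N L') ((Finset.range M).sup J) with hM'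
  have hMJ : ∀ j ∈ Finset.range M, J j ≤ M' := fun i hi => by
    have := Finset.le_sup (f := J) hi
    omega
  have key := Q.YAB.coef_vmode_neg_left α 0 κ.2 a v u (M := M) hX (fun i hi => hL i (by omega))
  simp only [Nat.cast_zero, sub_zero, add_zero, Nat.choose_self, Nat.cast_one, one_smul,
    pow_zero] at key
  simp only [coe_add_apply, coe_sum_apply, add_pow_apply, shift_apply, series_dualShift]
  rw [series_apply, key, map_sum, LinearMap.sum_apply, map_sum]
  simp only [map_add, LinearMap.add_apply, Finset.sum_add_distrib]
  have h3 : ∀ j ∈ Finset.range M, θ.1 (Q.YABC.coef κ.1 b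
      (vmode α (-1 - (j : ℤ)) (Q.YAB.coef κ.2 (a - j) v u)) w) =
      ∑ i ∈ Finset.range M', ((i + j).choose i : ℂ) * θ.1 (vmode α (-1 - ((i + j : ℕ) : ℤ))
        (Q.YABC.coef κ.1 (b - i) (Q.YAB.coef κ.2 (a - j) v u) w)) +
      ∑ i ∈ Finset.range M', ((i + j).choose i : ℂ) * (-1) ^ j *
        (Q.series hA hB hC κ θ v u (vmode α (i : ℤ) w)).1 (a - j) (b + 1 + i + j) := by
    intro j hj
    rw [Q.YABC.coef_vmode_neg_left α j κ.1 b _ w (M := M')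
      (fun i hi => hJ j i ((hMJ j hj).trans hi)) (fun i hi => hL' i (by omega)), map_sum,
      ← Finset.sum_add_distrib]
    refine Finset.sum_congr rfl fun i _ => ?_
    rw [map_smul, map_add, map_smul, series_apply, add_right_comm (b + 1) (i : ℂ)]
    simp only [smul_eq_mul]
    ring
  rw [Finset.sum_congr rfl h3, Finset.sum_add_distrib, add_right_comm]
  congr 1
  · congr 1
    -- The terms with `i + j = n` all carry the functional `θ α₋₁₋ₙ`, which vanishes for `n ≥ N`;
    -- their binomial coefficients add up to `((x - y) + y)^n`.
    · rw [sum_range_range_eq (N := N) _ (by omega)]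
      · refine Finset.sum_congr rfl fun i _ => Finset.sum_congr rfl fun j hj => ?_
        rw [Finset.mem_range] at hj
        rw [Nat.sub_add_cancel (by omega : j ≤ i)]
      · intro j i hij
        have := LinearMap.congr_fun (congrArg Subtype.val (Q.ABC.dualShift_eq_zero hn hα θ hij))
          (Q.YABC.coef κ.1 (b - i) (Q.YAB.coef κ.2 (a - j) v u) w)
        rw [NGradedModule.dualShift_apply] at this
        rw [this]
        simp
      · intro j i hj
        rw [hX j hj]
        simp
    · rw [← Finset.eventually_constant_sum (N := L) (n := M) (fun j hj => ?_) (by omega)]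
      · refine Finset.sum_congr rfl fun j _ => ?_
        exact apply_congr (Q.series hA hB hC κ θ v (vmode α (j : ℤ) u) w) (by push_cast; ring)
          (by push_cast; ring)
      · rw [hL j hj, series_apply]
        simp
  · rw [Finset.sum_comm,
      ← Finset.eventually_constant_sum (N := L') (n := M') (fun i hi => ?_) (by omega)]
    · refine Finset.sum_congr rfl fun i _ => ?_
      rw [divPow_apply (-1) i _ (J := M)]
      intro j hj b
      rw [series_apply, hX j hj]
      simp
    · rw [divPow_apply (-1) i _ (J := M)]
      · refine Finset.sum_eq_zero fun j _ => ?_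
        rw [hL' i hi, series_apply]
        simp
      · intro j hj b
        rw [series_apply, hX j hj]
        simp

/-- First the commutator inside `A ⊠ B`, giving powers of `(y - x)⁻¹`, then the associator at `y`.
-/
theorem wardIdentity_B :
    WardIdentity (fun κ θ (u : B) (v : A) w => Q.series hA hB hC (N := N) κ θ v u w)
      (shift 0 1) (shift 1 0 + shift 0 1) 0 := by
  intro κ θ u v w n hn α hα L L' hL hL'
  refine ⟨N, Q.ABC.dualShift hn hα θ,
    fun i => (-1 : ℂ) ^ (i + 1) •
      shift (-1 - i) 0 (Q.series hA hB hC κ θ (vmode α (i : ℤ) v) u w),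
    fun i => shift 0 (-1 - i) (Q.series hA hB hC κ θ v u (vmode α (i : ℤ) w)),
    fun i => ?_, fun i => ?_, ?_⟩
  · refine pow_smul_of_eq_neg ?_ (shift_fst_pow_apply i _)
    rw [end_sub_comm, shift_add_sub_snd]
  · rw [end_sub_zero]
    exact shift_snd_pow_apply i _
  refine seriesSpace.ext fun a b => ?_
  obtain ⟨n₁, hn₁⟩ := Q.YABC.coef_truncation κ.1 b (Q.YAB.coef κ.2 a v u) w
  set M := max n₁ (max N L') with hM
  have key1 := Q.YAB.coef_vmode_neg_right α 0 κ.2 a v u hL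
  have key2 := Q.YABC.coef_vmode_neg_left α 0 κ.1 b (Q.YAB.coef κ.2 a v u) w (M := M)
    (fun i hi => hn₁ i (by omega)) (fun i hi => hL' i (by omega))
  simp only [Nat.cast_zero, sub_zero, add_zero, Nat.choose_self, Nat.cast_one, one_smul,
    pow_zero, mul_one] at key1 key2
  simp only [coe_add_apply, coe_sum_apply, shift_pow, shift_apply, series_dualShift]
  rw [series_apply, key1, map_sub, LinearMap.sub_apply, key2, map_sub, map_sum, map_sum,
    LinearMap.sum_apply, map_sum, sub_eq_add_neg, ← Finset.sum_neg_distrib]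
  simp only [map_add, Finset.sum_add_distrib]
  rw [add_right_comm]
  congr 1
  · congr 1
    · rw [← Finset.eventually_constant_sum (N := N) (n := M) (fun j hj => ?_) (by omega)]
      · refine Finset.sum_congr rfl fun j _ => ?_
        push_cast
        simp
      · have := LinearMap.congr_fun (congrArg Subtype.val (Q.ABC.dualShift_eq_zero hn hα θ hj))
        exact this _
    · refine Finset.sum_congr rfl fun i _ => ?_
      rw [coe_smul_apply, shift_apply, series_apply, map_smul, LinearMap.smul_apply, map_smul,
        smul_eq_mul, pow_succ]
      push_cast
      ring_nf
  · rw [← Finset.eventually_constant_sum (N := L') (n := M) (fun j hj => ?_) (by omega)]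
    · refine Finset.sum_congr rfl fun j _ => ?_
      exact apply_congr (Q.series hA hB hC κ θ v u (vmode α (j : ℤ) w)) (by push_cast; ring)
        (by push_cast; ring)
    · rw [hL' j hj, series_apply]
      simp

/-- The commutator at `y` leaves `αᵢ` acting on `𝒴(v, x - y) u`. Distributing it over `v` and `u`
gives powers of `(0 - x)⁻¹`, expanded in `(x - y) / y`, and of `(0 - y)⁻¹`. -/
theorem wardIdentity_C :
    WardIdentity (fun κ θ (w : C) (v : A) (u : B) => Q.series hA hB hC (N := N) κ θ v u w)
      0 (shift 1 0 + shift 0 1) (shift 0 1) := by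
  intro κ θ w v u n hn α hα L L' hL hL'
  refine ⟨1, Q.ABC.dualShift hn hα θ,
    fun i => (-1 : ℂ) ^ (i + 1) •
      divPow (-1) i (Q.series hA hB hC κ θ (vmode α (i : ℤ) v) u w),
    fun i => (-1 : ℂ) ^ (i + 1) •
      shift 0 (-1 - i) (Q.series hA hB hC κ θ v (vmode α (i : ℤ) u) w),
    fun i => pow_smul_of_eq_neg (end_zero_sub _) ?_,
    fun i => pow_smul_of_eq_neg (end_zero_sub _) (shift_snd_pow_apply i _), ?_⟩
  · rw [shift_add_eq]
    exact sub_pow_divPow (-1) i _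
  refine seriesSpace.ext fun a b => ?_
  obtain ⟨n₁, hn₁⟩ := exists_vmode_eq_zero α (Q.YAB.coef κ.2 a v u)
  have hJ : ∀ i : ℕ, ∃ J : ℕ, ∀ j : ℕ, J ≤ j → ∀ b,
      (Q.series hA hB hC κ θ (vmode α (i : ℤ) v) u w).1 (a - j) b = 0 :=
    fun i => (Q.series hA hB hC κ θ (vmode α (i : ℤ) v) u w).2.2 a
  choose J hJ using hJ
  set M := max (max n₁ L') (L + (Finset.range L).sup J) with hM
  have hMJ : ∀ i ∈ Finset.range L, i + J i ≤ M := fun i hi => by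
    have := Finset.le_sup (f := J) hi
    rw [Finset.mem_range] at hi
    omega
  have key := Q.YABC.coef_vmode_neg_right α 0 κ.1 b (Q.YAB.coef κ.2 a v u) w (L := M)
    (fun i hi => hn₁ i (by omega))
  simp only [Nat.cast_zero, sub_zero, add_zero, Nat.choose_self, Nat.cast_one, mul_one] at key
  simp only [coe_add_apply, coe_sum_apply, Finset.sum_range_one, pow_zero, Module.End.one_apply,
    series_dualShift]
  rw [series_apply, key, map_sub, map_sum, Nat.cast_zero, sub_zero, sub_eq_add_neg,
    ← Finset.sum_neg_distrib, add_assoc]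
  congr 1
  have h3 : ∀ i ∈ Finset.range M, -θ.1 ((-1 : ℂ) ^ i • Q.YABC.coef κ.1 (b + 1 + i)
      (vmode α (i : ℤ) (Q.YAB.coef κ.2 a v u)) w) =
      (-1 : ℂ) ^ (i + 1) * (Q.series hA hB hC κ θ v (vmode α (i : ℤ) u) w).1 a (b + 1 + i) +
      ∑ r ∈ Finset.range L, (i.choose r : ℂ) * ((-1 : ℂ) ^ (i + 1) *
        (Q.series hA hB hC κ θ (vmode α (r : ℤ) v) u w).1 (a - i + r) (b + 1 + i)) := by
    intro i _
    rw [Q.YAB.vmode_nat_coef α i κ.2 a v u hL]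
    simp only [map_add, map_sum, map_smul, LinearMap.add_apply, LinearMap.sum_apply,
      LinearMap.smul_apply, smul_eq_mul, series_apply, pow_succ, mul_add, neg_add,
      Finset.mul_sum, ← Finset.sum_neg_distrib]
    congr 1
    · ring
    · exact Finset.sum_congr rfl fun r _ => by ring
  rw [Finset.sum_congr rfl h3, Finset.sum_add_distrib, add_comm]
  congr 1
  · rw [Finset.sum_comm]
    refine Finset.sum_congr rfl fun r hr => ?_
    rw [sum_range_choose_mul (hMJ r hr) (fun i => (-1 : ℂ) ^ (i + 1) *
      (Q.series hA hB hC κ θ (vmode α (r : ℤ) v) u w).1 (a - i + r) (b + 1 + i)),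
      coe_smul_apply, divPow_apply (-1) r _ (hJ r), Finset.mul_sum]
    · refine Finset.sum_congr rfl fun j _ => ?_
      rw [show a - ((r + j : ℕ) : ℂ) + r = a - j by push_cast; ring,
        show b + 1 + ((r + j : ℕ) : ℂ) = b + 1 + r + j by push_cast; ring]
      ring
    · intro j hj
      rw [show a - ((r + j : ℕ) : ℂ) + r = a - j by push_cast; ring, hJ r j hj, mul_zero]
  · rw [← Finset.eventually_constant_sum (N := L') (n := M) (fun j hj => ?_) (by omega)]
    · refine Finset.sum_congr rfl fun j _ => ?_
      rw [coe_smul_apply, shift_apply]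
      congr 1
      exact apply_congr _ (by push_cast; ring) (by push_cast; ring)
    · rw [hL' j hj, coe_smul_apply, shift_apply, series_apply]
      simp

theorem series_conf_A (h k : ℕ) (θ : Q.ABC.dualLE N) (v : A) (u : B) (w : C) :
    Q.series hA hB hC (h, k) θ (vmode (conf : V) 0 v) u w =
      derivFst (Q.series hA hB hC (h, k) θ v u w) +
        ((k : ℂ) + 1) • shift (-1) 0 (Q.series hA hB hC (h, k + 1) θ v u w) := by
  refine seriesSpace.ext fun a b => ?_
  rw [coe_add_apply, coe_smul_apply, derivFst_apply, shift_apply]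
  simp only [series_apply, Q.YAB.coef_conf, map_add, map_smul, smul_eq_mul, LinearMap.add_apply,
    LinearMap.smul_apply]
  simp

/-- `L(-1)` on the inner product is the derivative in `y` at fixed `x - y`, and it acts on `v` and
`u` by the Leibniz rule. -/
theorem series_conf_B (h k : ℕ) (θ : Q.ABC.dualLE N) (v : A) (u : B) (w : C) :
    Q.series hA hB hC (h, k) θ v (vmode (conf : V) 0 u) w =
      derivSnd (Q.series hA hB hC (h, k) θ v u w) +
        ((h : ℂ) + 1) • shift 0 (-1) (Q.series hA hB hC (h + 1, k) θ v u w) -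
      Q.series hA hB hC (h, k) θ (vmode (conf : V) 0 v) u w := by
  refine seriesSpace.ext fun a b => ?_
  rw [coe_sub_apply, coe_add_apply, coe_smul_apply, derivSnd_apply, shift_apply]
  obtain ⟨L, hL⟩ := exists_vmode_eq_zero (conf : V) v
  -- `L + 1` ensures that the range contains `i = 0`, the only index with `choose 0 i ≠ 0`.
  have h1 := Q.YAB.vmode_nat_coef (conf : V) 0 k a v u (L := L + 1) fun i hi => hL i (by omega)
  rw [Finset.sum_range_succ', Finset.sum_eq_zero (fun i _ => by simp)] at h1
  simp only [Nat.cast_zero, Nat.choose_self, Nat.cast_one, one_smul, zero_add, sub_zero,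
    add_zero] at h1
  rw [← sub_eq_iff_eq_add] at h1
  simp only [series_apply]
  rw [← h1, map_sub, LinearMap.sub_apply, map_sub, Q.YABC.coef_conf]
  simp

theorem series_eq_zero {h k : ℕ} (hk : Q.YABC.K < h ∨ Q.YAB.K < k) (θ : Q.ABC.dualLE N) (v : A)
    (u : B) (w : C) : Q.series hA hB hC (h, k) θ v u w = 0 := by
  refine seriesSpace.ext fun a b => ?_
  rw [series_apply, coe_zero_apply]
  rcases hk with hk | hk <;> simp [LogIntertwiningOperator.coef_eq_zero _ hk]

theorem isLinearMap_series_θ (κ : ℕ × ℕ) (v : A) (u : B) (w : C) :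
    IsLinearMap ℂ fun θ : Q.ABC.dualLE N => Q.series hA hB hC κ θ v u w :=
  ⟨fun _ _ => rfl, fun _ _ => rfl⟩

theorem isLinearMap_series_A (κ : ℕ × ℕ) (θ : Q.ABC.dualLE N) (u : B) (w : C) :
    IsLinearMap ℂ fun v => Q.series hA hB hC κ θ v u w :=
  ⟨fun _ _ => seriesSpace.ext fun _ _ => by simp [series_apply],
    fun _ _ => seriesSpace.ext fun _ _ => by simp [series_apply]⟩

theorem isLinearMap_series_B (κ : ℕ × ℕ) (θ : Q.ABC.dualLE N) (v : A) (w : C) :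
    IsLinearMap ℂ fun u => Q.series hA hB hC κ θ v u w :=
  ⟨fun _ _ => seriesSpace.ext fun _ _ => by simp [series_apply],
    fun _ _ => seriesSpace.ext fun _ _ => by simp [series_apply]⟩

theorem isLinearMap_series_C (κ : ℕ × ℕ) (θ : Q.ABC.dualLE N) (v : A) (u : B) :
    IsLinearMap ℂ fun w => Q.series hA hB hC κ θ v u w :=
  ⟨fun _ _ => seriesSpace.ext fun _ _ => by simp [series_apply],
    fun _ _ => seriesSpace.ext fun _ _ => by simp [series_apply]⟩

end LeftFusion

/-! ## The four systems -/

section LogMatrices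

variable {K₁ K₂ : ℕ} {R : Type*} [Zero R]

/-- The matrix raising the first component of the index. -/
def nextFst (a : Fin (K₁ + 1) × Fin (K₂ + 1) → R) :
    Matrix (Fin (K₁ + 1) × Fin (K₂ + 1)) (Fin (K₁ + 1) × Fin (K₂ + 1)) R :=
  Matrix.of fun k k' => if (k'.1 : ℕ) = k.1 + 1 ∧ k'.2 = k.2 then a k else 0

/-- The matrix raising the second component of the index. -/
def nextSnd (a : Fin (K₁ + 1) × Fin (K₂ + 1) → R) :
    Matrix (Fin (K₁ + 1) × Fin (K₂ + 1)) (Fin (K₁ + 1) × Fin (K₂ + 1)) R :=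
  Matrix.of fun k k' => if k'.1 = k.1 ∧ (k'.2 : ℕ) = k.2 + 1 then a k else 0

/-- The last index has no successor; this does no harm because the function there, of logarithmic
power beyond the bound, is zero. -/
theorem sum_nextFst {M : Type*} [AddCommMonoid M] (a : Fin (K₁ + 1) × Fin (K₂ + 1) → R)
    (g : R → ℕ → ℕ → M) (h0 : ∀ h k, g 0 h k = 0) (hg : ∀ r k, g r (K₁ + 1) k = 0)
    (k : Fin (K₁ + 1) × Fin (K₂ + 1)) :
    ∑ k' : Fin (K₁ + 1) × Fin (K₂ + 1), g (nextFst a k k') k'.1 k'.2 = g (a k) (k.1 + 1) k.2 := by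
  rcases Nat.lt_or_ge (k.1 + 1 : ℕ) (K₁ + 1) with h | h
  · rw [Finset.sum_eq_single (⟨k.1 + 1, h⟩, k.2)]
    · simp [nextFst]
    · rintro ⟨k₁, k₂⟩ _ hk
      rw [nextFst, Matrix.of_apply, if_neg, h0]
      rintro ⟨h1, h2⟩
      exact hk (Prod.ext (Fin.ext h1) h2)
    · simp
  · rw [show (k.1 + 1 : ℕ) = K₁ + 1 by have := k.1.2; omega, hg]
    refine Finset.sum_eq_zero fun k' _ => ?_
    rw [nextFst, Matrix.of_apply, if_neg, h0]
    rintro ⟨h1, -⟩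
    have := k'.1.2
    omega

theorem sum_nextSnd {M : Type*} [AddCommMonoid M] (a : Fin (K₁ + 1) × Fin (K₂ + 1) → R)
    (g : R → ℕ → ℕ → M) (h0 : ∀ h k, g 0 h k = 0) (hg : ∀ r h, g r h (K₂ + 1) = 0)
    (k : Fin (K₁ + 1) × Fin (K₂ + 1)) :
    ∑ k' : Fin (K₁ + 1) × Fin (K₂ + 1), g (nextSnd a k k') k'.1 k'.2 = g (a k) k.1 (k.2 + 1) := by
  rcases Nat.lt_or_ge (k.2 + 1 : ℕ) (K₂ + 1) with h | h
  · rw [Finset.sum_eq_single (k.1, ⟨k.2 + 1, h⟩)]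
    · simp [nextSnd]
    · rintro ⟨k₁, k₂⟩ _ hk
      rw [nextSnd, Matrix.of_apply, if_neg, h0]
      rintro ⟨h1, h2⟩
      exact hk (Prod.ext h1 (Fin.ext h2))
    · simp
  · rw [show (k.2 + 1 : ℕ) = K₂ + 1 by have := k.2.2; omega, hg]
    refine Finset.sum_eq_zero fun k' _ => ?_
    rw [nextSnd, Matrix.of_apply, if_neg, h0]
    rintro ⟨-, h1⟩
    have := k'.2.2
    omega

theorem nextFst_ne_zero {a : Fin (K₁ + 1) × Fin (K₂ + 1) → R} {k k' : Fin (K₁ + 1) × Fin (K₂ + 1)}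
    (h : nextFst a k k' ≠ 0) : (k.1 : ℕ) < k'.1 := by
  by_contra h'
  exact h (if_neg fun h'' => h' (by omega))

theorem nextSnd_ne_zero {a : Fin (K₁ + 1) × Fin (K₂ + 1) → R} {k k' : Fin (K₁ + 1) × Fin (K₂ + 1)}
    (h : nextSnd a k k' ≠ 0) : (k.2 : ℕ) < k'.2 := by
  by_contra h'
  exact h (if_neg fun h'' => h' (by omega))

end LogMatrices

section Systems

open LaurentPolynomial seriesSpace

theorem isUnit_C_exp (ℓ : ℂ) : IsUnit (C (Complex.exp ℓ) : ℂ[T;T⁻¹]) :=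
  (isUnit_iff_ne_zero.2 (Complex.exp_ne_zero ℓ)).map C

theorem shift_fst_cancel (H : seriesSpace) : shift 1 0 (shift (-1) 0 H) = H :=
  seriesSpace.ext fun a b => by simp

theorem shift_snd_cancel (H : seriesSpace) : shift 0 1 (shift 0 (-1) H) = H :=
  seriesSpace.ext fun a b => by simp

theorem expansionAct_T_one_apply (ℓ ε : ℂ) (f : truncatedSeries) :
    truncatedSeries.expansionAct (Complex.exp ℓ) ε (Complex.exp_ne_zero ℓ) (T 1) f =
      Complex.exp ℓ • f + ε • truncatedSeries.shift f := by
  rw [truncatedSeries.expansionAct_T_one]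
  rfl

theorem expansionAct_C_apply (ℓ ε a : ℂ) (f : truncatedSeries) :
    truncatedSeries.expansionAct (Complex.exp ℓ) ε (Complex.exp_ne_zero ℓ) (C a) f = a • f := by
  rw [truncatedSeries.expansionAct_C]
  rfl

theorem laurentAct_T_one_evalFst (ℓ : ℂ) (H : seriesSpace) :
    FormalSeries.laurentAct (T 1) (evalFst ℓ H) = evalFst ℓ (shift 0 1 H) := by
  ext e
  rw [FormalSeries.laurentAct_T, evalFst_shift_snd, Int.cast_one]

theorem laurentAct_T_neg_one_evalFst (ℓ : ℂ) (H : seriesSpace) :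
    FormalSeries.laurentAct (T (-1)) (evalFst ℓ H) = evalFst ℓ (shift 0 (-1) H) := by
  ext e
  have h := evalFst_shift_snd ℓ (shift 0 (-1) H) (e + 1)
  rw [shift_snd_cancel, add_sub_cancel_right] at h
  rw [FormalSeries.laurentAct_T, ← h]
  simp

theorem laurentAct_T_neg_one_evalSum (ℓ : ℂ) (H : seriesSpace) :
    FormalSeries.laurentAct (T (-1)) (evalSum ℓ H) = evalSum ℓ (shift (-1) 0 H) := by
  ext e
  have h := evalSum_shift_fst ℓ (shift (-1) 0 H) (e + 1)
  rw [shift_fst_cancel, add_sub_cancel_right] at h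
  rw [FormalSeries.laurentAct_T, ← h]
  simp

theorem laurentAct_T_one_evalSum (ℓ : ℂ) (H : seriesSpace) :
    FormalSeries.laurentAct (T 1) (evalSum ℓ H) = evalSum ℓ (shift 1 0 H) := by
  ext e
  rw [FormalSeries.laurentAct_T, evalSum_shift_fst, Int.cast_one]

theorem laurentAct_sub_T_one_evalSum (ℓ : ℂ) (H : seriesSpace) :
    FormalSeries.laurentAct (C (Complex.exp ℓ) - T 1) (evalSum ℓ H) = evalSum ℓ (shift 0 1 H) := by
  rw [map_sub, LinearMap.sub_apply, FormalSeries.laurentAct_C]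
  ext e
  rw [evalSum_shift_snd, Pi.sub_apply, Pi.smul_apply, smul_eq_mul, FormalSeries.laurentAct_T,
    Int.cast_one]

variable {V : Type v} [AddCommGroup V] [Module ℂ V] [VertexOperatorAlgebra V]
  {A B C : NGradedModule.{v, u} V} (hA : A.C1Cofinite) (hB : B.C1Cofinite) (hC : C.C1Cofinite)
  (ℓ : ℂ) (N : ℕ)

theorem WardIdentity.reindex {W P Q S : NGradedModule.{v, u} V} {N : ℕ} {κ κ' : Type} {M : Type*}
    [AddCommGroup M] [Module ℂ M] {Φ : κ → W.dualLE N → P → Q → S → M} {x y z : Module.End ℂ M}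
    (h : WardIdentity Φ x y z) (g : κ' → κ) : WardIdentity (fun k => Φ (g k)) x y z :=
  fun k => h (g k)

/-- Pairs of indices as pairs of natural numbers. -/
abbrev natPair (m n : ℕ) (k : Fin m × Fin n) : ℕ × ℕ := (k.1, k.2)

/-- The system in `y` for `A ⊠ (B ⊠ C)`. -/
def RightFusion.wardSystemY (P : RightFusion A B C) :
    WardSystem P.ABC B C A N (Fin (P.YABC.K + 1) × Fin (P.YBC.K + 1)) truncatedSeries
      (truncatedSeries.expansionAct (Complex.exp ℓ) (-1) (Complex.exp_ne_zero ℓ)) where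
  Φ k θ u w v := evalSndTruncated ℓ (P.series hA hB hC (k.1, k.2) θ v u w)
  lin_θ k u w v := ((evalSndTruncated ℓ) ∘ₗ (P.isLinearMap_series_θ hA hB hC _ v u w).mk').isLinear
  lin_p k θ w v := ((evalSndTruncated ℓ) ∘ₗ (P.isLinearMap_series_B hA hB hC _ θ v w).mk').isLinear
  lin_q k θ u v := ((evalSndTruncated ℓ) ∘ₗ (P.isLinearMap_series_C hA hB hC _ θ v u).mk').isLinear
  lin_s k θ u w := ((evalSndTruncated ℓ) ∘ₗ (P.isLinearMap_series_A hA hB hC _ θ u w).mk').isLinear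
  -- The Laurent variable is `x₀ - y`, so that Laurent polynomials are `ℂ[y, (x₀ - y)⁻¹]`; the
  -- series themselves are in powers of `y = t`.
  zp := LaurentPolynomial.C (Complex.exp ℓ) - T 1
  zq := 0
  zs := LaurentPolynomial.C (Complex.exp ℓ)
  t := LaurentPolynomial.C (Complex.exp ℓ) - T 1
  t_eq := sub_zero _
  isUnit_ps := by
    rw [sub_sub_cancel_left]
    exact (isUnit_T 1).neg
  isUnit_qs := by
    rw [zero_sub]
    exact (isUnit_C_exp ℓ).neg
  ward_p := ((P.wardIdentity_B hA hB hC).swap.reindex (natPair _ _)).comp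
    (evalSndTruncated ℓ)
    (fun m => by
      rw [map_sub, LinearMap.sub_apply, expansionAct_C_apply, expansionAct_T_one_apply,
        evalSndTruncated_shift_fst]
      module)
    (fun m => by simp)
    (fun m => by rw [expansionAct_C_apply, evalSndTruncated_shift_snd])
  ward_q := ((P.wardIdentity_C hA hB hC).swap.reindex (natPair _ _)).comp
    (evalSndTruncated ℓ)
    (fun m => by simp)
    (fun m => by
      rw [map_sub, LinearMap.sub_apply, expansionAct_C_apply, expansionAct_T_one_apply,
        evalSndTruncated_shift_fst]
      module)
    (fun m => by rw [expansionAct_C_apply, evalSndTruncated_shift_snd])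
  ward_s := ((P.wardIdentity_A hA hB hC).reindex (natPair _ _)).comp
    (evalSndTruncated ℓ)
    (fun m => by rw [expansionAct_C_apply, evalSndTruncated_shift_snd])
    (fun m => by
      rw [map_sub, LinearMap.sub_apply, expansionAct_C_apply, expansionAct_T_one_apply,
        evalSndTruncated_shift_fst]
      module)
    (fun m => by simp)
  δ := truncatedSeries.euler
  δ_t m := by
    rw [map_sub, LinearMap.sub_apply, LinearMap.sub_apply, expansionAct_C_apply,
      expansionAct_T_one_apply, expansionAct_C_apply, expansionAct_T_one_apply]
    have := truncatedSeries.euler_shift m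
    simp only [map_sub, map_add, map_smul, this]
    module
  -- `F_{h,k}` is a coefficient of `log^k y`, so `L(-1) u` equals its derivative plus `(k + 1) / y`
  -- times the coefficient with `k + 1`; solving for the derivative gives the sign. The other
  -- logarithm, `log x₀`, is constant, hence `l = 0`.
  n := nextSnd fun k => -((k.2 : ℂ) + 1)
  rank k := k.2
  rank_lt _ _ h := nextSnd_ne_zero h
  l := 0
  δ_Φ k θ u w v := by
    rw [sum_nextSnd _ (fun r h k => r • evalSndTruncated ℓ (P.series hA hB hC (h, k) θ v u w))
      (fun _ _ => zero_smul _ _) (fun r h => by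
        rw [P.series_eq_zero hA hB hC (Or.inr (Nat.lt_succ_self _)), map_zero, smul_zero])]
    simp only [Matrix.zero_apply, mul_zero, map_zero, LinearMap.zero_apply, Finset.sum_const_zero,
      add_zero]
    rw [map_sub, LinearMap.sub_apply, expansionAct_C_apply, expansionAct_T_one_apply,
      P.series_conf_B, map_add, map_smul, ← shift_evalSndTruncated_derivFst, map_add, map_smul,
      ← evalSndTruncated_shift_fst ℓ (shift (-1) 0 _), shift_fst_cancel]
    module

/-- The system in `x` for `(A ⊠ B) ⊠ C`. -/
def LeftFusion.wardSystemX (Q : LeftFusion A B C) :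
    WardSystem Q.ABC A B C N (Fin (Q.YABC.K + 1) × Fin (Q.YAB.K + 1)) truncatedSeries
      (truncatedSeries.expansionAct (Complex.exp ℓ) 1 (Complex.exp_ne_zero ℓ)) where
  Φ k θ v u w := evalSndTruncated ℓ (Q.series hA hB hC (k.1, k.2) θ v u w)
  lin_θ k v u w := ((evalSndTruncated ℓ) ∘ₗ (Q.isLinearMap_series_θ hA hB hC _ v u w).mk').isLinear
  lin_p k θ u w := ((evalSndTruncated ℓ) ∘ₗ (Q.isLinearMap_series_A hA hB hC _ θ u w).mk').isLinear
  lin_q k θ v w := ((evalSndTruncated ℓ) ∘ₗ (Q.isLinearMap_series_B hA hB hC _ θ v w).mk').isLinear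
  lin_s k θ v u := ((evalSndTruncated ℓ) ∘ₗ (Q.isLinearMap_series_C hA hB hC _ θ v u).mk').isLinear
  -- The Laurent variable is `x`, which is expanded as `y₀ + t`.
  zp := T 1
  zq := LaurentPolynomial.C (Complex.exp ℓ)
  zs := 0
  t := T 1 - LaurentPolynomial.C (Complex.exp ℓ)
  t_eq := rfl
  isUnit_ps := by
    rw [sub_zero]
    exact isUnit_T 1
  isUnit_qs := by
    rw [sub_zero]
    exact isUnit_C_exp ℓ
  ward_p := ((Q.wardIdentity_A hA hB hC).reindex (natPair _ _)).comp (evalSndTruncated ℓ)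
    (fun m => by
      rw [expansionAct_T_one_apply, LinearMap.add_apply, map_add, evalSndTruncated_shift_fst,
        evalSndTruncated_shift_snd]
      module)
    (fun m => by rw [expansionAct_C_apply, evalSndTruncated_shift_snd])
    (fun m => by simp)
  ward_q := ((Q.wardIdentity_B hA hB hC).reindex (natPair _ _)).comp (evalSndTruncated ℓ)
    (fun m => by rw [expansionAct_C_apply, evalSndTruncated_shift_snd])
    (fun m => by
      rw [expansionAct_T_one_apply, LinearMap.add_apply, map_add, evalSndTruncated_shift_fst,
        evalSndTruncated_shift_snd]
      module)
    (fun m => by simp)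
  ward_s := ((Q.wardIdentity_C hA hB hC).reindex (natPair _ _)).comp (evalSndTruncated ℓ)
    (fun m => by simp)
    (fun m => by
      rw [expansionAct_T_one_apply, LinearMap.add_apply, map_add, evalSndTruncated_shift_fst,
        evalSndTruncated_shift_snd]
      module)
    (fun m => by rw [expansionAct_C_apply, evalSndTruncated_shift_snd])
  δ := truncatedSeries.euler
  δ_t m := by
    rw [map_sub, LinearMap.sub_apply, LinearMap.sub_apply, expansionAct_C_apply,
      expansionAct_T_one_apply, expansionAct_C_apply, expansionAct_T_one_apply]
    have := truncatedSeries.euler_shift m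
    simp only [map_sub, map_add, map_smul, this]
    module
  n := nextSnd fun k => -((k.2 : ℂ) + 1)
  rank k := k.2
  rank_lt _ _ h := nextSnd_ne_zero h
  l := 0
  δ_Φ k θ v u w := by
    rw [sum_nextSnd _ (fun r h k => r • evalSndTruncated ℓ (Q.series hA hB hC (h, k) θ v u w))
      (fun _ _ => zero_smul _ _) (fun r h => by
        rw [Q.series_eq_zero hA hB hC (Or.inr (Nat.lt_succ_self _)), map_zero, smul_zero])]
    simp only [Matrix.zero_apply, mul_zero, map_zero, LinearMap.zero_apply, Finset.sum_const_zero,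
      add_zero]
    rw [map_sub, LinearMap.sub_apply, expansionAct_C_apply, expansionAct_T_one_apply,
      Q.series_conf_A, map_add, map_smul, ← shift_evalSndTruncated_derivFst, map_add, map_smul,
      ← evalSndTruncated_shift_fst ℓ (shift (-1) 0 _), shift_fst_cancel]
    module

/-- The system in `x` for `A ⊠ (B ⊠ C)`. -/
def RightFusion.wardSystemX (P : RightFusion A B C) :
    WardSystem P.ABC A B C N (Fin (P.YABC.K + 1) × Fin (P.YBC.K + 1)) FormalSeries
      FormalSeries.laurentAct where
  Φ k θ v u w := evalFst ℓ (P.series hA hB hC (k.1, k.2) θ v u w)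
  lin_θ k v u w := ((evalFst ℓ) ∘ₗ (P.isLinearMap_series_θ hA hB hC _ v u w).mk').isLinear
  lin_p k θ u w := ((evalFst ℓ) ∘ₗ (P.isLinearMap_series_A hA hB hC _ θ u w).mk').isLinear
  lin_q k θ v w := ((evalFst ℓ) ∘ₗ (P.isLinearMap_series_B hA hB hC _ θ v w).mk').isLinear
  lin_s k θ v u := ((evalFst ℓ) ∘ₗ (P.isLinearMap_series_C hA hB hC _ θ v u).mk').isLinear
  zp := T 1
  zq := LaurentPolynomial.C (Complex.exp ℓ)
  zs := 0
  t := T 1 - LaurentPolynomial.C (Complex.exp ℓ)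
  t_eq := rfl
  isUnit_ps := by
    rw [sub_zero]
    exact isUnit_T 1
  isUnit_qs := by
    rw [sub_zero]
    exact isUnit_C_exp ℓ
  ward_p := ((P.wardIdentity_A hA hB hC).reindex (natPair _ _)).comp (evalFst ℓ)
    (fun m => (laurentAct_T_one_evalFst ℓ m).symm)
    (fun m => by rw [FormalSeries.laurentAct_C, evalFst_shift_fst])
    (fun m => by simp)
  ward_q := ((P.wardIdentity_B hA hB hC).reindex (natPair _ _)).comp (evalFst ℓ)
    (fun m => by rw [FormalSeries.laurentAct_C, evalFst_shift_fst])
    (fun m => (laurentAct_T_one_evalFst ℓ m).symm)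
    (fun m => by simp)
  ward_s := ((P.wardIdentity_C hA hB hC).reindex (natPair _ _)).comp (evalFst ℓ)
    (fun m => by simp)
    (fun m => (laurentAct_T_one_evalFst ℓ m).symm)
    (fun m => by rw [FormalSeries.laurentAct_C, evalFst_shift_fst])
  δ := FormalSeries.laurentAct (T 1 - LaurentPolynomial.C (Complex.exp ℓ)) ∘ₗ FormalSeries.derivOp
  δ_t m := by
    rw [LinearMap.comp_apply, LinearMap.comp_apply, ← map_add]
    congr 1
    rw [map_sub, LinearMap.sub_apply, LinearMap.sub_apply, FormalSeries.laurentAct_C,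
      FormalSeries.laurentAct_C, map_sub, map_smul, FormalSeries.derivOp_T]
    abel
  -- The logarithm here is that of `x`, regular at `x = y₀`. It contributes only through `l`, with a
  -- factor `t`, and does not affect the residue.
  n := 0
  rank _ := 0
  rank_lt _ _ h := absurd rfl h
  l := nextFst fun k => -LaurentPolynomial.C ((k.1 : ℂ) + 1) * T (-1)
  δ_Φ k θ v u w := by
    rw [sum_nextFst _ (fun r h k => FormalSeries.laurentAct
      ((T 1 - LaurentPolynomial.C (Complex.exp ℓ)) * r)
        (evalFst ℓ (P.series hA hB hC (h, k) θ v u w)))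
      (fun _ _ => by simp) (fun r h => by
        rw [P.series_eq_zero hA hB hC (Or.inl (Nat.lt_succ_self _)), map_zero, map_zero])]
    simp only [Matrix.zero_apply, zero_smul, Finset.sum_const_zero, add_zero]
    rw [map_mul, Module.End.mul_apply, ← map_add, LinearMap.comp_apply]
    congr 1
    rw [P.series_conf_A, map_add, map_smul, evalFst_derivSnd, ← laurentAct_T_neg_one_evalFst,
      map_mul, map_neg,
      Module.End.mul_apply, LinearMap.neg_apply, FormalSeries.laurentAct_C, add_neg_cancel_right]
    rfl

/-- The system in `y` for `(A ⊠ B) ⊠ C`. -/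
def LeftFusion.wardSystemY (Q : LeftFusion A B C) :
    WardSystem Q.ABC B C A N (Fin (Q.YABC.K + 1) × Fin (Q.YAB.K + 1)) FormalSeries
      FormalSeries.laurentAct where
  Φ k θ u w v := evalSum ℓ (Q.series hA hB hC (k.1, k.2) θ v u w)
  lin_θ k u w v := ((evalSum ℓ) ∘ₗ (Q.isLinearMap_series_θ hA hB hC _ v u w).mk').isLinear
  lin_p k θ w v := ((evalSum ℓ) ∘ₗ (Q.isLinearMap_series_B hA hB hC _ θ v w).mk').isLinear
  lin_q k θ u v := ((evalSum ℓ) ∘ₗ (Q.isLinearMap_series_C hA hB hC _ θ v u).mk').isLinear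
  lin_s k θ u w := ((evalSum ℓ) ∘ₗ (Q.isLinearMap_series_A hA hB hC _ θ u w).mk').isLinear
  zp := LaurentPolynomial.C (Complex.exp ℓ) - T 1
  zq := 0
  zs := LaurentPolynomial.C (Complex.exp ℓ)
  t := LaurentPolynomial.C (Complex.exp ℓ) - T 1
  t_eq := sub_zero _
  isUnit_ps := by
    rw [sub_sub_cancel_left]
    exact (isUnit_T 1).neg
  isUnit_qs := by
    rw [zero_sub]
    exact (isUnit_C_exp ℓ).neg
  ward_p := ((Q.wardIdentity_B hA hB hC).swap.reindex (natPair _ _)).comp (evalSum ℓ)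
    (fun m => (laurentAct_sub_T_one_evalSum ℓ m).symm)
    (fun m => by simp)
    (fun m => by
      rw [LinearMap.add_apply, map_add, ← laurentAct_T_one_evalSum, ← laurentAct_sub_T_one_evalSum,
        ← LinearMap.add_apply, ← map_add, add_sub_cancel])
  ward_q := ((Q.wardIdentity_C hA hB hC).swap.reindex (natPair _ _)).comp (evalSum ℓ)
    (fun m => by simp)
    (fun m => (laurentAct_sub_T_one_evalSum ℓ m).symm)
    (fun m => by
      rw [LinearMap.add_apply, map_add, ← laurentAct_T_one_evalSum, ← laurentAct_sub_T_one_evalSum,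
        ← LinearMap.add_apply, ← map_add, add_sub_cancel])
  ward_s := ((Q.wardIdentity_A hA hB hC).reindex (natPair _ _)).comp (evalSum ℓ)
    (fun m => by
      rw [LinearMap.add_apply, map_add, ← laurentAct_T_one_evalSum, ← laurentAct_sub_T_one_evalSum,
        ← LinearMap.add_apply, ← map_add, add_sub_cancel])
    (fun m => (laurentAct_sub_T_one_evalSum ℓ m).symm)
    (fun m => by simp)
  -- In the variable `T = x₀ - y` the derivation `y d/dy` is `(T - x₀) d/dT`.
  δ := FormalSeries.laurentAct (T 1 - LaurentPolynomial.C (Complex.exp ℓ)) ∘ₗ FormalSeries.derivOp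
  δ_t m := by
    rw [LinearMap.comp_apply, LinearMap.comp_apply,
      ← neg_sub (LaurentPolynomial.C (Complex.exp ℓ)) (T 1), map_neg, LinearMap.neg_apply,
      LinearMap.neg_apply, map_neg, ← sub_eq_add_neg, ← map_sub, ← map_neg]
    congr 1
    rw [map_sub, LinearMap.sub_apply, LinearMap.sub_apply, FormalSeries.laurentAct_C,
      FormalSeries.laurentAct_C, map_sub, map_smul, FormalSeries.derivOp_T]
    abel
  -- Here `log y` is the logarithm of the outer operator, while the inner one, `log (x₀ - y)`, is
  -- regular at `y = 0` and enters through `l`, with positive sign because `d(x₀ - y)/dy = -1`.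
  n := nextFst fun k => -((k.1 : ℂ) + 1)
  rank k := k.1
  rank_lt _ _ h := nextFst_ne_zero h
  l := nextSnd fun k => LaurentPolynomial.C ((k.2 : ℂ) + 1) * T (-1)
  δ_Φ k θ u w v := by
    rw [sum_nextFst _ (fun r h k => r • evalSum ℓ (Q.series hA hB hC (h, k) θ v u w))
      (fun _ _ => zero_smul _ _) (fun r h => by
        rw [Q.series_eq_zero hA hB hC (Or.inl (Nat.lt_succ_self _)), map_zero, smul_zero]),
      sum_nextSnd _ (fun r h k => FormalSeries.laurentAct
      ((LaurentPolynomial.C (Complex.exp ℓ) - T 1) * r)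
        (evalSum ℓ (Q.series hA hB hC (h, k) θ v u w)))
      (fun _ _ => by simp) (fun r h => by
        rw [Q.series_eq_zero hA hB hC (Or.inr (Nat.lt_succ_self _)), map_zero, map_zero])]
    have h2 : FormalSeries.laurentAct (LaurentPolynomial.C (Complex.exp ℓ) - T 1)
        (evalSum ℓ (shift 0 (-1) (Q.series hA hB hC (k.1 + 1, k.2) θ v u w))) =
        evalSum ℓ (Q.series hA hB hC (k.1 + 1, k.2) θ v u w) := by
      rw [laurentAct_sub_T_one_evalSum, shift_snd_cancel]
    have h3 : FormalSeries.derivOp (evalSum ℓ (Q.series hA hB hC (k.1, k.2) θ v u w)) =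
        evalSum ℓ (derivFst (Q.series hA hB hC (k.1, k.2) θ v u w)) -
          evalSum ℓ (derivSnd (Q.series hA hB hC (k.1, k.2) θ v u w)) := by
      rw [← map_sub, evalSum_deriv]
      rfl
    rw [LinearMap.comp_apply, h3, ← neg_sub (LaurentPolynomial.C (Complex.exp ℓ)) (T 1), map_neg,
      LinearMap.neg_apply, Q.series_conf_B, Q.series_conf_A, map_sub (evalSum ℓ),
      map_add (evalSum ℓ), map_add (evalSum ℓ), map_smul, map_smul,
      ← laurentAct_T_neg_one_evalSum, map_mul,
      Module.End.mul_apply, map_mul, Module.End.mul_apply, FormalSeries.laurentAct_C]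
    simp only [map_sub (FormalSeries.laurentAct _), map_add (FormalSeries.laurentAct _),
      map_smul (FormalSeries.laurentAct _), h2]
    module

end Systems

/-! ## The differential systems -/

section DifferentialSystems

open LaurentPolynomial

variable {V : Type v} [AddCommGroup V] [Module ℂ V] [VertexOperatorAlgebra V]

theorem WardSystem.exists_isFuchsianMatrix {W P Q S : NGradedModule.{v, u} V} {N : ℕ} {κ : Type}
    {M : Type*} [AddCommGroup M] [Module ℂ M] [Fintype κ] {act : ℂ[T;T⁻¹] →ₐ[ℂ] Module.End ℂ M}
    (X : WardSystem W P Q S N κ M act) (hP : P.C1Cofinite) (hQ : Q.C1Cofinite)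
    (J : DualBasis W N) (bP : HomogeneousBases P) (bQ : HomogeneousBases Q)
    (bS : HomogeneousBases S) {ι : Type u} [Fintype ι]
    (e : ι ≃ J.elems × bP.big × bQ.big × bS.big × κ) {I₀ : Set ι}
    (hI : ∀ i, i ∈ I₀ ↔ WardSystem.IsSmall (e i)) {c ε : ℂ} (hc : c ≠ 0) (hε : ‖ε‖ = 1)
    (ht : laurentValue X.t c = 0) :
    ∃ Λ : Matrix ι ι ℂ[T;T⁻¹],
      IsFuchsianMatrix Λ c ε I₀
        (shiftByGrades (finite_residueEigenvalues hP hQ).toFinset S bS.small) ∧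
      ∀ i, X.δ (X.G J bP bQ bS (e i)) = ∑ j, act (Λ i j) (X.G J bP bQ bS (e j)) := by
  obtain ⟨Λ, hcol, heig, hδ⟩ := X.exists_fuchsianMatrix hP hQ J bP bQ bS e hc ht
  refine ⟨Λ, ⟨fun i j => differentiableOn_laurentValue _ c ε hε,
    fun i j hj => hcol i j fun h => hj ((hI j).2 h), ?_⟩, hδ⟩
  rintro ⟨j, hj⟩
  ext μ
  simp only [nonzeroEigenvalues, shiftByGrades, Set.mem_ofPred_eq, Set.Finite.mem_toFinset]
  rw [and_comm]
  refine and_congr_left fun hμ => heig ⟨j, (hI j).1 hj⟩ μ hμ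

theorem laurentValue_T_sub_C {c : ℂ} (hc : c ≠ 0) :
    laurentValue (T 1 - LaurentPolynomial.C c) c = 0 := by
  rw [laurentValue_eq_laurentEval _ hc, map_sub, ← laurentValue_eq_laurentEval _ hc,
    ← laurentValue_eq_laurentEval _ hc, laurentValue_C, ← one_mul (T 1),
    ← map_one LaurentPolynomial.C, laurentValue_C_mul_T, one_mul, zpow_one, sub_self]

theorem laurentValue_C_sub_T {c : ℂ} (hc : c ≠ 0) :
    laurentValue (LaurentPolynomial.C c - T 1) c = 0 := by
  rw [← neg_sub, laurentValue_eq_laurentEval _ hc, map_neg, ← laurentValue_eq_laurentEval _ hc,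
    laurentValue_T_sub_C hc, neg_zero]

theorem truncatedSeries.shift_pow_coe (n : ℕ) (f : truncatedSeries) :
    ((truncatedSeries.shift ^ n) f).1 = FormalSeries.laurentMul (T 1 ^ n) f.1 := by
  ext e
  rw [T_pow, ← FormalSeries.laurentAct_apply, FormalSeries.laurentAct_T]
  induction n generalizing e with
  | zero => simp
  | succ n ih =>
    rw [pow_succ', Module.End.mul_apply, truncatedSeries.shift_apply, ih]
    push_cast
    ring_nf

/-- The equation for `t d/dt` becomes the one for `d/dt` after a shift of exponents by one. -/
theorem solvesAtPole_of_euler {ι : Type u} [Fintype ι] {Λ : Matrix ι ι ℂ[T;T⁻¹]} {c ε : ℂ}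
    (hc : c ≠ 0) (G : ι → truncatedSeries)
    (h : ∀ i, truncatedSeries.euler (G i) =
      ∑ j, truncatedSeries.expansionAct c ε hc (Λ i j) (G j)) :
    SolvesAtPole Λ c ε fun i => (G i).1 := by
  intro i
  ext e
  rw [← FormalSeries.laurentAct_apply, FormalSeries.laurentAct_T]
  have := congrFun (congrArg Subtype.val (h i)) (e - ((-1 : ℤ) : ℂ))
  simp only [AddSubmonoidClass.coe_finsetSum, Finset.sum_apply,
    truncatedSeries.expansionAct_eq, truncatedSeries.powerOp_coe] at this
  rw [Finset.sum_apply, ← this]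
  change _ = (e - ((-1 : ℤ) : ℂ)) * _
  rw [Int.cast_neg, Int.cast_one, sub_neg_eq_add]
  rfl

theorem solvesInVariable_of_laurentAct {ι : Type u} [Fintype ι] {Λ : Matrix ι ι ℂ[T;T⁻¹]} {c : ℂ}
    (G : ι → FormalSeries)
    (h : ∀ i, (FormalSeries.laurentAct (T 1 - LaurentPolynomial.C c) ∘ₗ FormalSeries.derivOp)
      (G i) = ∑ j, FormalSeries.laurentAct (Λ i j) (G j)) :
    SolvesInVariable Λ c G := by
  intro i
  simp only [← FormalSeries.laurentAct_apply]
  exact h i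

variable {A B C : NGradedModule.{v, u} V} {W : NGradedModule.{v, u} V} {N : ℕ} (J : DualBasis W N)
  (bA : HomogeneousBases A) (bB : HomogeneousBases B) (bC : HomogeneousBases C) (K₁ K₂ : ℕ)

/-- The components in the order `B`, `C`, `A`. -/
def FourPointIndex.rotate : FourPointIndex J bA bB bC K₁ K₂ ≃
    J.elems × bB.big × bC.big × bA.big × (Fin (K₁ + 1) × Fin (K₂ + 1)) where
  toFun i := (i.1, i.2.2.1, i.2.2.2.1, i.2.1, i.2.2.2.2)
  invFun i := (i.1, i.2.2.2.1, i.2.1, i.2.2.1, i.2.2.2.2)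
  left_inv _ := rfl
  right_inv _ := rfl

variable {J bA bB bC K₁ K₂}

theorem mem_smallIndex_iff (i : FourPointIndex J bA bB bC K₁ K₂) :
    i ∈ smallIndex J bA bB bC K₁ K₂ ↔
      WardSystem.IsSmall (κ := Fin (K₁ + 1) × Fin (K₂ + 1)) i :=
  Iff.rfl

theorem mem_smallIndex_iff_rotate (i : FourPointIndex J bA bB bC K₁ K₂) :
    i ∈ smallIndex J bA bB bC K₁ K₂ ↔
      WardSystem.IsSmall (FourPointIndex.rotate J bA bB bC K₁ K₂ i) :=
  ⟨fun h => ⟨h.2.1, h.2.2, h.1⟩, fun h => ⟨h.2.2, h.1, h.2.1⟩⟩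

theorem grade₃_rotate (v : A) (u : B) (w : C) :
    grade₃ v u w = B.grade u + C.grade w + A.grade v := by
  rw [grade₃]
  omega

section Entries

variable (hA : A.C1Cofinite) (hB : B.C1Cofinite) (hC : C.C1Cofinite) (ℓ : ℂ)

theorem RightFusion.wardSystemY_G (P : RightFusion A B C) (J : DualBasis P.ABC N)
    (i : P.Index J bA bB bC) :
    ((P.wardSystemY hA hB hC ℓ N).G J bB bC bA (FourPointIndex.rotate J bA bB bC _ _ i)).1 =
      P.Gy J bA bB bC ℓ i := by
  obtain ⟨θ, v, u, w, h, k⟩ := i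
  have ht : truncatedSeries.expansionAct (Complex.exp ℓ) (-1) (Complex.exp_ne_zero ℓ)
      (LaurentPolynomial.C (Complex.exp ℓ) - T 1) = truncatedSeries.shift := by
    ext1 f
    rw [map_sub, LinearMap.sub_apply, expansionAct_C_apply, expansionAct_T_one_apply]
    module
  change (truncatedSeries.expansionAct (Complex.exp ℓ) (-1) (Complex.exp_ne_zero ℓ)
    ((LaurentPolynomial.C (Complex.exp ℓ) - T 1) ^ _) _).1 = _
  rw [map_pow, ht, truncatedSeries.shift_pow_coe]
  change _ = FormalSeries.laurentMul (T 1 ^ grade₃ v.1 u.1 w.1) _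
  rw [grade₃_rotate]
  rfl

theorem LeftFusion.wardSystemX_G (Q : LeftFusion A B C) (J : DualBasis Q.ABC N)
    (i : Q.Index J bA bB bC) :
    ((Q.wardSystemX hA hB hC ℓ N).G J bA bB bC i).1 = Q.Gxy J bA bB bC ℓ i := by
  obtain ⟨θ, v, u, w, h, k⟩ := i
  have ht : truncatedSeries.expansionAct (Complex.exp ℓ) 1 (Complex.exp_ne_zero ℓ)
      (T 1 - LaurentPolynomial.C (Complex.exp ℓ)) = truncatedSeries.shift := by
    ext1 f
    rw [map_sub, LinearMap.sub_apply, expansionAct_C_apply, expansionAct_T_one_apply]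
    module
  change (truncatedSeries.expansionAct (Complex.exp ℓ) 1 (Complex.exp_ne_zero ℓ)
    ((T 1 - LaurentPolynomial.C (Complex.exp ℓ)) ^ _) _).1 = _
  rw [map_pow, ht, truncatedSeries.shift_pow_coe]
  rfl

theorem RightFusion.wardSystemX_G (P : RightFusion A B C) (J : DualBasis P.ABC N)
    (i : P.Index J bA bB bC) :
    (P.wardSystemX hA hB hC ℓ N).G J bA bB bC i = P.Gxy J bA bB bC ℓ i := by
  obtain ⟨θ, v, u, w, h, k⟩ := i
  exact FormalSeries.laurentAct_apply _ _

theorem LeftFusion.wardSystemY_G (Q : LeftFusion A B C) (J : DualBasis Q.ABC N)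
    (i : Q.Index J bA bB bC) :
    (Q.wardSystemY hA hB hC ℓ N).G J bB bC bA (FourPointIndex.rotate J bA bB bC _ _ i) =
      Q.Gy J bA bB bC ℓ i := by
  obtain ⟨θ, v, u, w, h, k⟩ := i
  change _ = FormalSeries.laurentMul
    ((LaurentPolynomial.C (Complex.exp ℓ) - T 1) ^ grade₃ v.1 u.1 w.1) _
  rw [grade₃_rotate]
  exact FormalSeries.laurentAct_apply _ _

end Entries

variable (bA bB bC)

theorem RightFusion.exists_solvesAtPole (hA : A.C1Cofinite) (hB : B.C1Cofinite) (hC : C.C1Cofinite)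
    (ℓ : ℂ) (P : RightFusion A B C) (J : DualBasis P.ABC N) :
    ∃ Λ : Matrix (P.Index J bA bB bC) (P.Index J bA bB bC) ℂ[T;T⁻¹],
      IsFuchsianMatrix Λ (Complex.exp ℓ) (-1) (P.small J bA bB bC)
        (shiftByGrades (finite_residueEigenvalues hB hC).toFinset A bA.small) ∧
      SolvesAtPole Λ (Complex.exp ℓ) (-1) (P.Gy J bA bB bC ℓ) := by
  obtain ⟨Λ, hΛ, hδ⟩ := (P.wardSystemY hA hB hC ℓ N).exists_isFuchsianMatrix hB hC J bB bC bA
    (FourPointIndex.rotate J bA bB bC _ _) mem_smallIndex_iff_rotate (Complex.exp_ne_zero ℓ)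
    (ε := -1) (by simp) (laurentValue_C_sub_T (Complex.exp_ne_zero ℓ))
  refine ⟨Λ, hΛ, ?_⟩
  rw [← funext (P.wardSystemY_G hA hB hC ℓ J)]
  exact solvesAtPole_of_euler _ _ hδ

theorem LeftFusion.exists_solvesAtPole (hA : A.C1Cofinite) (hB : B.C1Cofinite) (hC : C.C1Cofinite)
    (ℓ : ℂ) (Q : LeftFusion A B C) (J : DualBasis Q.ABC N) :
    ∃ Λ : Matrix (Q.Index J bA bB bC) (Q.Index J bA bB bC) ℂ[T;T⁻¹],
      IsFuchsianMatrix Λ (Complex.exp ℓ) 1 (Q.small J bA bB bC)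
        (shiftByGrades (finite_residueEigenvalues hA hB).toFinset C bC.small) ∧
      SolvesAtPole Λ (Complex.exp ℓ) 1 (Q.Gxy J bA bB bC ℓ) := by
  obtain ⟨Λ, hΛ, hδ⟩ := (Q.wardSystemX hA hB hC ℓ N).exists_isFuchsianMatrix hA hB J bA bB bC
    (Equiv.refl (Q.Index J bA bB bC)) mem_smallIndex_iff (Complex.exp_ne_zero ℓ)
    (ε := 1) (by simp) (laurentValue_T_sub_C (Complex.exp_ne_zero ℓ))
  refine ⟨Λ, hΛ, ?_⟩
  rw [← funext (Q.wardSystemX_G hA hB hC ℓ J)]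
  exact solvesAtPole_of_euler _ _ hδ

theorem RightFusion.exists_solvesInVariable (hA : A.C1Cofinite) (hB : B.C1Cofinite)
    (hC : C.C1Cofinite)
    (ℓ : ℂ) (P : RightFusion A B C) (J : DualBasis P.ABC N) :
    ∃ Λ : Matrix (P.Index J bA bB bC) (P.Index J bA bB bC) ℂ[T;T⁻¹],
      IsFuchsianMatrix Λ (Complex.exp ℓ) 1 (P.small J bA bB bC)
        (shiftByGrades (finite_residueEigenvalues hA hB).toFinset C bC.small) ∧
      SolvesInVariable Λ (Complex.exp ℓ) (P.Gxy J bA bB bC ℓ) := by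
  obtain ⟨Λ, hΛ, hδ⟩ := (P.wardSystemX hA hB hC ℓ N).exists_isFuchsianMatrix hA hB J bA bB bC
    (Equiv.refl (P.Index J bA bB bC)) mem_smallIndex_iff (Complex.exp_ne_zero ℓ)
    (ε := 1) (by simp) (laurentValue_T_sub_C (Complex.exp_ne_zero ℓ))
  refine ⟨Λ, hΛ, ?_⟩
  rw [← funext (P.wardSystemX_G hA hB hC ℓ J)]
  exact solvesInVariable_of_laurentAct _ hδ

theorem LeftFusion.exists_solvesInVariable (hA : A.C1Cofinite) (hB : B.C1Cofinite)
    (hC : C.C1Cofinite)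
    (ℓ : ℂ) (Q : LeftFusion A B C) (J : DualBasis Q.ABC N) :
    ∃ Λ : Matrix (Q.Index J bA bB bC) (Q.Index J bA bB bC) ℂ[T;T⁻¹],
      IsFuchsianMatrix Λ (Complex.exp ℓ) (-1) (Q.small J bA bB bC)
        (shiftByGrades (finite_residueEigenvalues hB hC).toFinset A bA.small) ∧
      SolvesInVariable Λ (Complex.exp ℓ) (Q.Gy J bA bB bC ℓ) := by
  obtain ⟨Λ, hΛ, hδ⟩ := (Q.wardSystemY hA hB hC ℓ N).exists_isFuchsianMatrix hB hC J bB bC bA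
    (FourPointIndex.rotate J bA bB bC _ _) mem_smallIndex_iff_rotate (Complex.exp_ne_zero ℓ)
    (ε := -1) (by simp) (laurentValue_C_sub_T (Complex.exp_ne_zero ℓ))
  refine ⟨Λ, hΛ, ?_⟩
  rw [← funext (Q.wardSystemY_G hA hB hC ℓ J)]
  exact solvesInVariable_of_laurentAct _ hδ

end DifferentialSystems

end

theorem theorem3p2 {V : Type v} [AddCommGroup V] [Module ℂ V] [VertexOperatorAlgebra V] :
    -- the spaces `W^∨₍≤N₎` are finite dimensional and all specializations are finite sums
    (∀ A B C : NGradedModule.{v, u} V, A.C1Cofinite → B.C1Cofinite → C.C1Cofinite →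
      (∀ P : RightFusion A B C, ∀ N : ℕ, FiniteDimensional ℂ (P.ABC.dualLE N) ∧
        ∀ θ ∈ P.ABC.dualLE N, ∀ (v : A) (u : B) (w : C) (h k : ℕ),
          (P.F h k θ v u w).RowColumnFinite) ∧
      (∀ Q : LeftFusion A B C, ∀ N : ℕ, FiniteDimensional ℂ (Q.ABC.dualLE N) ∧
        ∀ θ ∈ Q.ABC.dualLE N, ∀ (v : A) (u : B) (w : C) (h k : ℕ),
          (Q.F h k θ v u w).RowColumnFinite)) ∧
    -- the systems in `y` with pole at `y = 0`
    (∀ B C : NGradedModule.{v, u} V, B.C1Cofinite → C.C1Cofinite → ∃ E : Finset ℂ,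
      ∀ A : NGradedModule.{v, u} V, A.C1Cofinite →
      ∀ (bA : HomogeneousBases A) (bB : HomogeneousBases B) (bC : HomogeneousBases C)
        (x₀ : ℂ), x₀ ≠ 0 → ∀ ℓ : ℂ, Complex.exp ℓ = x₀ → ∀ N : ℕ,
      (∀ (P : RightFusion A B C) (J : DualBasis P.ABC N),
        ∃ Λ : Matrix (P.Index J bA bB bC) (P.Index J bA bB bC) ℂ[T;T⁻¹],
          IsFuchsianMatrix Λ x₀ (-1) (P.small J bA bB bC) (shiftByGrades E A bA.small) ∧
          SolvesAtPole Λ x₀ (-1) (P.Gy J bA bB bC ℓ)) ∧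
      (∀ (Q : LeftFusion A B C) (J : DualBasis Q.ABC N),
        ∃ Λ : Matrix (Q.Index J bA bB bC) (Q.Index J bA bB bC) ℂ[T;T⁻¹],
          IsFuchsianMatrix Λ x₀ (-1) (Q.small J bA bB bC) (shiftByGrades E A bA.small) ∧
          SolvesInVariable Λ x₀ (Q.Gy J bA bB bC ℓ))) ∧
    -- the systems in `x` with pole at `x = y₀`
    (∀ A B : NGradedModule.{v, u} V, A.C1Cofinite → B.C1Cofinite → ∃ E : Finset ℂ,
      ∀ C : NGradedModule.{v, u} V, C.C1Cofinite →
      ∀ (bA : HomogeneousBases A) (bB : HomogeneousBases B) (bC : HomogeneousBases C)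
        (y₀ : ℂ), y₀ ≠ 0 → ∀ ℓ : ℂ, Complex.exp ℓ = y₀ → ∀ N : ℕ,
      (∀ (P : RightFusion A B C) (J : DualBasis P.ABC N),
        ∃ Λ : Matrix (P.Index J bA bB bC) (P.Index J bA bB bC) ℂ[T;T⁻¹],
          IsFuchsianMatrix Λ y₀ 1 (P.small J bA bB bC) (shiftByGrades E C bC.small) ∧
          SolvesInVariable Λ y₀ (P.Gxy J bA bB bC ℓ)) ∧
      (∀ (Q : LeftFusion A B C) (J : DualBasis Q.ABC N),
        ∃ Λ : Matrix (Q.Index J bA bB bC) (Q.Index J bA bB bC) ℂ[T;T⁻¹],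
          IsFuchsianMatrix Λ y₀ 1 (Q.small J bA bB bC) (shiftByGrades E C bC.small) ∧
          SolvesAtPole Λ y₀ 1 (Q.Gxy J bA bB bC ℓ))) := by
  refine ⟨fun A B C hA hB hC => ⟨fun P N => ⟨P.ABC.finiteDimensional_dualLE
      (P.c1Cofinite_ABC hA hB hC) N, fun θ hθ v u w h k => ?_⟩,
    fun Q N => ⟨Q.ABC.finiteDimensional_dualLE (Q.c1Cofinite_ABC hA hB hC) N,
      fun θ hθ v u w h k => ?_⟩⟩,
    -- The set is fixed before the third module, the bases, the point and `N`, as it comes from the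
    -- two colliding modules only.
    fun B C hB hC => ⟨(finite_residueEigenvalues hB hC).toFinset, ?_⟩,
    fun A B hA hB => ⟨(finite_residueEigenvalues hA hB).toFinset, ?_⟩⟩
  -- The series for `A ⊠ (B ⊠ C)` has `y` as its first variable, so rows and columns are
  -- interchanged.
  · exact ⟨seriesSpace.finite_column (P.series hA hB hC (h, k) ⟨θ, hθ⟩ v u w),
      seriesSpace.finite_row (P.series hA hB hC (h, k) ⟨θ, hθ⟩ v u w)⟩
  · exact ⟨seriesSpace.finite_row (Q.series hA hB hC (h, k) ⟨θ, hθ⟩ v u w),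
      seriesSpace.finite_column (Q.series hA hB hC (h, k) ⟨θ, hθ⟩ v u w)⟩
  · rintro A hA bA bB bC _ - ℓ rfl N
    exact ⟨fun P J => P.exists_solvesAtPole bA bB bC hA hB hC ℓ J,
      fun Q J => Q.exists_solvesInVariable bA bB bC hA hB hC ℓ J⟩
  · rintro C hC bA bB bC _ - ℓ rfl N
    exact ⟨fun P J => P.exists_solvesInVariable bA bB bC hA hB hC ℓ J,
      fun Q J => Q.exists_solvesAtPole bA bB bC hA hB hC ℓ J⟩
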